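/- Let $\mathcal L$ be a compact connected Riemann surface and $\lambda:\mathcal L\to\mathbb{CP}^1$ a meromorphic function whose poles are exactly the $m+1$ distinct points $\infty_0,\dots,\infty_m$, the pole at $\infty_i$ having order $n_i+1\ge 1$, and whose finite ramification points are simple and lie over pairwise distinct branch points. Near $\infty_i$ use a local parameter $x_i=\lambda^{-1/(n_i+1)}$ on a small coordinate disc; the discs are pairwise disjoint. Fix $z\in\mathbb C\setminus\{0\}$. Let $\mathcal L^z$ be the surface with boundary obtained from $\mathcal L\setminus\{\infty_0,\dots,\infty_m\}$ by replacing every $\infty_i$ by its circle of directions (real oriented blow-up) and keeping of this circle only the $n_i+1$ open arcs on which $\pi/2<\arg\{z\lambda\}<3\pi/2$. Its boundary $\partial\mathcal L^z$ is the union of these arcs. Put $\Lambda^*(z)=H_1(\mathcal L^z,\partial\mathcal L^z;\mathbb C)$ (relative singular homology). For every $i$ choose one of the arcs at $\infty_i$ and number the arcs at $\infty_i$ by $0,1,\dots,n_i$ counterclockwise around $\infty_i$, starting with the chosen arc. Consider the following contours. 1. Closed curves $a_1,\dots,a_g,b_1,\dots,b_g$ in $\mathcal L\setminus\{\infty_0,\dots,\infty_m\}$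 whose classes form a basis of $H_1(\mathcal L;\mathbb Z)$ (for instance a canonical homology basis), where $g$ is the genus of $\mathcal L$. 2. For $i=1,\dots,m$, a circle $\mathcal V_i$ $\{|x_i|=\rho_i\}$ in the coordinate disc, going once counterclockwise around $\infty_i$. 3. For $i=1,\dots,m$, a path $\mathcal W_{0i}(z)$ in $\mathcal L^z$ from a point of arc number $0$ at $\infty_0$ to a point of arc number $0$ at $\infty_i$. 4. For $i=0,\dots,m$ and $\alpha=1,\dots,n_i$, a path $\mathcal T_{i;\alpha}(z)$ in $\mathcal L^z$ which stays in the blown-up coordinate disc of $\infty_i$, starts at a point of arc number $\alpha-1$ at $\infty_i$, turns counterclockwise around $\infty_i$ to the next arc, number $\alpha$, and ends at a point of that arc; that is, a continuous choice of $\arg x_i$ along the path moves from the sector of the arc $\alpha-1$ to the adjacent sector of the arc $\alpha$. Then the classes of these $n=2g+2m+\sum_{i=0}^m n_i$ contours form a basis of the complex vector space $\Lambda^*(z)$. -/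

import Mathlib

open scoped Manifold ContDiff

noncomputable section

/-! ### Singular homology of a pair in degree one -/

namespace SingularPair

/-- Singular `k`-simplices of `X`. -/
abbrev Simp (k : ℕ) (X : Type*) [TopologicalSpace X] := C(stdSimplex ℝ (Fin (k + 1)), X)

/-- Singular `k`-chains with coefficients in `R`: the free `R`-module on the singular simplices. -/
abbrev Chain (R : Type*) [CommRing R] (k : ℕ) (X : Type*) [TopologicalSpace X] :=
  Simp k X →₀ R

/-- The inclusion of the face of the standard simplex opposite to the vertex `i`. -/
def faceMap (k : ℕ) (i : Fin (k + 2)) :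
    C(stdSimplex ℝ (Fin (k + 1)), stdSimplex ℝ (Fin (k + 2))) :=
  ⟨stdSimplex.map i.succAbove, stdSimplex.continuous_map _⟩

/-- The singular boundary operator, `∂σ = ∑ i, (-1)^i σ ∘ δ_i`. -/
def boundary (R : Type*) [CommRing R] (k : ℕ) (X : Type*) [TopologicalSpace X] :
    Chain R (k + 1) X →ₗ[R] Chain R k X :=
  Finsupp.linearCombination R fun σ : Simp (k + 1) X =>
    ∑ i : Fin (k + 2), Finsupp.single (σ.comp (faceMap k i)) ((-1 : R) ^ (i : ℕ))

/-- The chains of `X` all of whose simplices lie in the subset `A`. -/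
def chainsIn (R : Type*) [CommRing R] (k : ℕ) {X : Type*} [TopologicalSpace X] (A : Set X) :
    Submodule R (Chain R k X) :=
  Finsupp.supported R R {σ : Simp k X | Set.range σ ⊆ A}

/-- Relative singular `1`-cycles: the `1`-chains of `X` whose boundary is a chain of `A`. -/
def relCycles (R : Type*) [CommRing R] {X : Type*} [TopologicalSpace X] (A : Set X) :
    Submodule R (Chain R 1 X) :=
  (chainsIn R 0 A).comap (boundary R 0 X)

/-- Relative singular `1`-boundaries: sums of a boundary in `X` and a `1`-chain of `A`. -/
def relBoundaries (R : Type*) [CommRing R] {X : Type*} [TopologicalSpace X] (A : Set X) :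
    Submodule R (Chain R 1 X) :=
  LinearMap.range (boundary R 1 X) ⊔ chainsIn R 1 A

/-- The first relative singular homology `H₁(X, A; R)`, the quotient of the relative cycles by the
relative boundaries, formed inside the quotient of all `1`-chains by the relative boundaries.
For `A = ∅` it is `H₁(X; R)`. -/
abbrev H1 (R : Type*) [CommRing R] (X : Type*) [TopologicalSpace X] (A : Set X) :=
  (relCycles R A).map (relBoundaries R A).mkQ

/-- A path regarded as a singular `1`-simplex. -/
def pathSimp {X : Type*} [TopologicalSpace X] {p q : X} (γ : Path p q) : Simp 1 X :=
  γ.toContinuousMap.comp (toContinuousMap stdSimplexHomeomorphUnitInterval)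

/-- A point regarded as a singular `0`-simplex. -/
def pointSimp {X : Type*} [TopologicalSpace X] (p : X) : Simp 0 X := ContinuousMap.const _ p

lemma pathSimp_face {X : Type*} [TopologicalSpace X] {p q : X} (γ : Path p q) :
    (pathSimp γ).comp (faceMap 0 0) = pointSimp q ∧
      (pathSimp γ).comp (faceMap 0 1) = pointSimp p := by
  have hv : ∀ s : stdSimplex ℝ (Fin 1), s = stdSimplex.vertex 0 := fun s => by
    apply stdSimplex.ext
    funext i
    fin_cases i
    simp
  constructor
  · ext s
    rw [hv s]
    simp only [pathSimp, faceMap, pointSimp, ContinuousMap.comp_apply, ContinuousMap.coe_mk,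
      stdSimplex.map_vertex, ContinuousMap.const_apply]
    change γ (stdSimplexHomeomorphUnitInterval (stdSimplex.vertex 1)) = q
    rw [show stdSimplexHomeomorphUnitInterval (stdSimplex.vertex 1) = 1 from
      stdSimplexHomeomorphUnitInterval_one]
    exact γ.target
  · ext s
    rw [hv s]
    simp only [pathSimp, faceMap, pointSimp, ContinuousMap.comp_apply, ContinuousMap.coe_mk,
      stdSimplex.map_vertex, ContinuousMap.const_apply]
    change γ (stdSimplexHomeomorphUnitInterval (stdSimplex.vertex 0)) = p
    rw [show stdSimplexHomeomorphUnitInterval (stdSimplex.vertex 0) = 0 from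
      stdSimplexHomeomorphUnitInterval_zero]
    exact γ.source

lemma boundary_path (R : Type*) [CommRing R] {X : Type*} [TopologicalSpace X] {p q : X}
    (γ : Path p q) :
    boundary R 0 X (Finsupp.single (pathSimp γ) 1) =
      Finsupp.single (pointSimp q) 1 - Finsupp.single (pointSimp p) 1 := by
  simp only [boundary, Finsupp.linearCombination_single, one_smul]
  rw [Fin.sum_univ_two, (pathSimp_face γ).1, (pathSimp_face γ).2]
  simp [sub_eq_add_neg]

/-- The class in `H₁(X, A; R)` of a closed path of `X`. -/
def loopClass (R : Type*) [CommRing R] {X : Type*} [TopologicalSpace X] (A : Set X) {p : X}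
    (γ : Path p p) : H1 R X A :=
  ⟨(relBoundaries R A).mkQ (Finsupp.single (pathSimp γ) 1), Submodule.mem_map_of_mem <| by
    rw [relCycles, Submodule.mem_comap, boundary_path, sub_self]
    exact Submodule.zero_mem _⟩

/-- The class in `H₁(X, A; R)` of a path of `X` with both end points in `A`. -/
def pathClass (R : Type*) [CommRing R] {X : Type*} [TopologicalSpace X] (A : Set X) {p q : X}
    (hp : p ∈ A) (hq : q ∈ A) (γ : Path p q) : H1 R X A :=
  ⟨(relBoundaries R A).mkQ (Finsupp.single (pathSimp γ) 1), Submodule.mem_map_of_mem <| by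
    have key : ∀ x ∈ A, Finsupp.single (pointSimp x) (1 : R) ∈ chainsIn R 0 A := by
      intro x hx
      refine Finsupp.single_mem_supported R 1 ?_
      rintro _ ⟨s, rfl⟩
      exact hx
    rw [relCycles, Submodule.mem_comap, boundary_path]
    exact Submodule.sub_mem _ (key q hq) (key p hp)⟩

end SingularPair

/-! ### Hurwitz coverings -/

/-- A point of the Hurwitz space with ramification profile `n 0, …, n m` over infinity: a
meromorphic function `fn` on the Riemann surface `L` (the values of `fn` at its poles are
irrelevant) with poles `∞_i = pole i` of order `n i + 1` and with simple, distinct finite branch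
points. At every pole we record a coordinate disc of the distinguished local parameter
`λ ^ (-1 / (n i + 1))`; the discs are small enough to be pairwise disjoint. -/
structure HurwitzCovering (L : Type*) [TopologicalSpace L] [ChartedSpace ℂ L]
    (m : ℕ) (n : Fin (m + 1) → ℕ) where
  /-- the covering map `λ`, away from its poles -/
  fn : L → ℂ
  /-- the points `∞_0, …, ∞_m` -/
  pole : Fin (m + 1) → L
  pole_injective : Function.Injective pole
  holomorphic : ∀ P, P ∉ Set.range pole → MDifferentiableAt 𝓘(ℂ) 𝓘(ℂ) fn P
  /-- the local parameter at `∞_i` -/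
  coord : Fin (m + 1) → OpenPartialHomeomorph L ℂ
  coord_mem : ∀ i, coord i ∈ IsManifold.maximalAtlas 𝓘(ℂ) ω L
  radius : Fin (m + 1) → ℝ
  radius_pos : ∀ i, 0 < radius i
  coord_target : ∀ i, (coord i).target = Metric.ball 0 (radius i)
  pole_mem : ∀ i, pole i ∈ (coord i).source
  coord_pole : ∀ i, coord i (pole i) = 0
  coord_disjoint : Pairwise fun i j => Disjoint (coord i).source (coord j).source
  fn_eq : ∀ i, ∀ P ∈ (coord i).source, P ≠ pole i → fn P = ((coord i P) ^ (n i + 1))⁻¹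
  /-- finite ramification points are simple: `dλ` has only simple zeros -/
  simple : ∀ P, P ∉ Set.range pole →
    deriv (fn ∘ (chartAt ℂ P).symm) (chartAt ℂ P P) = 0 →
    deriv (deriv (fn ∘ (chartAt ℂ P).symm)) (chartAt ℂ P P) ≠ 0
  /-- different finite ramification points lie over different branch points -/
  distinct : ∀ P Q, P ∉ Set.range pole → Q ∉ Set.range pole →
    deriv (fn ∘ (chartAt ℂ P).symm) (chartAt ℂ P P) = 0 →
    deriv (fn ∘ (chartAt ℂ Q).symm) (chartAt ℂ Q Q) = 0 → fn P = fn Q → P = Q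

namespace HurwitzCovering

variable {L : Type*} [TopologicalSpace L] [ChartedSpace ℂ L] {m : ℕ} {n : Fin (m + 1) → ℕ}
  (C : HurwitzCovering L m n)

/-- The surface `L` without the points at infinity. -/
abbrev Punctured := {P : L // P ∉ Set.range C.pole}

/-- The directions `u` at `∞_i` along which `π/2 < arg (z λ) < 3π/2`: in the local parameter,
`λ = ρ ^ (-(n i + 1)) u ^ (-(n i + 1))` at `ρ u`. -/
def arcs (_C : HurwitzCovering L m n) (z : ℂ) (i : Fin (m + 1)) : Set Circle :=
  {u | (z * ((u : ℂ) ^ (n i + 1))⁻¹).re < 0}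

/-- The points of the surface `L^z`: the punctured surface, together with those directions at the
points at infinity that belong to the open arcs `π/2 < arg (z λ) < 3π/2` of the boundary circles
of the blow-up. -/
inductive Blow (z : ℂ) : Type _
  | interior (P : C.Punctured) : Blow z
  | boundary (i : Fin (m + 1)) (u : C.arcs z i) : Blow z

/-- Polar coordinates `(ρ, u)` near the boundary circle over `∞_i`, without the closed arcs of the
circle `ρ = 0` that are left out. -/
abbrev Collar (z : ℂ) (i : Fin (m + 1)) :=
  {p : ℝ × Circle // 0 ≤ p.1 ∧ p.1 < C.radius i ∧ (p.1 = 0 → p.2 ∈ C.arcs z i)}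

lemma coord_symm_notMem (i : Fin (m + 1)) {w : ℂ} (hw : w ≠ 0) (hr : ‖w‖ < C.radius i) :
    (C.coord i).symm w ∉ Set.range C.pole := by
  have ht : w ∈ (C.coord i).target := by
    rw [C.coord_target]
    simpa using hr
  have hs := (C.coord i).map_target ht
  rintro ⟨j, hj⟩
  by_cases h : i = j
  · subst h
    apply hw
    rw [← (C.coord i).right_inv ht, ← hj, C.coord_pole]
  · refine Set.disjoint_left.1 (C.coord_disjoint h) hs ?_
    rw [← hj]
    exact C.pole_mem j

lemma norm_polar {ρ : ℝ} (h : 0 ≤ ρ) (u : Circle) : ‖(ρ : ℂ) * (u : ℂ)‖ = ρ := by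
  rw [norm_mul, Circle.norm_coe, mul_one, Complex.norm_real, Real.norm_of_nonneg h]

/-- The point of the punctured surface with local parameter `ρ u` at `∞_i`. -/
def polarPoint (i : Fin (m + 1)) (ρ : ℝ) (h0 : 0 < ρ) (hr : ρ < C.radius i) (u : Circle) :
    C.Punctured :=
  ⟨(C.coord i).symm ((ρ : ℂ) * (u : ℂ)), C.coord_symm_notMem i
    (mul_ne_zero (by exact_mod_cast h0.ne') u.coe_ne_zero) (by rwa [norm_polar h0.le])⟩

/-- The collar of the boundary circle over `∞_i` as a part of `L^z`. -/
def collarMap (z : ℂ) (i : Fin (m + 1)) (p : C.Collar z i) : C.Blow z :=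
  if h : p.1.1 = 0 then Blow.boundary i ⟨p.1.2, p.2.2.2 h⟩
  else Blow.interior (C.polarPoint i p.1.1 (lt_of_le_of_ne p.2.1 (Ne.symm h)) p.2.2.1 p.1.2)

/-- The topology of `L^z`, glued from the punctured surface and the collars: a set is open iff its
traces on the punctured surface and on all the collars are open. -/
instance instTopologicalSpaceBlow (z : ℂ) : TopologicalSpace (C.Blow z) :=
  TopologicalSpace.coinduced (fun P : C.Punctured => Blow.interior P) inferInstance ⊔
    ⨆ i, TopologicalSpace.coinduced (C.collarMap z i) inferInstance

lemma continuous_interior (z : ℂ) :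
    Continuous (fun P : C.Punctured => (Blow.interior P : C.Blow z)) :=
  continuous_iff_coinduced_le.2 le_sup_left

lemma continuous_collarMap (z : ℂ) (i : Fin (m + 1)) : Continuous (C.collarMap z i) :=
  continuous_iff_coinduced_le.2
    (le_sup_of_le_right (le_iSup (fun i => TopologicalSpace.coinduced (C.collarMap z i) _) i))

/-- The boundary `∂L^z`, a disjoint union of open arcs. -/
def bdry (z : ℂ) : Set (C.Blow z) := {x | ∃ i u, x = Blow.boundary i u}

/-- The space `Λ*(z) = H₁(L^z, ∂L^z)`, with complex coefficients. -/
abbrev LambdaStar (z : ℂ) := SingularPair.H1 ℂ (C.Blow z) (C.bdry z)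

/-- The arc number `β` at `∞_i`, in terms of the angle `θ` of the local parameter: as
`arg (z λ) = arg z - (n i + 1) θ`, these `θ` satisfy `π/2 < arg (z λ) < 3π/2` modulo `2π`.
The arcs `β` and `β + n i + 1` agree on the circle, and `β + 1` is the arc that follows `β`
counterclockwise around `∞_i`, i.e. the one on the next sheet. -/
def arcAngles (_C : HurwitzCovering L m n) (z : ℂ) (i : Fin (m + 1)) (β : ℤ) : Set ℝ :=
  Set.Ioo ((z.arg + Real.pi / 2 + 2 * Real.pi * β) / (n i + 1))
    ((z.arg + 3 * Real.pi / 2 + 2 * Real.pi * β) / (n i + 1))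

/-- The loop of radius `ρ` which encircles `∞_i` once counterclockwise. -/
def circleLoop (i : Fin (m + 1)) (ρ : ℝ) (h0 : 0 < ρ) (hr : ρ < C.radius i) :
    Path (C.polarPoint i ρ h0 hr 1) (C.polarPoint i ρ h0 hr 1) where
  toFun t := C.polarPoint i ρ h0 hr (Circle.exp (2 * Real.pi * (t : ℝ)))
  continuous_toFun := by
    refine Continuous.subtype_mk ?_ _
    refine (C.coord i).continuousOn_symm.comp_continuous (by fun_prop) fun t => ?_
    rw [C.coord_target, mem_ball_zero_iff, norm_polar h0.le]
    exact hr
  source' := by simp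
  target' := by simp

/-- The data of the contours `γ_k(z)` on a Hurwitz covering of genus `g`. -/
structure ContourSystem (g : ℕ) (z : ℂ) where
  /-- base points of the cycles `a_k` and `b_k` -/
  aBase : Fin g → C.Punctured
  bBase : Fin g → C.Punctured
  /-- the `a`- and `b`-cycles, closed curves avoiding the points at infinity -/
  a : ∀ k, Path (aBase k) (aBase k)
  b : ∀ k, Path (bBase k) (bBase k)
  /-- the cycles `a_k`, `b_k` represent a basis of the homology of the compact surface -/
  homologyBasis : ∃ B : Module.Basis (Fin g ⊕ Fin g) ℤ (SingularPair.H1 ℤ L ∅), ⇑B =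
    Sum.elim (fun k => SingularPair.loopClass ℤ ∅ ((a k).map continuous_subtype_val))
      (fun k => SingularPair.loopClass ℤ ∅ ((b k).map continuous_subtype_val))
  /-- radius of the loop around the point `∞_{i+1}` -/
  vRadius : Fin m → ℝ
  vRadius_pos : ∀ i, 0 < vRadius i
  vRadius_lt : ∀ i, vRadius i < C.radius i.succ
  /-- number of the arc at `∞_i` which lies on the first sheet (number `k_i`) at `∞_i` -/
  firstSheet : Fin (m + 1) → ℤ
  /-- directions in which the path from `∞_0` to `∞_{i+1}` leaves and arrives -/
  wStart : Fin m → C.arcs z 0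
  wEnd : ∀ i : Fin m, C.arcs z i.succ
  wStart_mem : ∀ i, ∃ θ ∈ C.arcAngles z 0 (firstSheet 0), (wStart i : Circle) = Circle.exp θ
  wEnd_mem : ∀ i : Fin m, ∃ θ ∈ C.arcAngles z i.succ (firstSheet i.succ),
    (wEnd i : Circle) = Circle.exp θ
  /-- the path from `∞_0` to `∞_{i+1}` -/
  w : ∀ i : Fin m, Path (Blow.boundary 0 (wStart i) : C.Blow z) (Blow.boundary i.succ (wEnd i))
  /-- the path which leaves `∞_i` on the sheet number `α` (counted from the first sheet at `∞_i`),
  goes counterclockwise around `∞_i` and comes back to `∞_i` on the next sheet, given by a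
  curve in polar coordinates at `∞_i` together with a continuous choice of the angle -/
  tStart : ∀ i, Fin (n i) → C.Collar z i
  tEnd : ∀ i, Fin (n i) → C.Collar z i
  t : ∀ i (α : Fin (n i)), Path (tStart i α) (tEnd i α)
  tAngle : ∀ i, Fin (n i) → C(unitInterval, ℝ)
  t_angle : ∀ i α s, (t i α s).1.2 = Circle.exp (tAngle i α s)
  tStart_radius : ∀ i α, (tStart i α).1.1 = 0
  tEnd_radius : ∀ i α, (tEnd i α).1.1 = 0
  tAngle_start : ∀ i (α : Fin (n i)),
    tAngle i α 0 ∈ C.arcAngles z i (firstSheet i + ((α : ℕ) : ℤ))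
  tAngle_end : ∀ i (α : Fin (n i)),
    tAngle i α 1 ∈ C.arcAngles z i (firstSheet i + ((α : ℕ) : ℤ) + 1)

lemma collarMap_mem_bdry (z : ℂ) (i : Fin (m + 1)) (p : C.Collar z i) (hp : p.1.1 = 0) :
    C.collarMap z i p ∈ C.bdry z := by
  rw [collarMap, dif_pos hp]
  exact ⟨i, _, rfl⟩

end HurwitzCovering

/-- Index set of the contours: the `a`-cycles, the `b`-cycles, the loops around
`∞_1, …, ∞_m`, the paths from `∞_0` to `∞_1, …, ∞_m`, and the `n i` paths from `∞_i` to itself. -/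
abbrev ContourIndex (g m : ℕ) (n : Fin (m + 1) → ℕ) :=
  (Fin g ⊕ Fin g) ⊕ (Fin m ⊕ (Fin m ⊕ (Σ i, Fin (n i))))

lemma card_contourIndex (g m : ℕ) (n : Fin (m + 1) → ℕ) :
    Fintype.card (ContourIndex g m n) = 2 * g + 2 * m + ∑ i, n i := by
  simp only [Fintype.card_sum, Fintype.card_fin, Fintype.card_sigma]
  ring

namespace HurwitzCovering

open SingularPair

variable {L : Type*} [TopologicalSpace L] [ChartedSpace ℂ L] {m : ℕ} {n : Fin (m + 1) → ℕ}
  {C : HurwitzCovering L m n}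

/-- The classes of the contours `γ_k(z)` in `Λ*(z)`. -/
def ContourSystem.contour {g : ℕ} {z : ℂ} (S : C.ContourSystem g z) :
    ContourIndex g m n → C.LambdaStar z
  | .inl (.inl k) => loopClass ℂ (C.bdry z) ((S.a k).map (C.continuous_interior z))
  | .inl (.inr k) => loopClass ℂ (C.bdry z) ((S.b k).map (C.continuous_interior z))
  | .inr (.inl i) => loopClass ℂ (C.bdry z)
      ((C.circleLoop i.succ (S.vRadius i) (S.vRadius_pos i) (S.vRadius_lt i)).map
        (C.continuous_interior z))
  | .inr (.inr (.inl i)) => pathClass ℂ (C.bdry z) ⟨_, _, rfl⟩ ⟨_, _, rfl⟩ (S.w i)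
  | .inr (.inr (.inr ⟨i, α⟩)) => pathClass ℂ (C.bdry z)
      (C.collarMap_mem_bdry z i _ (S.tStart_radius i α))
      (C.collarMap_mem_bdry z i _ (S.tEnd_radius i α))
      ((S.t i α).map (C.continuous_collarMap z i))

end HurwitzCovering

end

noncomputable section

open Topology Filter Set SingularPair

/-! ### Cocycles on paths and their primitives -/

/-! Everything is tested by duality. A functional on relative `H₁` is a cocycle on paths that
vanishes on the paths of the boundary (`homologyFunctional`, `exists_cocycle_of_functional`). Such a
cocycle has local primitives, and conversely local functions that differ by locally constant ones
integrate to a cocycle (`Coherent.exists_cocycle`). This is degree-one Čech cohomology and needs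
neither excision nor exact sequences.

Spanning. If the contours do not span, some nonzero functional kills them all; let `ψ` be its
cocycle. The loops around `∞_1, …, ∞_m` make the residues of `ψ` there vanish, and the residue at
`∞_0` vanishes because the residues sum to zero (`sum_residue_eq_zero`). The sum is computed by
tracing along `λ`: the sum of `ψ` over the sheets has a primitive on the simply connected plane,
whereas one turn around infinity permutes the sheets and changes the primitive by the total residue.
Without residues `ψ` extends to the compact surface (`exists_extension`). There it vanishes on an
integral homology basis, hence on every loop, and so it has a primitive. The primitive carries over
to the blow-up (`exists_prim_blow`) and is constant on each boundary arc. The paths `T` equate the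
constants of successive arcs at one pole and the paths `W` those of different poles
(`const_on_bdry`). A cocycle whose primitive is constant on the boundary gives the zero functional,
a contradiction.

Independence. The coefficients of a relation are killed one family at a time by test cocycles. The
increment of the indicator function of the arcs beyond number `α` at `∞_i` sees only one path `T`
(`coeff_t`), and the indicator of all the arcs at one pole sees only one `W` (`coeff_w`). With these
gone, the dual basis of the homology of the compact surface, pulled back by collapsing the boundary
circles, isolates each `a` and `b` (`coeff_ab`). The loops around the poles then need a cocycle with
opposite residues at `∞_i` and `∞_0` (`coeff_v`). It behaves like the logarithm of a function with
divisor `∞_i - ∞_0`; such a logarithm is written down for two nearby points and propagated by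
connectedness (`exists_hasWinding`), so no existence theorem for meromorphic functions or
differentials is needed. -/

/-- A function on the paths of `Y` is a cocycle if it is additive along the sides of the lower
triangle of every square; equivalently it defines a functional on singular `1`-chains which
vanishes on boundaries. -/
def IsCocycle {Y M : Type*} [TopologicalSpace Y] [AddCommGroup M]
    (ψ : C(unitInterval, Y) → M) : Prop :=
  ∀ H : C(ℝ × ℝ, Y), ψ ⟨fun s => H (s, 0), by fun_prop⟩ + ψ ⟨fun s => H (1, s), by fun_prop⟩ =
    ψ ⟨fun s => H (s, s), by fun_prop⟩

/-- `h` is a primitive of `ψ` near `y`. -/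
def IsPrimAt {Y M : Type*} [TopologicalSpace Y] [AddCommGroup M]
    (ψ : C(unitInterval, Y) → M) (h : Y → M) (y : Y) : Prop :=
  ∃ V ∈ 𝓝 y, ∀ γ : C(unitInterval, Y), (∀ t, γ t ∈ V) → ψ γ = h (γ 1) - h (γ 0)

/-- `k` is a primitive on `K` of the pull-back of `ψ` along `e`. -/
def IsPrimAlong {Y E M : Type*} [TopologicalSpace Y] [TopologicalSpace E] [AddCommGroup M]
    (ψ : C(unitInterval, Y) → M) (e : E → Y) (K : Set E) (k : E → M) : Prop :=
  ∀ (γ : C(unitInterval, E)) (η : C(unitInterval, Y)), (∀ t, γ t ∈ K) →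
    (∀ t, η t = e (γ t)) → ψ η = k (γ 1) - k (γ 0)

/-- A family of functions, `f y` being considered near `y`, whose members differ by locally
constant functions. -/
def Coherent {Y M : Type*} [TopologicalSpace Y] [AddCommGroup M] (f : Y → Y → M) : Prop :=
  ∀ y, ∀ᶠ x in 𝓝 y, ∀ᶠ x' in 𝓝 x, f y x' - f x x' = f y x - f x x

/-- `F` differs from every member of the family `f` by a locally constant function. -/
def IsPrimitive {Y M : Type*} [TopologicalSpace Y] [AddCommGroup M] (f : Y → Y → M)
    (F : Y → M) : Prop :=
  ∀ x, ∀ᶠ x' in 𝓝 x, F x' - f x x' = F x - f x x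

section Cocycle

variable {Y Z M : Type*} [TopologicalSpace Y] [TopologicalSpace Z] [AddCommGroup M]

theorem IsCocycle.comp {ψ : C(unitInterval, Y) → M} (hψ : IsCocycle ψ) (e : C(Z, Y)) :
    IsCocycle fun γ : C(unitInterval, Z) => ψ (e.comp γ) :=
  fun H => hψ (e.comp H)

theorem IsCocycle.const {ψ : C(unitInterval, Y) → M} (hψ : IsCocycle ψ) (y : Y) :
    ψ (ContinuousMap.const _ y) = 0 := by
  have := hψ (ContinuousMap.const _ y)
  exact left_eq_add.mp this.symm

theorem IsCocycle.square {ψ : C(unitInterval, Y) → M} (hψ : IsCocycle ψ) (H : C(ℝ × ℝ, Y)) :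
    ψ ⟨fun s => H (s, 0), by fun_prop⟩ + ψ ⟨fun s => H (1, s), by fun_prop⟩ =
    ψ ⟨fun s => H (0, s), by fun_prop⟩ + ψ ⟨fun s => H (s, 1), by fun_prop⟩ := by
  rw [hψ H]
  exact (hψ (H.comp ⟨Prod.swap, continuous_swap⟩)).symm

/-- A cocycle has a primitive along every map of a convex set. -/
theorem IsCocycle.exists_prim_of_convex {E : Type*} [AddCommGroup E] [Module ℝ E]
    [TopologicalSpace E] [ContinuousAdd E] [ContinuousSMul ℝ E]
    {ψ : C(unitInterval, Y) → M} (hψ : IsCocycle ψ) {K : Set E} (hK : Convex ℝ K)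
    {e : E → Y} (he : ContinuousOn e K) :
    ∃ k : E → M, IsPrimAlong ψ e K k := by
  classical
  rcases K.eq_empty_or_nonempty with rfl | ⟨x₀, hx₀⟩
  · exact ⟨0, fun γ η h => absurd (h 0) (notMem_empty _)⟩
  have hmem : ∀ x ∈ K, ∀ u : unitInterval, (1 - (u : ℝ)) • x₀ + (u : ℝ) • x ∈ K := fun x hx u =>
    hK hx₀ hx (by linarith [u.2.2]) u.2.1 (by ring)
  have hseg : ∀ x ∈ K, Continuous fun u : unitInterval =>
      e ((1 - (u : ℝ)) • x₀ + (u : ℝ) • x) := fun x hx =>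
    he.comp_continuous (by fun_prop) (hmem x hx)
  -- The primitive at `x` is the value of `ψ` on the segment from `x₀` to `x`. Along `γ` it is
  -- compared by the square identity for the cone from `x₀` over `γ`, one side of which is constant.
  -- Clamping by `projIcc` keeps the cone inside `K`, the only place where `e` is continuous.
  refine ⟨fun x => if hx : x ∈ K then ψ ⟨_, hseg x hx⟩ else 0, fun γ η hγ hη => ?_⟩
  beta_reduce
  rw [dif_pos (hγ 1), dif_pos (hγ 0)]
  have hH : Continuous fun p : ℝ × ℝ => e
      ((1 - (projIcc (0 : ℝ) 1 zero_le_one p.1 : ℝ)) • x₀ +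
        (projIcc (0 : ℝ) 1 zero_le_one p.1 : ℝ) • γ (projIcc (0 : ℝ) 1 zero_le_one p.2)) :=
    he.comp_continuous (by fun_prop) fun p => hmem _ (hγ _) _
  have key := hψ.square ⟨_, hH⟩
  have h1 : (⟨fun s : unitInterval => (⟨_, hH⟩ : C(ℝ × ℝ, Y)) (1, (s : ℝ)), by fun_prop⟩ :
      C(unitInterval, Y)) = η := by
    ext s
    simp [hη, projIcc_val]
  have h2 : (⟨fun s : unitInterval => (⟨_, hH⟩ : C(ℝ × ℝ, Y)) (0, (s : ℝ)), by fun_prop⟩ :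
      C(unitInterval, Y)) = ContinuousMap.const _ (e x₀) := by
    ext s
    simp
  have h3 : (⟨fun s : unitInterval => (⟨_, hH⟩ : C(ℝ × ℝ, Y)) ((s : ℝ), 0), by fun_prop⟩ :
      C(unitInterval, Y)) = ⟨_, hseg _ (hγ 0)⟩ := by
    ext s
    simp [projIcc_val]
  have h4 : (⟨fun s : unitInterval => (⟨_, hH⟩ : C(ℝ × ℝ, Y)) ((s : ℝ), 1), by fun_prop⟩ :
      C(unitInterval, Y)) = ⟨_, hseg _ (hγ 1)⟩ := by
    ext s
    simp [projIcc_val]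
  rw [h1, h2, h3, h4, hψ.const, zero_add] at key
  exact eq_sub_of_add_eq' key

theorem IsPrimAt.eventually {ψ : C(unitInterval, Y) → M} {h : Y → M} {y : Y}
    (hh : IsPrimAt ψ h y) : ∀ᶠ x in 𝓝 y, IsPrimAt ψ h x := by
  obtain ⟨V, hV, H⟩ := hh
  filter_upwards [eventually_mem_nhds_iff.2 hV] with x hx
  exact ⟨V, hx, H⟩

theorem IsPrimAt.congr {ψ : C(unitInterval, Y) → M} {h h' : Y → M} {y : Y}
    (hh : IsPrimAt ψ h y) (c : M) (he : ∀ᶠ x in 𝓝 y, h' x = h x + c) : IsPrimAt ψ h' y := by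
  obtain ⟨V, hV, H⟩ := hh
  refine ⟨_, inter_mem hV he, fun γ hγ => ?_⟩
  rw [H γ fun t => (hγ t).1, (hγ 1).2, (hγ 0).2]
  abel

/-- Along a short path from `y` to `x` both functions have the increment prescribed by `ψ`. This is
what makes a choice of local primitives coherent. -/
theorem IsPrimAt.sub_eventually_eq [LocallyPathConnectedSpace Y] {ψ : C(unitInterval, Y) → M}
    {h h' : Y → M} {y : Y} (hh : IsPrimAt ψ h y) (hh' : IsPrimAt ψ h' y) :
    ∀ᶠ x in 𝓝 y, h x - h' x = h y - h' y := by
  obtain ⟨V, hV, H⟩ := hh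
  obtain ⟨V', hV', H'⟩ := hh'
  obtain ⟨W, ⟨hW, hWc⟩, hWV⟩ := (path_connected_basis y).mem_iff.1 (inter_mem hV hV')
  filter_upwards [hW] with x hx
  obtain ⟨γ, hγ⟩ := hWc.joinedIn y (mem_of_mem_nhds hW) x hx
  have h1 := H γ.toContinuousMap fun t => (hWV (hγ t)).1
  have h2 := H' γ.toContinuousMap fun t => (hWV (hγ t)).2
  have e0 : γ.toContinuousMap 0 = y := γ.source
  have e1 : γ.toContinuousMap 1 = x := γ.target
  rw [e0, e1] at h1 h2
  have := h1.symm.trans h2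
  rw [sub_eq_sub_iff_add_eq_add] at this ⊢
  rw [this]
  abel

/-- Primitives along a map which has a local section into a convex set. -/
theorem isPrimAt_of_section {E : Type*} [TopologicalSpace E] {ψ : C(unitInterval, Y) → M}
    {K : Set E} {e : E → Y} {k : E → M}
    (hk : IsPrimAlong ψ e K k)
    {V : Set Y} {y : Y} (hV : V ∈ 𝓝 y) {s : Y → E} (hs : ContinuousOn s V)
    (hsK : MapsTo s V K) (hes : ∀ v ∈ V, e (s v) = v) : IsPrimAt ψ (k ∘ s) y :=
  ⟨V, hV, fun γ hγ => hk ⟨fun t => s (γ t), hs.comp_continuous γ.continuous hγ⟩ γ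
    (fun t => hsK (hγ t)) fun t => (hes _ (hγ t)).symm⟩

/-- The difference is locally constant, hence constant. Global comparisons of primitives rest on
this. -/
theorem eq_of_eventually_sub_eq [PreconnectedSpace Y] {F G : Y → M}
    (h : ∀ y, ∀ᶠ x in 𝓝 y, F x - G x = F y - G y) (x y : Y) : F x - F y = G x - G y := by
  have hloc := (IsLocallyConstant.iff_eventually_eq fun x => F x - G x).2 h
  have := hloc.apply_eq_of_preconnectedSpace x y
  rw [sub_eq_sub_iff_add_eq_add] at this ⊢
  rw [add_comm, add_comm (G x), ← this, add_comm]

/-- A cocycle has a primitive along every path. -/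
theorem IsCocycle.exists_prim_path {ψ : C(unitInterval, Y) → M} (hψ : IsCocycle ψ)
    (γ : C(unitInterval, Y)) : ∃ F : unitInterval → M, ψ γ = F 1 - F 0 ∧
      ∀ (h : Y → M) (t : unitInterval), IsPrimAt ψ h (γ t) →
        ∀ᶠ t' in 𝓝 t, F t' - h (γ t') = F t - h (γ t) := by
  obtain ⟨k, hk⟩ := (hψ.comp γ).exists_prim_of_convex (convex_Icc (0 : ℝ) 1)
    (e := projIcc (0 : ℝ) 1 zero_le_one) continuous_projIcc.continuousOn
  have h1 := hk ⟨fun t => (t : ℝ), continuous_subtype_val⟩ (ContinuousMap.id _) (fun t => t.2)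
    (fun t => (projIcc_val _ t).symm)
  beta_reduce at h1
  rw [show γ.comp (ContinuousMap.id _) = γ from rfl] at h1
  refine ⟨fun t => k t, h1, fun h t hh => ?_⟩
  obtain ⟨V, hV, H⟩ := hh
  have hV' := γ.continuous.continuousAt.preimage_mem_nhds hV
  obtain ⟨ε, hε, hεV⟩ := Metric.mem_nhds_iff.1 hV'
  filter_upwards [Metric.ball_mem_nhds t hε] with t' ht'
  have hc : ∀ u : unitInterval, (1 - (u : ℝ)) * t + u * t' ∈ Icc (0 : ℝ) 1 := fun u =>
    (convex_Icc (0 : ℝ) 1) t.2 t'.2 (by linarith [u.2.2]) u.2.1 (by ring)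
  -- The piece of `γ` between `t` and `t'` stays where `h` is a primitive, so `k` and `h` both
  -- compute `ψ` on it.
  let p : C(unitInterval, unitInterval) := ⟨fun u => ⟨_, hc u⟩, by fun_prop⟩
  have hp0 : p 0 = t := Subtype.ext (by simp [p])
  have hp1 : p 1 = t' := Subtype.ext (by simp [p])
  have e1 := hk ⟨fun u => (p u : ℝ), by fun_prop⟩ p (fun u => (p u).2)
    (fun u => (projIcc_val _ _).symm)
  have e2 := H (γ.comp p) fun u => by
    refine hεV ?_
    rw [Metric.mem_ball, Subtype.dist_eq, Real.dist_eq] at ht' ⊢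
    have : ((p u : unitInterval) : ℝ) - t = u * (t' - t) := by
      simp only [p, ContinuousMap.coe_mk]
      ring
    rw [this, abs_mul, abs_of_nonneg u.2.1]
    nlinarith [u.2.2, u.2.1, abs_nonneg ((t' : ℝ) - t)]
  simp only [ContinuousMap.coe_mk, ContinuousMap.comp_apply, hp0, hp1] at e1 e2
  have := e1.symm.trans e2
  rw [sub_eq_sub_iff_add_eq_add] at this ⊢
  rw [this]
  abel

/-- A function that is a primitive near every point is a primitive. -/
theorem IsCocycle.eq_sub_of_isPrimAt {ψ : C(unitInterval, Y) → M} (hψ : IsCocycle ψ)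
    {γ : C(unitInterval, Y)} {h : Y → M} (hh : ∀ t, IsPrimAt ψ h (γ t)) :
    ψ γ = h (γ 1) - h (γ 0) := by
  obtain ⟨F, hF, H⟩ := hψ.exists_prim_path γ
  rw [hF]
  exact eq_of_eventually_sub_eq (G := fun t => h (γ t)) (fun t => H h t (hh t)) 1 0

/-- The segment from `x` to `y`. -/
def segPath {E : Type*} [AddCommGroup E] [Module ℝ E] [TopologicalSpace E] [ContinuousAdd E]
    [ContinuousSMul ℝ E] (x y : E) : C(unitInterval, E) :=
  ⟨fun t => (1 - (t : ℝ)) • x + (t : ℝ) • y, by fun_prop⟩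

theorem segPath_zero {E : Type*} [AddCommGroup E] [Module ℝ E] [TopologicalSpace E]
    [ContinuousAdd E] [ContinuousSMul ℝ E] (x y : E) : segPath x y 0 = x := by
  simp [segPath]

theorem segPath_one {E : Type*} [AddCommGroup E] [Module ℝ E] [TopologicalSpace E]
    [ContinuousAdd E] [ContinuousSMul ℝ E] (x y : E) : segPath x y 1 = y := by
  simp [segPath]

theorem segPath_mem {E : Type*} [AddCommGroup E] [Module ℝ E] [TopologicalSpace E]
    [ContinuousAdd E] [ContinuousSMul ℝ E] {K : Set E} (hK : Convex ℝ K) {x y : E} (hx : x ∈ K)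
    (hy : y ∈ K) (t : unitInterval) : segPath x y t ∈ K :=
  hK hx hy (by linarith [t.2.2]) t.2.1 (by ring)

theorem IsPrimAlong.segment {E : Type*} [AddCommGroup E] [Module ℝ E] [TopologicalSpace E]
    [ContinuousAdd E] [ContinuousSMul ℝ E] {ψ : C(unitInterval, Y) → M} {e : E → Y} {K : Set E}
    {k : E → M} (hk : IsPrimAlong ψ e K k) (hK : Convex ℝ K) {x y : E} (hx : x ∈ K) (hy : y ∈ K)
    {η : C(unitInterval, Y)} (hη : ∀ t, η t = e (segPath x y t)) : ψ η = k y - k x := by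
  have := hk (segPath x y) η (segPath_mem hK hx hy) hη
  simpa [segPath] using this

/-- A chart provides a section into a ball, which is convex. -/
theorem OpenPartialHomeomorph.exists_isPrimAt {E : Type*} [NormedAddCommGroup E]
    [NormedSpace ℝ E] (φ : OpenPartialHomeomorph Y E) {ψ : C(unitInterval, Y) → M}
    (hψ : IsCocycle ψ) {y : Y} (hy : y ∈ φ.source) : ∃ h : Y → M, IsPrimAt ψ h y := by
  obtain ⟨ε, hε, hb⟩ := Metric.isOpen_iff.1 φ.open_target _ (φ.map_source hy)
  obtain ⟨k, hk⟩ := hψ.exists_prim_of_convex (convex_ball (φ y) ε) (φ.continuousOn_symm.mono hb)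
  exact ⟨_, isPrimAt_of_section hk
    (inter_mem (φ.open_source.mem_nhds hy) ((φ.continuousAt hy).preimage_mem_nhds
      (Metric.ball_mem_nhds _ hε))) (φ.continuousOn.mono inter_subset_left) (fun v hv => hv.2)
    fun v hv => φ.left_inv hv.1⟩

end Cocycle

/-! ### Integration of coherent families -/

section Coherent

variable {Y Z M : Type*} [TopologicalSpace Y] [TopologicalSpace Z] [AddCommGroup M]

theorem Coherent.comp {f : Y → Y → M} (hf : Coherent f) {e : Z → Y} (he : Continuous e) :
    Coherent fun z z' => f (e z) (e z') := fun z =>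
  (he.continuousAt.eventually (hf (e z))).mono fun _ hx => he.continuousAt.eventually hx

theorem IsPrimitive.comp {f : Y → Y → M} {F : Y → M} (hF : IsPrimitive f F) {e : Z → Y}
    (he : Continuous e) : IsPrimitive (fun z z' => f (e z) (e z')) fun z => F (e z) := fun z =>
  he.continuousAt.eventually (hF (e z))

theorem IsPrimitive.sub_eq [PreconnectedSpace Y] {f : Y → Y → M} {F G : Y → M}
    (hF : IsPrimitive f F) (hG : IsPrimitive f G) (x y : Y) : F x - F y = G x - G y := by
  refine eq_of_eventually_sub_eq (fun y => ?_) x y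
  filter_upwards [hF y, hG y] with x h1 h2
  rw [sub_eq_sub_iff_add_eq_add] at h1 h2 ⊢
  have : F x + G y + (f y y + f y x) = F y + G x + (f y y + f y x) := by
    calc F x + G y + (f y y + f y x) = (F x + f y y) + (G y + f y x) := by abel
      _ = (F y + f y x) + (G x + f y y) := by rw [h1, h2]
      _ = _ := by abel
  exact add_right_cancel this

/-- The principal bundle with discrete fibre `M` attached to a coherent family. -/
def Coherent.core [TopologicalSpace M] [DiscreteTopology M] {f : Y → Y → M} (hf : Coherent f) :
    FiberBundleCore Y Y M where
  baseSet y := interior {x | ∀ᶠ x' in 𝓝 x, f y x' - f x x' = f y x - f x x}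
  isOpen_baseSet _ := isOpen_interior
  indexAt := id
  mem_baseSet_at x := mem_interior_iff_mem_nhds.2 (hf x)
  coordChange i j x v := v + f i x - f j x
  coordChange_self i x _ v := by abel
  continuousOn_coordChange i j := by
    rintro ⟨x, v⟩ ⟨⟨hi, hj⟩, -⟩
    refine ContinuousAt.continuousWithinAt ?_
    have hi := interior_subset hi
    have hj := interior_subset hj
    refine ContinuousAt.congr (f := fun p : Y × M => p.2 + f i x - f j x)
      (Continuous.continuousAt ?_) ?_
    · exact (continuous_of_discreteTopology (f := fun m : M => m + f i x - f j x)).comp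
        continuous_snd
    · filter_upwards [continuous_fst.continuousAt.eventually hi,
        continuous_fst.continuousAt.eventually hj] with p h1 h2
      rw [add_sub_assoc, add_sub_assoc]
      congr 1
      have := congrArg₂ (· - ·) h1 h2
      simp only [sub_sub_sub_cancel_right] at this
      exact this.symm
  coordChange_comp i j k x _ v := by abel

/-- A coherent family on a simply connected space has a global primitive. -/
theorem Coherent.exists_isPrimitive [SimplyConnectedSpace Y] [LocallyPathConnectedSpace Y]
    {f : Y → Y → M} (hf : Coherent f) : ∃ F : Y → M, IsPrimitive f F := by
  let _ : TopologicalSpace M := ⊥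
  have _ : DiscreteTopology M := ⟨rfl⟩
  obtain ⟨y₀⟩ : Nonempty Y := inferInstance
  have hcov : IsCoveringMap (Bundle.TotalSpace.proj : Bundle.TotalSpace M hf.core.Fiber → Y) :=
    FiberBundle.isCoveringMap
  -- The lift of the identity is a continuous section. Its coordinate at `x` is `v x` in the
  -- trivialisation of index `x`, and adding `f x x` makes the differences with `f y` locally
  -- constant.
  obtain ⟨s, ⟨-, hs⟩, -⟩ := hcov.existsUnique_continuousMap_lifts (ContinuousMap.id Y) y₀
    ⟨y₀, (0 : M)⟩ rfl
  have hs' : ∀ x, (s x).proj = x := fun x => congrFun hs x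
  let v : Y → M := fun x => (s x).snd
  refine ⟨fun x => v x + f x x, fun y => ?_⟩
  have hc : ContinuousAt (fun x => (hf.core.localTriv y (s x)).2) y := by
    refine continuous_snd.continuousAt.comp
      (ContinuousAt.comp (f := s) ?_ s.continuous.continuousAt)
    refine (hf.core.localTriv y).continuousOn_toFun.continuousAt ?_
    refine (hf.core.localTriv y).open_source.mem_nhds ?_
    rw [FiberBundleCore.mem_localTriv_source, hs']
    exact hf.core.mem_baseSet_at y
  have hev := hc.preimage_mem_nhds (isOpen_discrete {(hf.core.localTriv y (s y)).2} |>.mem_nhds rfl)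
  filter_upwards [hev] with x hx
  rw [mem_preimage, mem_singleton_iff, FiberBundleCore.localTriv_apply,
    FiberBundleCore.localTriv_apply] at hx
  have hx' : v x + f (s x).proj (s x).proj - f y (s x).proj =
    v y + f (s y).proj (s y).proj - f y (s y).proj := hx
  rw [hs', hs'] at hx'
  exact hx'

/-- A coherent family integrates to a cocycle. -/
theorem Coherent.exists_cocycle {f : Y → Y → M} (hf : Coherent f) :
    ∃ ψ : C(unitInterval, Y) → M, IsCocycle ψ ∧ (∀ y, IsPrimAt ψ (f y) y) ∧
      ∀ (γ : C(unitInterval, Y)) (F : unitInterval → M),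
        IsPrimitive (fun t t' => f (γ t) (γ t')) F → ψ γ = F 1 - F 0 := by
  have hex : ∀ γ : C(unitInterval, Y), ∃ F : ℝ → M, IsPrimitive
      (fun t t' => f (γ (projIcc 0 1 zero_le_one t)) (γ (projIcc 0 1 zero_le_one t'))) F :=
    fun γ => (hf.comp (γ.continuous.comp continuous_projIcc)).exists_isPrimitive
  choose F hF using hex
  have key : ∀ (γ : C(unitInterval, Y)) (G : unitInterval → M),
      IsPrimitive (fun t t' => f (γ t) (γ t')) G → F γ 1 - F γ 0 = G 1 - G 0 := fun γ G hG => by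
    have h := (hF γ).comp (continuous_subtype_val : Continuous ((↑) : unitInterval → ℝ))
    simp only [projIcc_val] at h
    simpa using h.sub_eq hG 1 0
  refine ⟨fun γ => F γ 1 - F γ 0, fun H => ?_, fun y => ?_, key⟩
  -- A single primitive over the whole plane computes the three sides of the triangle, and
  -- increments add up.
  · obtain ⟨G, hG⟩ := (hf.comp H.continuous).exists_isPrimitive
    have hc : ∀ e : C(unitInterval, ℝ × ℝ), F (H.comp e) 1 - F (H.comp e) 0 =
      G (e 1) - G (e 0) := fun e => key _ (fun t => G (e t)) (hG.comp e.continuous)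
    have h1 := hc ⟨fun s => (s, 0), by fun_prop⟩
    have h2 := hc ⟨fun s => (1, s), by fun_prop⟩
    have h3 := hc ⟨fun s => (s, s), by fun_prop⟩
    refine (congrArg₂ (· + ·) h1 h2).trans (Eq.trans ?_ h3.symm)
    simp
  · refine ⟨_, hf y, fun γ hγ => key γ (fun t => f y (γ t)) fun t => ?_⟩
    exact γ.continuous.continuousAt.eventually (hγ t)

end Coherent

/-! ### Cocycles and singular homology -/

section Singular

/-- The triangle `0 ≤ v ≤ u ≤ 1` as the standard simplex, extended to the plane. -/
def planeToSimplex : C(ℝ × ℝ, stdSimplex ℝ (Fin 3)) where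
  toFun p := ⟨![1 - (projIcc (0 : ℝ) 1 zero_le_one p.1 : ℝ),
      (projIcc (0 : ℝ) 1 zero_le_one p.1 : ℝ) -
        min (projIcc (0 : ℝ) 1 zero_le_one p.1 : ℝ) (projIcc (0 : ℝ) 1 zero_le_one p.2 : ℝ),
      min (projIcc (0 : ℝ) 1 zero_le_one p.1 : ℝ) (projIcc (0 : ℝ) 1 zero_le_one p.2 : ℝ)], by
    refine ⟨fun i => ?_, ?_⟩
    · have h1 := (projIcc (0 : ℝ) 1 zero_le_one p.1).2
      have h2 := (projIcc (0 : ℝ) 1 zero_le_one p.2).2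
      fin_cases i
      · simpa using h1.2
      · simp
      · exact le_min h1.1 h2.1
    · simp [Fin.sum_univ_three]⟩
  continuous_toFun := by
    refine Continuous.subtype_mk (continuous_pi fun i => ?_) _
    fin_cases i <;> simp <;> fun_prop

/-- The square collapsed onto the standard simplex. -/
def simplexToPlane : C(stdSimplex ℝ (Fin 3), ℝ × ℝ) where
  toFun t := (t 1 + t 2, t 2)
  continuous_toFun := by
    have h : ∀ i, Continuous fun t : stdSimplex ℝ (Fin 3) => t i := fun i =>
      (continuous_apply i).comp continuous_subtype_val
    exact ((h 1).add (h 2)).prodMk (h 2)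

variable {Y M : Type*} [TopologicalSpace Y]

/-- A singular `1`-simplex regarded as a map on the unit interval. -/
def simpPath (σ : Simp 1 Y) : C(unitInterval, Y) :=
  σ.comp (toContinuousMap stdSimplexHomeomorphUnitInterval.symm)

/-- A map on the unit interval regarded as a singular `1`-simplex. -/
def pathToSimp (γ : C(unitInterval, Y)) : Simp 1 Y :=
  γ.comp (toContinuousMap stdSimplexHomeomorphUnitInterval)

theorem simpPath_pathToSimp (γ : C(unitInterval, Y)) : simpPath (pathToSimp γ) = γ := by
  ext s
  simp [simpPath, pathToSimp]

theorem pathToSimp_simpPath (σ : Simp 1 Y) : pathToSimp (simpPath σ) = σ := by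
  ext s
  simp [simpPath, pathToSimp]

theorem faceMap_apply (i : Fin 3) (s : stdSimplex ℝ (Fin 2)) (j : Fin 3) :
    faceMap 1 i s j = ∑ k ∈ Finset.univ.filter (fun k => i.succAbove k = j), s k := by
  simp [faceMap, stdSimplex.map_coe, FunOnFinite.linearMap_apply_apply]

theorem homeo_symm_apply (s : unitInterval) :
    stdSimplexHomeomorphUnitInterval.symm s 0 = 1 - s ∧
      stdSimplexHomeomorphUnitInterval.symm s 1 = s := ⟨rfl, rfl⟩

theorem planeToSimplex_apply (p : ℝ × ℝ) : (planeToSimplex p : Fin 3 → ℝ) =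
    ![1 - (projIcc (0 : ℝ) 1 zero_le_one p.1 : ℝ),
      (projIcc (0 : ℝ) 1 zero_le_one p.1 : ℝ) -
        min (projIcc (0 : ℝ) 1 zero_le_one p.1 : ℝ) (projIcc (0 : ℝ) 1 zero_le_one p.2 : ℝ),
      min (projIcc (0 : ℝ) 1 zero_le_one p.1 : ℝ) (projIcc (0 : ℝ) 1 zero_le_one p.2 : ℝ)] := rfl

theorem face_eq (s : unitInterval) :
    faceMap 1 2 (stdSimplexHomeomorphUnitInterval.symm s) = planeToSimplex (s, 0) ∧
    faceMap 1 1 (stdSimplexHomeomorphUnitInterval.symm s) = planeToSimplex (s, s) ∧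
    faceMap 1 0 (stdSimplexHomeomorphUnitInterval.symm s) = planeToSimplex (1, s) := by
  have := homeo_symm_apply s
  have h0 := s.2.1
  have h1 := s.2.2
  have e := projIcc_val (zero_le_one (α := ℝ)) s
  refine ⟨?_, ?_, ?_⟩ <;>
  · apply stdSimplex.ext
    funext j
    rw [faceMap_apply, planeToSimplex_apply]
    fin_cases j <;> simp [Finset.sum_filter, this, e, Fin.succAbove, Fin.lt_def, h0, h1]

theorem simplexToPlane_planeToSimplex {u v : ℝ} (hv : 0 ≤ v) (hvu : v ≤ u) (hu : u ≤ 1) :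
    simplexToPlane (planeToSimplex (u, v)) = (u, v) := by
  have e1 : (projIcc (0 : ℝ) 1 zero_le_one u : ℝ) = u :=
    congrArg Subtype.val (projIcc_of_mem zero_le_one ⟨hv.trans hvu, hu⟩)
  have e2 : (projIcc (0 : ℝ) 1 zero_le_one v : ℝ) = v :=
    congrArg Subtype.val (projIcc_of_mem zero_le_one ⟨hv, hvu.trans hu⟩)
  change (planeToSimplex (u, v) 1 + planeToSimplex (u, v) 2, planeToSimplex (u, v) 2) = _
  rw [planeToSimplex_apply]
  simp [e1, e2, hvu]

theorem boundary_single (R : Type*) [CommRing R] (σ : Simp 2 Y) :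
    boundary R 1 Y (Finsupp.single σ 1) =
      Finsupp.single (σ.comp (faceMap 1 0)) 1 - Finsupp.single (σ.comp (faceMap 1 1)) 1 +
        Finsupp.single (σ.comp (faceMap 1 2)) 1 := by
  simp [boundary, Fin.sum_univ_three, sub_eq_add_neg]

variable [AddCommGroup M]

/-- A functional on singular chains which vanishes on boundaries is a cocycle. -/
theorem isCocycle_of_boundary {R : Type*} [CommRing R] [Module R M] (Φ : Chain R 1 Y →ₗ[R] M)
    (hΦ : ∀ c, Φ (boundary R 1 Y c) = 0) :
    IsCocycle fun γ => Φ (Finsupp.single (pathToSimp γ) 1) := by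
  intro H
  have h := hΦ (Finsupp.single (H.comp simplexToPlane) 1)
  have key : ∀ (i : Fin 3) (γ : C(unitInterval, ℝ × ℝ)), (∀ s, simplexToPlane
      (faceMap 1 i (stdSimplexHomeomorphUnitInterval.symm s)) = γ s) →
      (H.comp simplexToPlane).comp (faceMap 1 i) = pathToSimp (H.comp γ) := by
    intro i γ hγ
    rw [← pathToSimp_simpPath ((H.comp simplexToPlane).comp (faceMap 1 i))]
    congr 1
    ext s
    exact congrArg H (hγ s)
  rw [boundary_single, map_add, map_sub,
    key 0 ⟨fun s => (1, s), by fun_prop⟩ fun s => by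
      rw [(face_eq s).2.2, simplexToPlane_planeToSimplex s.2.1 s.2.2 le_rfl]; rfl,
    key 1 ⟨fun s => (s, s), by fun_prop⟩ fun s => by
      rw [(face_eq s).2.1, simplexToPlane_planeToSimplex s.2.1 le_rfl s.2.2]; rfl,
    key 2 ⟨fun s => (s, 0), by fun_prop⟩ fun s => by
      rw [(face_eq s).1, simplexToPlane_planeToSimplex le_rfl s.2.1 s.2.2]; rfl] at h
  rw [sub_add_eq_add_sub, sub_eq_zero, add_comm] at h
  exact h

/-- The functional on singular chains given by a cocycle. -/
def chainMap (R : Type*) [CommRing R] [Module R M] (ψ : C(unitInterval, Y) → M) :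
    Chain R 1 Y →ₗ[R] M :=
  Finsupp.linearCombination R fun σ => ψ (simpPath σ)

theorem chainMap_single (R : Type*) [CommRing R] [Module R M] (ψ : C(unitInterval, Y) → M)
    (γ : C(unitInterval, Y)) :
    chainMap R ψ (Finsupp.single (pathToSimp γ) 1) = ψ γ := by
  simp [chainMap, simpPath_pathToSimp]

theorem chainMap_boundary (R : Type*) [CommRing R] [Module R M] {ψ : C(unitInterval, Y) → M}
    (hψ : IsCocycle ψ) (c : Chain R 2 Y) : chainMap R ψ (boundary R 1 Y c) = 0 := by
  suffices (chainMap R ψ).comp (boundary R 1 Y) = 0 from LinearMap.congr_fun this c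
  refine Finsupp.lhom_ext' fun σ => LinearMap.ext_ring ?_
  have h := hψ (σ.comp planeToSimplex)
  have key : ∀ (i : Fin 3) (γ : C(unitInterval, ℝ × ℝ)), (∀ s,
      faceMap 1 i (stdSimplexHomeomorphUnitInterval.symm s) = planeToSimplex (γ s)) →
      σ.comp (faceMap 1 i) = pathToSimp ((σ.comp planeToSimplex).comp γ) := by
    intro i γ hγ
    rw [← pathToSimp_simpPath (σ.comp (faceMap 1 i))]
    congr 1
    ext s
    exact congrArg σ (hγ s)
  simp only [LinearMap.comp_apply, Finsupp.lsingle_apply, LinearMap.zero_apply]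
  rw [boundary_single, map_add, map_sub,
    key 0 ⟨fun s => (1, s), by fun_prop⟩ fun s => (face_eq s).2.2,
    key 1 ⟨fun s => (s, s), by fun_prop⟩ fun s => (face_eq s).2.1,
    key 2 ⟨fun s => (s, 0), by fun_prop⟩ fun s => (face_eq s).1,
    chainMap_single, chainMap_single, chainMap_single, sub_add_eq_add_sub, sub_eq_zero, add_comm]
  exact h

theorem relBoundaries_le_ker {R : Type*} [CommRing R] [Module R M] {ψ : C(unitInterval, Y) → M}
    (hψ : IsCocycle ψ) {A : Set Y} (hA : ∀ γ : C(unitInterval, Y), (∀ t, γ t ∈ A) → ψ γ = 0) :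
    relBoundaries R A ≤ LinearMap.ker (chainMap R ψ) := by
  refine sup_le ?_ ?_
  · rintro _ ⟨c, rfl⟩
    exact chainMap_boundary R hψ c
  · rw [chainsIn, Finsupp.supported_eq_span_single, Submodule.span_le]
    rintro _ ⟨σ, hσ, rfl⟩
    rw [SetLike.mem_coe, LinearMap.mem_ker, ← pathToSimp_simpPath σ, chainMap_single]
    exact hA _ fun t => hσ ⟨_, rfl⟩

/-- The functional on relative homology given by a cocycle which vanishes on the paths of `A`. -/
def homologyFunctional (R : Type*) [CommRing R] [Module R M] {ψ : C(unitInterval, Y) → M}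
    (hψ : IsCocycle ψ) {A : Set Y} (hA : ∀ γ : C(unitInterval, Y), (∀ t, γ t ∈ A) → ψ γ = 0) :
    H1 R Y A →ₗ[R] M :=
  ((relBoundaries R A).liftQ (chainMap R ψ) (relBoundaries_le_ker hψ hA)).comp
    (Submodule.subtype _)

theorem homologyFunctional_loopClass (R : Type*) [CommRing R] [Module R M]
    {ψ : C(unitInterval, Y) → M}
    (hψ : IsCocycle ψ) {A : Set Y} (hA : ∀ γ : C(unitInterval, Y), (∀ t, γ t ∈ A) → ψ γ = 0)
    {p : Y} (γ : Path p p) :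
    homologyFunctional R hψ hA (loopClass R A γ) = ψ γ.toContinuousMap :=
  chainMap_single R ψ γ.toContinuousMap

theorem homologyFunctional_pathClass (R : Type*) [CommRing R] [Module R M]
    {ψ : C(unitInterval, Y) → M}
    (hψ : IsCocycle ψ) {A : Set Y} (hA : ∀ γ : C(unitInterval, Y), (∀ t, γ t ∈ A) → ψ γ = 0)
    {p q : Y} (hp : p ∈ A) (hq : q ∈ A) (γ : Path p q) :
    homologyFunctional R hψ hA (pathClass R A hp hq γ) = ψ γ.toContinuousMap :=
  chainMap_single R ψ γ.toContinuousMap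

/-- The cocycle of increments of a function. -/
theorem isCocycle_increment (h : Y → M) :
    IsCocycle fun γ : C(unitInterval, Y) => h (γ 1) - h (γ 0) := by
  intro H
  simp

/-- Every functional on relative homology comes from a cocycle, and it vanishes if the cocycle is
the increment of a function constant on `A`. -/
theorem exists_cocycle_of_functional {K : Type*} [Field K] {A : Set Y} (φ : H1 K Y A →ₗ[K] K) :
    ∃ ψ : C(unitInterval, Y) → K, IsCocycle ψ ∧
      (∀ γ : C(unitInterval, Y), (∀ t, γ t ∈ A) → ψ γ = 0) ∧
      (∀ (p : Y) (γ : Path p p), φ (loopClass K A γ) = ψ γ.toContinuousMap) ∧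
      (∀ (p q : Y) (hp : p ∈ A) (hq : q ∈ A) (γ : Path p q),
        φ (pathClass K A hp hq γ) = ψ γ.toContinuousMap) ∧
      ∀ (h : Y → K) (c : K), (∀ γ, ψ γ = h (γ 1) - h (γ 0)) → (∀ a ∈ A, h a = c) → φ = 0 := by
  -- `φ` only sees relative cycles. Over a field it extends to the quotient of all `1`-chains and
  -- can then be evaluated on single paths.
  obtain ⟨Φ, hΦ⟩ := LinearMap.exists_extend φ
  have hΦ' : ∀ x : H1 K Y A, Φ x = φ x := fun x => LinearMap.congr_fun hΦ x
  have hb : ∀ c ∈ relBoundaries K A, (Φ.comp (relBoundaries K A).mkQ) c = 0 := fun c hc => by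
    rw [LinearMap.comp_apply, Submodule.mkQ_apply, (Submodule.Quotient.mk_eq_zero _).2 hc, map_zero]
  refine ⟨fun γ => Φ.comp (relBoundaries K A).mkQ (Finsupp.single (pathToSimp γ) 1),
    isCocycle_of_boundary _ fun c => hb _ (Submodule.mem_sup_left ⟨c, rfl⟩), fun γ hγ => ?_,
    fun p γ => (hΦ' _).symm, fun p q hp hq γ => (hΦ' _).symm, fun h c hh hc => ?_⟩
  · refine hb _ (Submodule.mem_sup_right (Finsupp.single_mem_supported K 1 ?_))
    rintro _ ⟨s, rfl⟩
    exact hγ _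
  -- Subtracting `c` changes nothing on the boundary of a `1`-simplex, whose coefficients sum to
  -- zero, but it makes the `0`-cochain vanish on `A`, where relative cycles have their boundary.
  · have hz : Φ.comp (relBoundaries K A).mkQ =
        (Finsupp.linearCombination K fun σ : Simp 0 Y => h (σ default) - c).comp
          (boundary K 0 Y) := by
      refine Finsupp.lhom_ext' fun σ => LinearMap.ext_ring ?_
      have := hh (simpPath σ)
      beta_reduce at this
      rw [pathToSimp_simpPath] at this
      refine this.trans ?_
      let γ : Path (simpPath σ 0) (simpPath σ 1) := ⟨simpPath σ, rfl, rfl⟩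
      have hγ := boundary_path K γ
      rw [show pathSimp γ = σ from pathToSimp_simpPath σ] at hγ
      simp [hγ, pointSimp]
    refine LinearMap.ext fun x => ?_
    obtain ⟨y, hy, hyx⟩ := x.2
    rw [← hΦ', ← hyx]
    refine (LinearMap.congr_fun hz y).trans ?_
    have hy : boundary K 0 Y y ∈ chainsIn K 0 A := hy
    rw [chainsIn, Finsupp.mem_supported] at hy
    rw [LinearMap.comp_apply, Finsupp.linearCombination_apply, Finsupp.sum]
    refine Finset.sum_eq_zero fun σ hσ => ?_
    rw [hc _ (hy hσ ⟨default, rfl⟩), sub_self, smul_zero]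

theorem IsCocycle.trans {ψ : C(unitInterval, Y) → M} (hψ : IsCocycle ψ) {x y z : Y}
    (γ : Path x y) (γ' : Path y z) :
    ψ (γ.trans γ').toContinuousMap = ψ γ.toContinuousMap + ψ γ'.toContinuousMap := by
  -- The bottom side runs through the first half of the concatenation, the right side through the
  -- second, and the diagonal through all of it.
  have h := hψ ⟨fun p => (γ.trans γ').extend (p.1 / 2 + p.2 / 2), by fun_prop⟩
  refine Eq.trans ?_ (h.symm.trans ?_)
  · congr 1
    ext s
    change _ = (γ.trans γ').extend ((s : ℝ) / 2 + s / 2)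
    rw [add_halves]
    simp
  · congr 2
    · ext s
      change (γ.trans γ').extend ((s : ℝ) / 2 + 0 / 2) = _
      have hs : (s : ℝ) / 2 ∈ unitInterval := ⟨by linarith [s.2.1], by linarith [s.2.2]⟩
      rw [zero_div, add_zero, Path.extend_apply _ hs, Path.trans_apply, dif_pos (by
        have := s.2.2; show (s : ℝ) / 2 ≤ 1 / 2; linarith)]
      refine congrArg γ (Subtype.ext ?_)
      show 2 * ((s : ℝ) / 2) = s
      ring
    · ext s
      change (γ.trans γ').extend ((1 : ℝ) / 2 + s / 2) = γ' s
      have hs : (1 : ℝ) / 2 + s / 2 ∈ unitInterval :=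
        ⟨by linarith [s.2.1], by linarith [s.2.2]⟩
      rw [Path.extend_apply _ hs, Path.trans_apply]
      split_ifs with h'
      · have h0 : s = 0 := Subtype.ext (by
          have := s.2.1; change (1 : ℝ) / 2 + s / 2 ≤ 1 / 2 at h'; change (s : ℝ) = 0; linarith)
        subst h0
        rw [γ'.source]
        convert γ.target
        simp
      · refine congrArg γ' (Subtype.ext ?_)
        show 2 * ((1 : ℝ) / 2 + s / 2) - 1 = s
        ring

theorem IsCocycle.symm {ψ : C(unitInterval, Y) → M} (hψ : IsCocycle ψ) {x y : Y}
    (γ : Path x y) : ψ γ.symm.toContinuousMap = - ψ γ.toContinuousMap := by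
  -- The bottom side is `γ`, the right side its reverse, and the diagonal is constant.
  have h := hψ ⟨fun p => γ.extend (p.1 - p.2), by fun_prop⟩
  rw [eq_neg_iff_add_eq_zero, add_comm]
  refine Eq.trans ?_ (h.trans ?_)
  · congr 2
    · ext s
      simp
    · ext s
      change _ = γ.extend (1 - s)
      rw [Path.extend_apply γ (⟨by linarith [s.2.2], by linarith [s.2.1]⟩)]
      rfl
  · rw [← hψ.const x]
    congr 1
    ext s
    simp

/-- A cocycle vanishing on closed paths is the increment of a function. -/
theorem IsCocycle.exists_prim_of_loops [PathConnectedSpace Y] {ψ : C(unitInterval, Y) → M}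
    (hψ : IsCocycle ψ) (hl : ∀ (p : Y) (γ : Path p p), ψ γ.toContinuousMap = 0) :
    ∃ h : Y → M, ∀ γ, ψ γ = h (γ 1) - h (γ 0) := by
  obtain ⟨y₀⟩ : Nonempty Y := inferInstance
  let p : ∀ y, Path y₀ y := PathConnectedSpace.somePath y₀
  refine ⟨fun y => ψ (p y).toContinuousMap, fun γ => ?_⟩
  have h := hl y₀ (((p (γ 0)).trans ⟨γ, rfl, rfl⟩).trans (p (γ 1)).symm)
  rw [hψ.trans, hψ.trans, hψ.symm, add_neg_eq_zero] at h
  exact eq_sub_of_add_eq' h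

/-- A cocycle vanishing on closed curves which generate the integral homology vanishes on all
closed paths. -/
theorem IsCocycle.loop_eq_zero_of_basis {ψ : C(unitInterval, Y) → M} (hψ : IsCocycle ψ)
    {ι : Type*} (B : Module.Basis ι ℤ (H1 ℤ Y ∅))
    (hB : ∀ i, homologyFunctional ℤ hψ (A := ∅) (fun _ h => (h 0).elim) (B i) = 0)
    {p : Y} (γ : Path p p) : ψ γ.toContinuousMap = 0 := by
  rw [← homologyFunctional_loopClass ℤ hψ (A := ∅) (fun _ h => (h 0).elim) γ,
    B.ext (f₂ := 0) fun i => (hB i).trans rfl, LinearMap.zero_apply]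

/-- An additive functional on the integral homology is given by a cocycle. -/
theorem exists_cocycle_of_integral_functional [PathConnectedSpace Y] (φ : H1 ℤ Y ∅ →+ M) :
    ∃ ψ : C(unitInterval, Y) → M, IsCocycle ψ ∧
      ∀ (p : Y) (γ : Path p p), ψ γ.toContinuousMap = φ (loopClass ℤ ∅ γ) := by
  obtain ⟨y₀⟩ : Nonempty Y := inferInstance
  let u : C(unitInterval, Y) → Chain ℤ 1 Y := fun γ => Finsupp.single (pathToSimp γ) 1
  let q : Y → Chain ℤ 1 Y := fun y => u (PathConnectedSpace.somePath y₀ y).toContinuousMap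
  -- Over `ℤ` the functional need not extend to all chains, as `M` may fail to be injective. Each
  -- path is therefore closed up by chosen paths from `y₀`; the corrections telescope in the cocycle
  -- identity and cancel on loops.
  let v : C(unitInterval, Y) → Chain ℤ 1 Y := fun γ => u γ + q (γ 0) - q (γ 1)
  have hv : ∀ γ, v γ ∈ relCycles ℤ (∅ : Set Y) := by
    intro γ
    have h1 := boundary_path ℤ (⟨γ, rfl, rfl⟩ : Path (γ 0) (γ 1))
    have h2 := fun y => boundary_path ℤ (PathConnectedSpace.somePath y₀ y)
    have h3 : boundary ℤ 0 Y (v γ) = 0 := by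
      rw [map_sub, map_add]
      refine (congrArg₂ _ (congrArg₂ _ h1 (h2 _)) (h2 _)).trans ?_
      abel
    rw [relCycles, Submodule.mem_comap, h3]
    exact Submodule.zero_mem _
  have hc := isCocycle_of_boundary (relBoundaries ℤ (∅ : Set Y)).mkQ fun c => by
    rw [Submodule.mkQ_apply, Submodule.Quotient.mk_eq_zero]
    exact Submodule.mem_sup_left ⟨c, rfl⟩
  refine ⟨fun γ => φ ⟨(relBoundaries ℤ (∅ : Set Y)).mkQ (v γ), Submodule.mem_map_of_mem (hv γ)⟩,
    fun H => ?_, fun p γ => ?_⟩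
  · beta_reduce
    rw [← map_add]
    refine congrArg φ (Subtype.ext ?_)
    have := hc H
    simp only [Submodule.coe_add, v, map_add, map_sub, u] at this ⊢
    rw [← this]
    simp only [ContinuousMap.coe_mk, Icc.coe_zero, Icc.coe_one]
    abel
  · refine congrArg φ (Subtype.ext ?_)
    have h : v γ.toContinuousMap = u γ.toContinuousMap := by
      have e0 : γ.toContinuousMap 0 = p := γ.source
      have e1 : γ.toContinuousMap 1 = p := γ.target
      simp only [v, e0, e1, add_sub_cancel_right]
    exact congrArg (relBoundaries ℤ (∅ : Set Y)).mkQ h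

end Singular

/-! ### Residues of cocycles at the points at infinity -/

namespace HurwitzCovering

variable {L M : Type*} [TopologicalSpace L] [ChartedSpace ℂ L] {m : ℕ} {n : Fin (m + 1) → ℕ}
  (C : HurwitzCovering L m n) [AddCommGroup M]

theorem finite_range_pole : (range C.pole).Finite := finite_range _

theorem isOpenEmbedding_val [T2Space L] :
    IsOpenEmbedding (Subtype.val : C.Punctured → L) :=
  C.finite_range_pole.isClosed.isOpen_compl.isOpenEmbedding_subtypeVal

theorem locallyPathConnectedSpace_punctured [T2Space L] :
    LocallyPathConnectedSpace C.Punctured :=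
  have := ChartedSpace.locallyPathConnectedSpace ℂ L
  C.isOpenEmbedding_val.locallyPathConnectedSpace

theorem exists_isPrimAt [T2Space L] {ψ : C(unitInterval, C.Punctured) → M} (hψ : IsCocycle ψ)
    (P : C.Punctured) : ∃ h, IsPrimAt ψ h P :=
  have : Nonempty C.Punctured := ⟨P⟩
  ((C.isOpenEmbedding_val.toOpenPartialHomeomorph _).trans
    (chartAt ℂ (P : L))).exists_isPrimAt hψ (by simp)

/-- The map `s ↦ exp s` in the coordinate at `∞_i`. -/
def expPoint (i : Fin (m + 1)) (s : ℂ) : C.Punctured :=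
  if h : s.re < Real.log (C.radius i) then
    ⟨(C.coord i).symm (Complex.exp s), C.coord_symm_notMem i (Complex.exp_ne_zero s) (by
      rwa [Complex.norm_exp, ← Real.lt_log_iff_exp_lt (C.radius_pos i)])⟩
  else C.polarPoint i (C.radius i / 2) (half_pos (C.radius_pos i)) (half_lt_self (C.radius_pos i)) 1

/-- The logarithms of the points of the coordinate disc at `∞_i`. -/
def logDisc (i : Fin (m + 1)) : Set ℂ := {s | s.re < Real.log (C.radius i)}

theorem convex_logDisc (i : Fin (m + 1)) : Convex ℝ (C.logDisc i) := convex_halfSpace_re_lt _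

theorem isOpen_logDisc (i : Fin (m + 1)) : IsOpen (C.logDisc i) :=
  isOpen_lt Complex.continuous_re continuous_const

theorem exp_mem_target (i : Fin (m + 1)) {s : ℂ} (hs : s ∈ C.logDisc i) :
    Complex.exp s ∈ (C.coord i).target := by
  rw [C.coord_target, mem_ball_zero_iff, Complex.norm_exp,
    ← Real.lt_log_iff_exp_lt (C.radius_pos i)]
  exact hs

theorem mem_logDisc (i : Fin (m + 1)) {s : ℂ} {P : L} (hP : P ∈ (C.coord i).source)
    (hs : Complex.exp s = C.coord i P) : s ∈ C.logDisc i := by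
  have := (C.coord i).map_source hP
  rw [← hs, C.coord_target, mem_ball_zero_iff, Complex.norm_exp,
    ← Real.lt_log_iff_exp_lt (C.radius_pos i)] at this
  exact this

theorem coe_expPoint (i : Fin (m + 1)) {s : ℂ} (hs : s ∈ C.logDisc i) :
    (C.expPoint i s : L) = (C.coord i).symm (Complex.exp s) := by
  rw [expPoint, dif_pos (show s.re < _ from hs)]

theorem expPoint_mem_source (i : Fin (m + 1)) {s : ℂ} (hs : s ∈ C.logDisc i) :
    (C.expPoint i s : L) ∈ (C.coord i).source := by
  rw [C.coe_expPoint i hs]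
  exact (C.coord i).map_target (C.exp_mem_target i hs)

theorem coord_expPoint (i : Fin (m + 1)) {s : ℂ} (hs : s ∈ C.logDisc i) :
    C.coord i (C.expPoint i s) = Complex.exp s := by
  rw [C.coe_expPoint i hs, (C.coord i).right_inv (C.exp_mem_target i hs)]

theorem continuousOn_expPoint (i : Fin (m + 1)) :
    ContinuousOn (C.expPoint i) (C.logDisc i) := by
  rw [continuousOn_iff_continuous_domRestrict, continuous_induced_rng]
  have : Continuous fun s : C.logDisc i => (C.coord i).symm (Complex.exp s) :=
    (C.coord i).continuousOn_symm.comp_continuous (by fun_prop) fun s => C.exp_mem_target i s.2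
  refine this.congr fun s => (C.coe_expPoint i s.2).symm

theorem coord_ne_zero (i : Fin (m + 1)) {P : L} (hP : P ∈ (C.coord i).source)
    (h : P ∉ range C.pole) : C.coord i P ≠ 0 := fun h0 => h ⟨i, (C.coord i).injOn (C.pole_mem i) hP
      ((C.coord_pole i).trans h0.symm)⟩

theorem notMem_range_pole (i : Fin (m + 1)) {P : L} (hP : P ∈ (C.coord i).source)
    (h : C.coord i P ≠ 0) : P ∉ range C.pole := by
  have hr := (C.coord i).map_source hP
  rw [C.coord_target, mem_ball_zero_iff] at hr
  rw [← (C.coord i).left_inv hP]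
  exact C.coord_symm_notMem i h hr

/-- The residue of a cocycle at `∞_i`, as the period of its primitive in logarithmic
coordinates and as its value on circles. -/
theorem exists_residue {ψ : C(unitInterval, C.Punctured) → M} (hψ : IsCocycle ψ)
    (i : Fin (m + 1)) : ∃ (k : ℂ → M) (c : M), IsPrimAlong ψ (C.expPoint i) (C.logDisc i) k ∧
      (∀ s ∈ C.logDisc i, ∀ l : ℤ, k (s + l * (2 * Real.pi * Complex.I)) = k s + l • c) ∧
      ∀ ρ h0 hr, ψ (C.circleLoop i ρ h0 hr).toContinuousMap = c := by
  obtain ⟨k, hk⟩ := hψ.exists_prim_of_convex (C.convex_logDisc i) (C.continuousOn_expPoint i)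
  have hmem : ∀ (s : ℂ) (l : ℤ), s ∈ C.logDisc i →
      s + l * (2 * Real.pi * Complex.I) ∈ C.logDisc i := fun s l hs => by
    simpa [logDisc] using hs
  have hper : ∀ (s : ℂ) (l : ℤ), s ∈ C.logDisc i →
      C.expPoint i (s + l * (2 * Real.pi * Complex.I)) = C.expPoint i s := fun s l hs => by
    apply Subtype.ext
    rw [C.coe_expPoint i hs, C.coe_expPoint i (hmem s l hs), Complex.exp_periodic.int_mul]
  -- A segment and its translate by a multiple of `2πi` have the same image, so `k` has the same
  -- increment along both: the period does not depend on the point.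
  have hc : ∀ s ∈ C.logDisc i, ∀ s' ∈ C.logDisc i, ∀ l : ℤ,
      k (s + l * (2 * Real.pi * Complex.I)) - k s =
        k (s' + l * (2 * Real.pi * Complex.I)) - k s' := by
    intro s hs s' hs' l
    have hcont : Continuous fun t => C.expPoint i (segPath s s' t) :=
      (C.continuousOn_expPoint i).comp_continuous (segPath s s').continuous
        (segPath_mem (C.convex_logDisc i) hs hs')
    have h1 := hk.segment (C.convex_logDisc i) hs hs' (η := ⟨_, hcont⟩) fun _ => rfl
    have h2 := hk.segment (C.convex_logDisc i) (hmem s l hs) (hmem s' l hs') (η := ⟨_, hcont⟩)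
      fun t => by
        rw [show segPath (s + l * (2 * Real.pi * Complex.I)) (s' + l * (2 * Real.pi * Complex.I)) t
          = segPath s s' t + l * (2 * Real.pi * Complex.I) by simp [segPath]; ring,
          hper _ _ (segPath_mem (C.convex_logDisc i) hs hs' t)]
        rfl
    have h3 := h1.symm.trans h2
    rw [sub_eq_sub_iff_add_eq_add] at h3 ⊢
    rw [add_comm, h3, add_comm]
  let s₀ : ℂ := ((Real.log (C.radius i) - 1 : ℝ) : ℂ)
  have hs₀ : s₀ ∈ C.logDisc i := by simp [s₀, logDisc]
  let c := k (s₀ + (1 : ℤ) * (2 * Real.pi * Complex.I)) - k s₀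
  have hstep : ∀ s ∈ C.logDisc i, k (s + 2 * Real.pi * Complex.I) = k s + c := fun s hs => by
    have := hc s hs s₀ hs₀ 1
    rw [sub_eq_iff_eq_add, add_comm _ (k s)] at this
    simpa [c] using this
  refine ⟨k, c, hk, fun s hs l => ?_, fun ρ h0 hr => ?_⟩
  · induction l with
    | zero => simp
    | succ j ih =>
      have := hstep _ (hmem s j hs)
      rw [ih] at this
      rw [add_smul, one_smul, ← add_assoc, ← this]
      congr 1
      push_cast
      ring
    | pred j ih =>
      have := hstep _ (hmem s (-j - 1) hs)
      rw [sub_smul, one_smul, ← add_sub_assoc, ← ih, eq_sub_iff_add_eq, ← this]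
      congr 1
      push_cast
      ring
  -- The circle of radius `ρ` lifts to the vertical segment from `log ρ` to `log ρ + 2πi`.
  · have hρ : ((Real.log ρ : ℝ) : ℂ) ∈ C.logDisc i := by
      simpa [logDisc] using Real.log_lt_log h0 hr
    have h1 := hk.segment (C.convex_logDisc i) hρ (hmem _ 1 hρ)
      (η := (C.circleLoop i ρ h0 hr).toContinuousMap) fun t => by
        have hm := segPath_mem (C.convex_logDisc i) hρ (hmem _ 1 hρ) t
        apply Subtype.ext
        rw [C.coe_expPoint i hm]
        change (C.coord i).symm _ = _
        rw [show segPath ((Real.log ρ : ℝ) : ℂ) ((Real.log ρ : ℝ) +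
          (1 : ℤ) * (2 * Real.pi * Complex.I)) t = (Real.log ρ : ℝ) + (2 * Real.pi * (t : ℝ) : ℝ) *
            Complex.I by simp [segPath]; ring, Complex.exp_add, ← Complex.ofReal_exp,
          Real.exp_log h0, Circle.coe_exp]
    rw [h1]
    have := hstep _ hρ
    simp [this]

/-- Near a point of a punctured coordinate disc, primitives are given by branches of the
logarithm. -/
theorem isPrimAt_log {ψ : C(unitInterval, C.Punctured) → M} {i : Fin (m + 1)} {k : ℂ → M}
    (hk : IsPrimAlong ψ (C.expPoint i) (C.logDisc i) k) {P : C.Punctured}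
    (hP : (P : L) ∈ (C.coord i).source) {s : ℂ} (hs : Complex.exp s = C.coord i P) :
    IsPrimAt ψ (fun Q : C.Punctured => k (s + Complex.log (C.coord i Q / C.coord i P))) P := by
  have hP0 := C.coord_ne_zero i hP P.2
  have hcP : ContinuousAt (fun Q : C.Punctured => C.coord i Q / C.coord i P) P :=
    (((C.coord i).continuousAt hP).comp continuous_subtype_val.continuousAt).div_const _
  have hexp : ∀ Q : C.Punctured, (Q : L) ∈ (C.coord i).source →
      Complex.exp (s + Complex.log (C.coord i Q / C.coord i P)) = C.coord i Q := fun Q hQ => by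
    rw [Complex.exp_add, hs, Complex.exp_log (div_ne_zero (C.coord_ne_zero i hQ Q.2) hP0),
      mul_div_cancel₀ _ hP0]
  refine isPrimAt_of_section hk
    (s := fun Q : C.Punctured => s + Complex.log (C.coord i Q / C.coord i P))
    (V := {Q : C.Punctured | (Q : L) ∈ (C.coord i).source ∧
      C.coord i Q / C.coord i P ∈ Complex.slitPlane}) ?_ ?_ ?_ ?_
  · refine inter_mem (continuous_subtype_val.continuousAt.preimage_mem_nhds
      ((C.coord i).open_source.mem_nhds hP)) (hcP.preimage_mem_nhds
        (t := Complex.slitPlane) (Complex.isOpen_slitPlane.mem_nhds ?_))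
    rw [div_self hP0]
    exact Complex.one_mem_slitPlane
  · refine continuousOn_const.add (ContinuousOn.clog ?_ fun Q hQ => hQ.2)
    exact ((C.coord i).continuousOn.comp continuous_subtype_val.continuousOn
      fun Q hQ => hQ.1).div_const _
  · exact fun Q hQ => C.mem_logDisc i hQ.1 (hexp Q hQ.1)
  · intro Q hQ
    apply Subtype.ext
    rw [C.coe_expPoint i (C.mem_logDisc i hQ.1 (hexp Q hQ.1)), hexp Q hQ.1,
      (C.coord i).left_inv hQ.1]

/-- Once `k` has no period, the jump of the principal logarithm across its cut is invisible, and `k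
∘ log` is a primitive on the whole punctured disc. -/
theorem isPrimAt_log_coord {ψ : C(unitInterval, C.Punctured) → M} {i : Fin (m + 1)} {k : ℂ → M}
    (hk : IsPrimAlong ψ (C.expPoint i) (C.logDisc i) k)
    (hper : ∀ s ∈ C.logDisc i, ∀ l : ℤ, k (s + l * (2 * Real.pi * Complex.I)) = k s)
    {P : C.Punctured} (hP : (P : L) ∈ (C.coord i).source) :
    IsPrimAt ψ (fun Q : C.Punctured => k (Complex.log (C.coord i Q))) P := by
  have hP0 := C.coord_ne_zero i hP P.2
  refine (C.isPrimAt_log hk hP (Complex.exp_log hP0)).congr 0 ?_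
  filter_upwards [continuous_subtype_val.continuousAt.preimage_mem_nhds
      ((C.coord i).open_source.mem_nhds hP)] with Q hQ
  have hQ0 := C.coord_ne_zero i hQ Q.2
  have hexp : Complex.exp (Complex.log (C.coord i P) + Complex.log (C.coord i Q / C.coord i P)) =
      Complex.exp (Complex.log (C.coord i Q)) := by
    rw [Complex.exp_add, Complex.exp_log hP0, Complex.exp_log (div_ne_zero hQ0 hP0),
      mul_div_cancel₀ _ hP0, Complex.exp_log hQ0]
  obtain ⟨l, hl⟩ := Complex.exp_eq_exp_iff_exists_int.1 hexp
  rw [hl, hper _ (C.mem_logDisc i hQ (Complex.exp_log hQ0)), add_zero]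

/-- A cocycle without residues extends over the points at infinity. -/
theorem exists_extension [T2Space L] {ψ : C(unitInterval, C.Punctured) → M} (hψ : IsCocycle ψ)
    (hres : ∀ i ρ h0 hr, ψ (C.circleLoop i ρ h0 hr).toContinuousMap = 0) :
    ∃ Ψ : C(unitInterval, L) → M, IsCocycle Ψ ∧ ∀ γ : C(unitInterval, C.Punctured),
      Ψ ⟨fun t => (γ t : L), by fun_prop⟩ = ψ γ := by
  classical
  have := C.locallyPathConnectedSpace_punctured
  have hpole : ∀ i, ∃ k : ℂ → M, ∀ P : C.Punctured, (P : L) ∈ (C.coord i).source →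
      IsPrimAt ψ (fun Q : C.Punctured => k (Complex.log (C.coord i Q))) P := fun i => by
    obtain ⟨k, c, hk, hper, hc⟩ := C.exists_residue hψ i
    have hc0 : c = 0 := by
      rw [← hc _ (half_pos (C.radius_pos i)) (half_lt_self (C.radius_pos i)), hres]
    exact ⟨k, fun P hP => C.isPrimAt_log_coord hk (fun s hs l => by
      rw [hper s hs l, hc0, smul_zero, add_zero]) hP⟩
  choose k hk using hpole
  choose h hh using C.exists_isPrimAt hψ
  -- At a pole the family uses the single-valued primitive of the punctured disc, elsewhere any
  -- local primitive. The values at the poles are arbitrary: coherence is automatic at `x = y`, and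
  -- near another point only the values on the punctured surface count.
  let f : L → L → M := fun y x => if hy : ∃ i, C.pole i = y then
    k hy.choose (Complex.log (C.coord hy.choose x))
    else if hx : x ∉ range C.pole then h ⟨y, hy⟩ ⟨x, hx⟩ else 0
  have hf1 : ∀ Q : C.Punctured, (fun x : C.Punctured => f Q x) = h Q := fun Q => by
    funext x
    have h1 : ¬ ∃ i, C.pole i = Q := Q.2
    simp only [f]
    rw [dif_neg h1, dif_pos x.2]
  have hf2 : ∀ i, (fun x : C.Punctured => f (C.pole i) x) =
      fun Q : C.Punctured => k i (Complex.log (C.coord i Q)) := fun i => by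
    have hy : ∃ j, C.pole j = C.pole i := ⟨i, rfl⟩
    have hy' : hy.choose = i := C.pole_injective hy.choose_spec
    funext x
    simp only [f]
    rw [dif_pos hy, hy']
  have hloc : ∀ Q : C.Punctured, IsPrimAt ψ (fun x : C.Punctured => f Q x) Q := fun Q => by
    rw [hf1]
    exact hh Q
  have hnear : ∀ y : L, ∀ᶠ x in 𝓝 y, x = y ∨
      ∃ Q : C.Punctured, (Q : L) = x ∧ IsPrimAt ψ (fun x : C.Punctured => f y x) Q := by
    intro y
    by_cases hy : y ∈ range C.pole
    · obtain ⟨i, rfl⟩ := hy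
      filter_upwards [(C.coord i).open_source.mem_nhds (C.pole_mem i)] with x hx
      by_cases hxy : x = C.pole i
      · exact Or.inl hxy
      · refine Or.inr ⟨⟨x, C.notMem_range_pole i hx fun h0 => hxy ?_⟩, rfl, ?_⟩
        · exact (C.coord i).injOn hx (C.pole_mem i) (h0.trans (C.coord_pole i).symm)
        · rw [hf2]
          exact hk i _ hx
    · have h1 := (hloc ⟨y, hy⟩).eventually
      have h2 := C.isOpenEmbedding_val.map_nhds_eq ⟨y, hy⟩
      rw [← show ((⟨y, hy⟩ : C.Punctured) : L) = y from rfl, ← h2, eventually_map]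
      filter_upwards [h1] with Q hQ
      exact Or.inr ⟨Q, rfl, hQ⟩
  have hcoh : Coherent f := by
    intro y
    filter_upwards [hnear y] with x hx
    rcases hx with rfl | ⟨Q, rfl, hQ⟩
    · simp
    · rw [← C.isOpenEmbedding_val.map_nhds_eq Q, eventually_map]
      exact hQ.sub_eventually_eq (hloc Q)
  obtain ⟨Ψ, hΨ, -, hval⟩ := hcoh.exists_cocycle
  refine ⟨Ψ, hΨ, fun γ => ?_⟩
  obtain ⟨F, hF, H⟩ := hψ.exists_prim_path γ
  rw [hF]
  exact hval _ F fun t => H _ t (hloc (γ t))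

end HurwitzCovering

/-! ### Sums over the fibres -/

/-- Sums of a locally constant function over the fibres of a proper local homeomorphism are
locally constant. -/
theorem eventually_finsum_fiber_eq {X Y M : Type*} [TopologicalSpace X] [TopologicalSpace Y]
    [T2Space X] [AddCommGroup M] {f : X → Y} {y : Y} (hfin : (f ⁻¹' {y}).Finite)
    (hproper : ∀ W : Set X, IsOpen W → f ⁻¹' {y} ⊆ W → ∀ᶠ y' in 𝓝 y, f ⁻¹' {y'} ⊆ W)
    (hloc : ∀ q ∈ f ⁻¹' {y}, ∃ e : OpenPartialHomeomorph X Y, q ∈ e.source ∧ EqOn e f e.source)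
    {g : X → M} (hg : ∀ q ∈ f ⁻¹' {y}, ∀ᶠ q' in 𝓝 q, g q' = g q) :
    ∀ᶠ y' in 𝓝 y, ∑ᶠ q ∈ f ⁻¹' {y'}, g q = ∑ᶠ q ∈ f ⁻¹' {y}, g q := by
  obtain ⟨U, hU, hdisj⟩ := hfin.t2_separation
  have hloc' : ∀ q ∈ f ⁻¹' {y}, ∃ S : Set X, IsOpen S ∧ q ∈ S ∧ InjOn f S ∧
      ∀ T ⊆ S, IsOpen T → IsOpen (f '' T) := fun q hq => by
    obtain ⟨e, he, hef⟩ := hloc q hq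
    refine ⟨e.source, e.open_source, he, e.injOn.congr hef, fun T hT hTo => ?_⟩
    rw [← image_congr fun x hx => hef (hT hx)]
    exact e.isOpen_image_of_subset_source hTo hT
  choose! S hSo hqS hSi hS using hloc'
  -- On `V q` the map is injective and open, `g` is constant, and the sets for different points of
  -- the fibre are disjoint. Openness gives every nearby fibre a point in each `V q`; properness
  -- leaves it no others.
  let V : X → Set X := fun q => U q ∩ interior (S q) ∩ interior {q' | g q' = g q}
  have hVo : ∀ q, IsOpen (V q) := fun q => ((hU q).2.inter isOpen_interior).inter isOpen_interior
  have hVS : ∀ q, V q ⊆ S q := fun q x hx => interior_subset hx.1.2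
  have hVq : ∀ q ∈ f ⁻¹' {y}, q ∈ V q := fun q hq =>
    ⟨⟨(hU q).1, mem_interior_iff_mem_nhds.2 ((hSo q hq).mem_nhds (hqS q hq))⟩,
      mem_interior_iff_mem_nhds.2 (hg q hq)⟩
  have himg : ∀ q ∈ f ⁻¹' {y}, f '' V q ∈ 𝓝 y := fun q hq =>
    (hS q hq _ (hVS q) (hVo q)).mem_nhds ⟨q, hVq q hq, hq⟩
  filter_upwards [hproper (⋃ q ∈ f ⁻¹' {y}, V q) (isOpen_biUnion fun q _ => hVo q)
    (fun q hq => mem_biUnion hq (hVq q hq)), (biInter_mem hfin).2 himg] with y' h1 h2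
  rw [mem_iInter₂] at h2
  choose! b hb hfb using h2
  refine (finsum_mem_eq_of_bijOn b ⟨fun q hq => hfb q hq, fun q hq q' hq' h => ?_, fun x hx => ?_⟩
    fun q hq => ?_).symm
  · by_contra hne
    exact disjoint_left.1 (hdisj hq hq' hne) (hb q hq).1.1 (h ▸ (hb q' hq').1.1)
  · obtain ⟨q, hq, hxq⟩ := mem_iUnion₂.1 (h1 hx)
    refine ⟨q, hq, hSi q hq (hVS q (hb q hq)) (hVS q hxq) ?_⟩
    rw [hfb q hq]
    exact hx.symm
  · exact (interior_subset (hb q hq).2).symm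

/-- Short segments from `x` map into the neighbourhood where `h` is a primitive, so `k` and `h ∘ e`
have equal increments along them. -/
theorem IsPrimAlong.eventually_sub_eq {Y E M : Type*} [TopologicalSpace Y] [AddCommGroup M]
    [NormedAddCommGroup E] [NormedSpace ℝ E] {ψ : C(unitInterval, Y) → M} {e : E → Y} {K : Set E}
    {k : E → M} (hk : IsPrimAlong ψ e K k) (hK : IsOpen K) (he : ContinuousOn e K) {x : E}
    (hx : x ∈ K) {h : Y → M} (hh : IsPrimAt ψ h (e x)) :
    ∀ᶠ x' in 𝓝 x, k x' - h (e x') = k x - h (e x) := by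
  obtain ⟨V, hV, H⟩ := hh
  obtain ⟨ε, hε, hb⟩ := Metric.mem_nhds_iff.1 (inter_mem (hK.mem_nhds hx)
    ((he.continuousAt (hK.mem_nhds hx)).preimage_mem_nhds hV))
  filter_upwards [Metric.ball_mem_nhds x hε] with x' hx'
  have hs := segPath_mem (convex_ball x ε) (Metric.mem_ball_self hε) hx'
  have hc : Continuous fun t => e (segPath x x' t) :=
    he.comp_continuous (segPath x x').continuous fun t => (hb (hs t)).1
  have h1 := hk (segPath x x') ⟨_, hc⟩ (fun t => (hb (hs t)).1) fun _ => rfl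
  rw [H ⟨_, hc⟩ fun t => (hb (hs t)).2] at h1
  simp only [segPath, ContinuousMap.coe_mk, Icc.coe_one, Icc.coe_zero, sub_self, zero_smul,
    one_smul, zero_add, sub_zero, add_zero] at h1
  rw [sub_eq_sub_iff_add_eq_add] at h1 ⊢
  rw [← h1, add_comm]

/-! ### The fibres of the covering map and the trace of a cocycle. -/

namespace HurwitzCovering

variable {L M : Type*} [TopologicalSpace L] [ChartedSpace ℂ L] {m : ℕ} {n : Fin (m + 1) → ℕ}
  (C : HurwitzCovering L m n) [AddCommGroup M]

/-- The covering map on the punctured surface. -/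
def val (Q : C.Punctured) : ℂ := C.fn Q

theorem analyticAt_chart [T2Space L] [IsManifold 𝓘(ℂ) ω L] {P : L} (hP : P ∉ range C.pole) :
    AnalyticAt ℂ (C.fn ∘ (chartAt ℂ P).symm) (chartAt ℂ P P) := by
  have : IsManifold 𝓘(ℂ) 1 L := IsManifold.of_le (n := ω) le_top
  have hW : (chartAt ℂ P).target ∩ (chartAt ℂ P).symm ⁻¹' (range C.pole)ᶜ ∈
      𝓝 (chartAt ℂ P P) := by
    refine inter_mem ((chartAt ℂ P).open_target.mem_nhds (mem_chart_target ℂ P)) ?_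
    refine ((chartAt ℂ P).continuousAt_symm (mem_chart_target ℂ P)).preimage_mem_nhds ?_
    rw [(chartAt ℂ P).left_inv (mem_chart_source ℂ P)]
    exact C.finite_range_pole.isClosed.isOpen_compl.mem_nhds hP
  refine DifferentiableOn.analyticAt (fun w hw => ?_) hW
  refine DifferentiableAt.differentiableWithinAt ?_
  rw [← mdifferentiableAt_iff_differentiableAt]
  exact (C.holomorphic _ hw.2).comp w
    (mdifferentiableAt_atlas_symm (chart_mem_atlas ℂ P) hw.1)

/-- Ramification points are isolated, and so are the points of the fibres. -/
theorem eventually_unramified [T2Space L] [IsManifold 𝓘(ℂ) ω L] (P : C.Punctured) :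
    ∀ᶠ Q in 𝓝[≠] P, C.val Q ≠ C.val P ∧ ∃ e : OpenPartialHomeomorph C.Punctured ℂ,
      Q ∈ e.source ∧ EqOn e C.val e.source := by
  have : Nonempty C.Punctured := ⟨P⟩
  set φ := chartAt ℂ (P : L) with hφ
  set f := C.fn ∘ φ.symm with hf
  have ha : AnalyticAt ℂ f (φ P) := C.analyticAt_chart P.2
  -- If the derivative vanished identically near the point, the second derivative would vanish too,
  -- against the simplicity of the ramification. This also excludes that `f` is locally constant.
  have hd : ∀ᶠ w in 𝓝[≠] (φ P), deriv f w ≠ 0 := by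
    rcases ha.deriv.eventually_eq_zero_or_eventually_ne_zero with h | h
    · have h0 : deriv f (φ P) = 0 := h.self_of_nhds
      have h1 : deriv (deriv f) (φ P) = 0 := by
        rw [EventuallyEq.deriv_eq (f := fun _ => (0 : ℂ)) h]
        simp
      exact absurd h1 (C.simple P P.2 h0)
    · exact h
  have hv : ∀ᶠ w in 𝓝[≠] (φ P), f w ≠ f (φ P) := by
    rcases ha.eventually_eq_or_eventually_ne analyticAt_const (g := fun _ => f (φ P)) with h | h
    · have h2 : ∀ᶠ w in 𝓝[≠] (φ P), deriv f w = 0 := by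
        filter_upwards [(eventually_eventually_nhds.2 h).filter_mono nhdsWithin_le_nhds] with w hw
        rw [EventuallyEq.deriv_eq (f := fun _ => f (φ P)) hw]
        simp
      obtain ⟨w, h3, h4⟩ := (h2.and hd).exists
      exact absurd h3 h4
    · exact h
  have hA := ha.eventually_analyticAt.filter_mono (nhdsWithin_le_nhds (s := {φ P}ᶜ))
  have hsrc : ∀ᶠ Q : C.Punctured in 𝓝[≠] P, (Q : L) ∈ φ.source :=
    nhdsWithin_le_nhds (continuous_subtype_val.continuousAt.preimage_mem_nhds
      (φ.open_source.mem_nhds (mem_chart_source ℂ (P : L))))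
  have htend : Tendsto (fun Q : C.Punctured => φ Q) (𝓝[≠] P) (𝓝[≠] (φ P)) := by
    refine tendsto_nhdsWithin_iff.2 ⟨?_, ?_⟩
    · exact (((φ.continuousAt (mem_chart_source ℂ (P : L))).comp
        continuous_subtype_val.continuousAt).tendsto).mono_left nhdsWithin_le_nhds
    · filter_upwards [hsrc, self_mem_nhdsWithin] with Q hQ hne h
      exact hne (Subtype.ext (φ.injOn hQ (mem_chart_source ℂ (P : L)) h))
  filter_upwards [hsrc, htend.eventually hd, htend.eventually hv, htend.eventually hA]
    with Q h1 h2 h3 h4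
  have hfn : ∀ R : C.Punctured, (R : L) ∈ φ.source → f (φ R) = C.val R := fun R hR => by
    rw [hf, Function.comp_apply, φ.left_inv hR]
    rfl
  refine ⟨by rwa [hfn Q h1, hfn P (mem_chart_source ℂ (P : L))] at h3, ?_⟩
  have hs := h4.hasStrictDerivAt.hasStrictFDerivAt_equiv h2
  refine ⟨((C.isOpenEmbedding_val.toOpenPartialHomeomorph _).trans φ).trans
    (hs.toOpenPartialHomeomorph f), ?_, ?_⟩
  · have := hs.mem_toOpenPartialHomeomorph_source
    simp [h1, this]
  · intro R hR
    have hR1 : (R : L) ∈ φ.source := by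
      simp at hR
      exact hR.1
    simp [← hfn R hR1]

theorem continuous_val [T2Space L] [IsManifold 𝓘(ℂ) ω L] : Continuous C.val :=
  continuous_iff_continuousAt.2 fun Q =>
    (C.holomorphic Q Q.2).continuousAt.comp continuous_subtype_val.continuousAt

theorem coord_eq_zero_iff (i : Fin (m + 1)) {P : L} (hP : P ∈ (C.coord i).source) :
    C.coord i P = 0 ↔ P = C.pole i :=
  ⟨fun h => (C.coord i).injOn hP (C.pole_mem i) (h.trans (C.coord_pole i).symm),
    fun h => h ▸ C.coord_pole i⟩

/-- Neighbourhoods of the points at infinity on which the covering map is large. -/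
theorem exists_nhds_pole (R : ℝ) (i : Fin (m + 1)) : ∃ N : Set L, IsOpen N ∧ C.pole i ∈ N ∧
    ∀ P ∈ N, P ≠ C.pole i → R < ‖C.fn P‖ := by
  have ht : Tendsto (fun w : ℂ => ‖(w ^ (n i + 1))⁻¹‖) (𝓝[≠] 0) atTop := by
    have h1 : Tendsto (fun w : ℂ => w ^ (n i + 1)) (𝓝[≠] 0) (𝓝[≠] 0) := by
      refine tendsto_nhdsWithin_iff.2 ⟨?_, ?_⟩
      · have : Tendsto (fun w : ℂ => w ^ (n i + 1)) (𝓝 0) (𝓝 (0 ^ (n i + 1))) :=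
          (continuous_pow _).tendsto 0
        rw [zero_pow (Nat.succ_ne_zero _)] at this
        exact this.mono_left nhdsWithin_le_nhds
      · filter_upwards [self_mem_nhdsWithin] with w hw
        exact pow_ne_zero _ hw
    simp only [norm_inv]
    exact tendsto_inv_nhdsGT_zero.comp (tendsto_norm_nhdsNE_zero.comp h1)
  have hev := mem_nhdsWithin.1 (ht.eventually_gt_atTop R)
  obtain ⟨U, hUo, hU0, hU⟩ := hev
  refine ⟨(C.coord i).source ∩ C.coord i ⁻¹' U, (C.coord i).isOpen_inter_preimage hUo,
    ⟨C.pole_mem i, by rwa [mem_preimage, C.coord_pole]⟩, fun P hP hne => ?_⟩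
  rw [C.fn_eq i P hP.1 hne]
  exact hU ⟨hP.2, fun h => hne ((C.coord_eq_zero_iff i hP.1).1 h)⟩

theorem continuousOn_fn [T2Space L] [IsManifold 𝓘(ℂ) ω L] : ContinuousOn C.fn (range C.pole)ᶜ :=
  fun P hP => (C.holomorphic P hP).continuousAt.continuousWithinAt

variable [T2Space L] [CompactSpace L] [IsManifold 𝓘(ℂ) ω L]

/-- Near the poles `|λ|` exceeds `|y| + 1`. What remains outside `W` and these neighbourhoods is
compact, so its image is closed; it misses `y` and hence all nearby values. -/
theorem fiber_proper (y : ℂ) (W : Set C.Punctured) (hW : IsOpen W) (hy : C.val ⁻¹' {y} ⊆ W) :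
    ∀ᶠ y' in 𝓝 y, C.val ⁻¹' {y'} ⊆ W := by
  choose N hNo hNp hN using C.exists_nhds_pole (‖y‖ + 1)
  have hO : IsOpen (Subtype.val '' W ∪ ⋃ i, N i) :=
    (C.isOpenEmbedding_val.isOpenMap W hW).union (isOpen_iUnion hNo)
  have hK : IsCompact (Subtype.val '' W ∪ ⋃ i, N i)ᶜ := hO.isClosed_compl.isCompact
  have hKp : (Subtype.val '' W ∪ ⋃ i, N i)ᶜ ⊆ (range C.pole)ᶜ := compl_subset_compl.2 <| by
    rintro _ ⟨i, rfl⟩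
    exact Or.inr (mem_iUnion.2 ⟨i, hNp i⟩)
  have hc : IsClosed (C.fn '' (Subtype.val '' W ∪ ⋃ i, N i)ᶜ) :=
    (hK.image_of_continuousOn (C.continuousOn_fn.mono hKp)).isClosed
  have hyc : y ∉ C.fn '' (Subtype.val '' W ∪ ⋃ i, N i)ᶜ := by
    rintro ⟨P, hP, hPy⟩
    exact hP (Or.inl ⟨⟨P, hKp hP⟩, hy hPy, rfl⟩)
  filter_upwards [hc.isOpen_compl.mem_nhds hyc, Metric.ball_mem_nhds y one_pos] with y' h1 h2 Q hQ
  have hQ' : C.fn Q = y' := hQ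
  by_cases hm : (Q : L) ∈ Subtype.val '' W ∪ ⋃ i, N i
  · rcases hm with ⟨Q', hQ'W, h⟩ | h
    · rwa [Subtype.ext h] at hQ'W
    · obtain ⟨i, hi⟩ := mem_iUnion.1 h
      have h3 := hN i Q hi fun h => Q.2 ⟨i, h.symm⟩
      rw [hQ'] at h3
      rw [mem_ball_iff_norm] at h2
      have := norm_le_norm_add_norm_sub' y' y
      linarith
  · exact absurd ⟨Q, hm, hQ'⟩ h1

/-- The fibre lies in a compact set away from the poles, and its points are isolated. -/
theorem fiber_finite (y : ℂ) : (C.val ⁻¹' {y}).Finite := by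
  choose N hNo hNp hN using C.exists_nhds_pole ‖y‖
  have hK : IsCompact (⋃ i, N i)ᶜ := (isOpen_iUnion hNo).isClosed_compl.isCompact
  have hKp : (⋃ i, N i)ᶜ ⊆ (range C.pole)ᶜ := compl_subset_compl.2 <| by
    rintro _ ⟨i, rfl⟩
    exact mem_iUnion.2 ⟨i, hNp i⟩
  have hK' : IsCompact (Subtype.val ⁻¹' (⋃ i, N i)ᶜ : Set C.Punctured) := by
    rw [C.isOpenEmbedding_val.isInducing.isCompact_iff, image_preimage_eq_inter_range,
      Subtype.range_val_subtype]
    convert hK using 1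
    exact inter_eq_left.2 hKp
  have hloc : ∀ P : C.Punctured, {Q | C.val Q = y → Q = P} ∈ 𝓝 P := fun P => by
    by_cases hP : C.val P = y
    · have := eventually_nhdsWithin_iff.1 (C.eventually_unramified P)
      filter_upwards [this] with Q hQ h
      by_contra hne
      exact (hQ hne).1 (h.trans hP.symm)
    · filter_upwards [C.continuous_val.continuousAt.preimage_mem_nhds
        (isOpen_ne.mem_nhds hP)] with Q hQ h
      exact absurd h hQ
  obtain ⟨t, -, ht⟩ := hK'.elim_nhds_subcover _ fun P _ => hloc P
  refine t.finite_toSet.subset fun Q hQ => ?_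
  have hQK : Q ∈ (Subtype.val ⁻¹' (⋃ i, N i)ᶜ : Set C.Punctured) := fun h => by
    obtain ⟨i, hi⟩ := mem_iUnion.1 h
    have h3 := hN i Q hi fun h => Q.2 ⟨i, h.symm⟩
    rw [show C.fn Q = y from hQ] at h3
    exact lt_irrefl _ h3
  obtain ⟨P, hP, hQP⟩ := mem_iUnion₂.1 (ht hQK)
  rw [hQP hQ]
  exact hP

/-- A cocycle has a primitive near every fibre. -/
theorem exists_isPrimAt_fiber {ψ : C(unitInterval, C.Punctured) → M} (hψ : IsCocycle ψ) (y : ℂ) :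
    ∃ g : C.Punctured → M, ∀ Q ∈ C.val ⁻¹' {y}, IsPrimAt ψ g Q := by
  classical
  obtain ⟨U, hU, hdisj⟩ := (C.fiber_finite y).t2_separation
  choose h hh using C.exists_isPrimAt hψ
  refine ⟨fun x => if hx : ∃ Q ∈ C.val ⁻¹' {y}, x ∈ U Q then h hx.choose x else 0, fun Q hQ => ?_⟩
  refine (hh Q).congr 0 ?_
  filter_upwards [(hU Q).2.mem_nhds (hU Q).1] with x hx
  have hex : ∃ Q ∈ C.val ⁻¹' {y}, x ∈ U Q := ⟨Q, hQ, hx⟩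
  have : hex.choose = Q := by
    by_contra hne
    exact disjoint_left.1 (hdisj hex.choose_spec.1 hQ hne) hex.choose_spec.2 hx
  rw [dif_pos hex, this, add_zero]

/-- The sum of a cocycle over the sheets is the increment of a function on the plane. -/
theorem exists_trace {ψ : C(unitInterval, C.Punctured) → M} (hψ : IsCocycle ψ) :
    ∃ (F : ℂ → M) (g : ℂ → C.Punctured → M), (∀ y, ∀ Q ∈ C.val ⁻¹' {y}, IsPrimAt ψ (g y) Q) ∧
      ∀ y, ∀ᶠ y' in 𝓝 y, F y' - ∑ᶠ Q ∈ C.val ⁻¹' {y'}, g y Q =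
        F y - ∑ᶠ Q ∈ C.val ⁻¹' {y}, g y Q := by
  have := C.locallyPathConnectedSpace_punctured
  choose g hg using C.exists_isPrimAt_fiber hψ
  -- Fibres are summed without multiplicity, so a sum may jump at a branch value `y`. This is
  -- harmless: coherence is trivial at `x = y`, and the fibres over nearby `x ≠ y` are unramified.
  have hcoh : Coherent fun y y' => ∑ᶠ Q ∈ C.val ⁻¹' {y'}, g y Q := by
    intro y
    have hW : ∀ Q ∈ C.val ⁻¹' {y}, ∀ᶠ Q' in 𝓝 Q, IsPrimAt ψ (g y) Q' ∧ (C.val Q' ≠ y →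
        ∃ e : OpenPartialHomeomorph C.Punctured ℂ, Q' ∈ e.source ∧ EqOn e C.val e.source) := by
      intro Q hQ
      filter_upwards [(hg y Q hQ).eventually, eventually_nhdsWithin_iff.1
        (C.eventually_unramified Q)] with Q' h1 h2
      exact ⟨h1, fun hne => (h2 fun h => hne ((congrArg C.val h).trans hQ)).2⟩
    filter_upwards [C.fiber_proper y _ isOpen_interior
      fun Q hQ => mem_interior_iff_mem_nhds.2 (hW Q hQ)] with x hx
    by_cases hxy : x = y
    · subst hxy
      simp
    · have h1 := eventually_finsum_fiber_eq (g := fun Q => g y Q - g x Q) (C.fiber_finite x)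
        (C.fiber_proper x) (fun Q hQ => (interior_subset (hx hQ)).2 fun h =>
          hxy ((show C.val Q = x from hQ).symm.trans h)) fun Q hQ =>
            (interior_subset (hx hQ)).1.sub_eventually_eq (hg x Q hQ)
      filter_upwards [h1] with x' hx'
      rwa [finsum_mem_sub_distrib _ _ (C.fiber_finite x'),
        finsum_mem_sub_distrib _ _ (C.fiber_finite x)] at hx'
  obtain ⟨F, hF⟩ := hcoh.exists_isPrimitive
  exact ⟨F, g, hg, hF⟩

end HurwitzCovering

/-! ### The sum of the residues -/

namespace HurwitzCovering

variable {L M : Type*} [TopologicalSpace L] [ChartedSpace ℂ L] {m : ℕ} {n : Fin (m + 1) → ℕ}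
  (C : HurwitzCovering L m n) [AddCommGroup M]

/-- Logarithms of the local parameters of the points at which the covering map is `exp s`. -/
def sheetLog (d : ℕ) (j : ℤ) (s : ℂ) : ℂ :=
  (-s + j * (2 * Real.pi * Complex.I)) / (d + 1)

theorem continuous_sheetLog (d : ℕ) (j : ℤ) : Continuous (sheetLog d j) := by
  unfold sheetLog
  fun_prop

theorem exp_sheetLog (d : ℕ) (j : ℤ) (s : ℂ) :
    (Complex.exp (sheetLog d j s) ^ (d + 1))⁻¹ = Complex.exp s := by
  have h : (d : ℂ) + 1 ≠ 0 := by exact_mod_cast Nat.succ_ne_zero d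
  rw [← Complex.exp_nat_mul, ← Complex.exp_neg, sheetLog]
  push_cast
  rw [mul_div_cancel₀ _ h, show -(-s + j * (2 * Real.pi * Complex.I)) =
    s + ((-j : ℤ) : ℂ) * (2 * Real.pi * Complex.I) by push_cast; ring,
    Complex.exp_periodic.int_mul]

theorem re_sheetLog (d : ℕ) (j : ℤ) (s : ℂ) : (sheetLog d j s).re = -s.re / (d + 1) := by
  rw [sheetLog, show (d : ℂ) + 1 = ((d + 1 : ℝ) : ℂ) by push_cast; rfl, Complex.div_ofReal_re]
  simp

/-- One turn of `λ` moves every sheet to the preceding one. -/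
theorem sheetLog_add_period (d : ℕ) (j : ℤ) (s : ℂ) :
    sheetLog d j (s + 2 * Real.pi * Complex.I) = sheetLog d (j - 1) s := by
  simp only [sheetLog]
  push_cast
  ring

/-- Passing through all `d + 1` sheets turns the local parameter once around the pole. -/
theorem sheetLog_add_degree (d : ℕ) (j l : ℤ) (s : ℂ) :
    sheetLog d (j + l * (d + 1)) s = sheetLog d j s + l * (2 * Real.pi * Complex.I) := by
  have h : (d : ℂ) + 1 ≠ 0 := by exact_mod_cast Nat.succ_ne_zero d
  simp only [sheetLog]
  push_cast
  rw [div_add' _ _ _ h]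
  congr 1
  ring

theorem val_expPoint (i : Fin (m + 1)) {s : ℂ} (hs : s ∈ C.logDisc i) :
    C.val (C.expPoint i s) = (Complex.exp s ^ (n i + 1))⁻¹ := by
  rw [val, C.fn_eq i _ (C.expPoint_mem_source i hs) fun h => (C.expPoint i s).2 ⟨i, h.symm⟩,
    C.coord_expPoint i hs]

/-- Near infinity the fibre is read off from logarithms of the local parameters. Integers that agree
modulo `n i + 1` give the same point, so each point of the disc at `∞_i` has exactly one
representative among `0, …, n i`. -/
theorem bijOn_sheets {s : ℂ} (h1 : ∀ i (j : ℤ), sheetLog (n i) j s ∈ C.logDisc i)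
    (h2 : ∀ Q ∈ C.val ⁻¹' {Complex.exp s}, ∃ i, (Q : L) ∈ (C.coord i).source) :
    BijOn (fun p : (i : Fin (m + 1)) × Fin (n i + 1) =>
        C.expPoint p.1 (sheetLog (n p.1) (p.2 : ℕ) s))
      univ (C.val ⁻¹' {Complex.exp s}) := by
  refine ⟨fun p _ => ?_, ?_, fun Q hQ => ?_⟩
  · exact (C.val_expPoint p.1 (h1 _ _)).trans (exp_sheetLog _ _ _)
  · rintro ⟨i, j⟩ - ⟨i', j'⟩ - h
    dsimp only at h
    have hi : i = i' := by
      by_contra hne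
      refine disjoint_left.1 (C.coord_disjoint hne) (C.expPoint_mem_source i (h1 i (j : ℕ))) ?_
      rw [h]
      exact C.expPoint_mem_source i' (h1 i' (j' : ℕ))
    subst hi
    have h3 := C.coord_expPoint i (h1 i (j : ℕ))
    rw [h, C.coord_expPoint i (h1 i (j' : ℕ)), Complex.exp_eq_exp_iff_exists_int] at h3
    obtain ⟨l, hl⟩ := h3
    rw [← sheetLog_add_degree, sheetLog, sheetLog] at hl
    have hn : ((n i : ℂ) + 1) ≠ 0 := by exact_mod_cast Nat.succ_ne_zero (n i)
    have hl' := mul_right_cancel₀ Complex.two_pi_I_ne_zero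
      (add_left_cancel ((div_left_inj' hn).1 hl))
    have hl2 : ((j' : ℕ) : ℤ) = (j : ℕ) + l * (n i + 1) := by exact_mod_cast hl'
    have hj := j.2
    have hj' := j'.2
    have hl0 : l = 0 := by
      by_contra hne
      rcases lt_or_gt_of_ne hne with h | h
      · have : l * (n i + 1 : ℤ) ≤ -1 * (n i + 1) :=
          mul_le_mul_of_nonneg_right (by omega) (by positivity)
        omega
      · have : 1 * (n i + 1 : ℤ) ≤ l * (n i + 1) :=
          mul_le_mul_of_nonneg_right (by omega) (by positivity)
        omega
    have : (j : ℕ) = j' := by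
      rw [hl0] at hl2
      omega
    rw [Fin.ext this]
  · obtain ⟨i, hi⟩ := h2 Q hQ
    have hw := C.coord_ne_zero i hi Q.2
    have hv : ((C.coord i Q) ^ (n i + 1))⁻¹ = Complex.exp s := by
      rw [← C.fn_eq i Q hi fun h => Q.2 ⟨i, h.symm⟩]
      exact hQ
    rw [← Complex.exp_log hw, ← Complex.exp_nat_mul, ← Complex.exp_neg,
      Complex.exp_eq_exp_iff_exists_int] at hv
    obtain ⟨l, hl⟩ := hv
    have hn : ((n i : ℂ) + 1) ≠ 0 := by exact_mod_cast Nat.succ_ne_zero (n i)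
    have hlog : Complex.log (C.coord i Q) = sheetLog (n i) (-l) s := by
      rw [sheetLog, eq_div_iff hn]
      push_cast at hl ⊢
      linear_combination -hl
    have hpos : (0 : ℤ) < n i + 1 := by positivity
    have hmod := Int.emod_lt_of_pos (-l) hpos
    have hmod0 := Int.emod_nonneg (-l) hpos.ne'
    refine ⟨⟨i, ⟨(-l % (n i + 1)).toNat, by omega⟩⟩, mem_univ _, ?_⟩
    apply Subtype.ext
    dsimp only
    rw [C.coe_expPoint i (h1 _ _), Int.toNat_of_nonneg hmod0,
      ← Complex.exp_periodic.int_mul (-l / (n i + 1)), ← sheetLog_add_degree, Int.emod_add_ediv_mul,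
      ← hlog, Complex.exp_log hw, (C.coord i).left_inv hi]

variable [T2Space L] [CompactSpace L] [IsManifold 𝓘(ℂ) ω L]

/-- Over a neighbourhood of infinity, all points are in the coordinate discs. -/
theorem exists_bound : ∃ S : ℝ, (∀ i, ∀ (j : ℤ) (s : ℂ), S < s.re →
    sheetLog (n i) j s ∈ C.logDisc i) ∧
    ∀ s : ℂ, S < s.re → ∀ Q ∈ C.val ⁻¹' {Complex.exp s}, ∃ i, (Q : L) ∈ (C.coord i).source := by
  have hK : IsCompact (⋃ i, (C.coord i).source)ᶜ :=
    (isOpen_iUnion fun i => (C.coord i).open_source).isClosed_compl.isCompact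
  obtain ⟨R, hR⟩ := (hK.image_of_continuousOn (C.continuousOn_fn.mono
    (compl_subset_compl.2 (by
      rintro _ ⟨i, rfl⟩
      exact mem_iUnion.2 ⟨i, C.pole_mem i⟩)))).isBounded.exists_norm_le
  obtain ⟨S, hS⟩ := (finite_range fun i => -((n i + 1 : ℝ) * Real.log (C.radius i))).bddAbove
  -- `S` puts all the sheet logarithms into the logarithmic half-planes. `R` bounds `|λ|` off the
  -- discs, and `exp x ≥ x + 1` turns `re s > R` into `|exp s| > R`.
  refine ⟨max R S, fun i j s hs => ?_, fun s hs Q hQ => ?_⟩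
  · have h := hS ⟨i, rfl⟩
    have h1 : (0 : ℝ) < n i + 1 := by positivity
    have h2 := (le_max_right R S).trans_lt hs
    change (sheetLog (n i) j s).re < _
    rw [re_sheetLog, div_lt_iff₀ h1]
    dsimp only at h
    nlinarith
  · by_contra hne
    have h := hR _ ⟨Q, fun h => hne (mem_iUnion.1 h), rfl⟩
    have h2 := (le_max_left R S).trans_lt hs
    rw [show C.fn Q = Complex.exp s from hQ, Complex.norm_exp] at h
    linarith [Real.add_one_le_exp s.re]

/-- The residue theorem for cocycles. -/
theorem sum_residue_eq_zero {ψ : C(unitInterval, C.Punctured) → M} (hψ : IsCocycle ψ)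
    {ρ : Fin (m + 1) → ℝ} (h0 : ∀ i, 0 < ρ i) (hr : ∀ i, ρ i < C.radius i) :
    ∑ i, ψ (C.circleLoop i (ρ i) (h0 i) (hr i)).toContinuousMap = 0 := by
  choose k c hk hper hc using C.exists_residue hψ
  simp only [hc]
  obtain ⟨F, g, hg, hF⟩ := C.exists_trace hψ
  obtain ⟨S, hS1, hS2⟩ := C.exists_bound
  -- The trace in logarithmic coordinates. It differs from `F ∘ exp` by a constant on the
  -- half-plane, but its periodicity under `2πi` is not built in.
  let K : ℂ → M := fun s => ∑ i, ∑ j : Fin (n i + 1), k i (sheetLog (n i) (j : ℕ) s)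
  have hsum : ∀ s : ℂ, S < s.re → ∀ y, ∑ᶠ Q ∈ C.val ⁻¹' {Complex.exp s}, g y Q =
      ∑ i, ∑ j : Fin (n i + 1), g y (C.expPoint i (sheetLog (n i) (j : ℕ) s)) := fun s hs y => by
    rw [← finsum_mem_eq_of_bijOn _ (C.bijOn_sheets (fun i j => hS1 i j s hs) (hS2 s hs))
      (fun _ _ => rfl), finsum_mem_univ, finsum_eq_sum_of_fintype, Fintype.sum_sigma]
  have hloc : ∀ s : ℂ, S < s.re → ∀ᶠ s' in 𝓝 s,
      F (Complex.exp s') - K s' = F (Complex.exp s) - K s := by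
    intro s hs
    have hev1 := Complex.continuous_exp.continuousAt.eventually (hF (Complex.exp s))
    have hev2 : ∀ᶠ s' : ℂ in 𝓝 s, S < s'.re :=
      Complex.continuous_re.continuousAt.eventually_const_lt hs
    have hev3 : ∀ᶠ s' in 𝓝 s, ∀ i, ∀ j : Fin (n i + 1),
        k i (sheetLog (n i) (j : ℕ) s') -
            g (Complex.exp s) (C.expPoint i (sheetLog (n i) (j : ℕ) s')) =
        k i (sheetLog (n i) (j : ℕ) s) -
            g (Complex.exp s) (C.expPoint i (sheetLog (n i) (j : ℕ) s)) := by
      rw [eventually_all]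
      intro i
      rw [eventually_all]
      intro j
      refine (continuous_sheetLog (n i) _).continuousAt.eventually ((hk i).eventually_sub_eq
        (C.isOpen_logDisc i) (C.continuousOn_expPoint i) (hS1 i _ s hs) (hg _ _ ?_))
      exact (C.val_expPoint i (hS1 i _ s hs)).trans (exp_sheetLog _ _ _)
    filter_upwards [hev1, hev2, hev3] with s' e1 e2 e3
    rw [hsum s' e2, hsum s hs] at e1
    have e4 : K s' - ∑ i, ∑ j : Fin (n i + 1),
        g (Complex.exp s) (C.expPoint i (sheetLog (n i) (j : ℕ) s')) =
        K s - ∑ i, ∑ j : Fin (n i + 1),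
        g (Complex.exp s) (C.expPoint i (sheetLog (n i) (j : ℕ) s)) := by
      simp only [K, ← Finset.sum_sub_distrib, e3]
    rw [← sub_sub_sub_cancel_right (F (Complex.exp s')), e1, e4, sub_sub_sub_cancel_right]
  have : PreconnectedSpace {s : ℂ | S < s.re} :=
    Subtype.preconnectedSpace (convex_halfSpace_re_gt S).isPreconnected
  -- Since `F ∘ exp` agrees at `s₀` and `s₀ + 2πi`, so does `K`. Computing the change of `K` from
  -- the sheets yields the total residue.
  let s₀ : ℂ := ((S + 1 : ℝ) : ℂ)
  have hs₀ : S < s₀.re := by simp [s₀]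
  have hs₁ : S < (s₀ + 2 * Real.pi * Complex.I).re := by simp [s₀]
  have hconst := eq_of_eventually_sub_eq (Y := {s : ℂ | S < s.re})
    (F := fun s => F (Complex.exp s)) (G := fun s => K s)
    (fun s => continuous_subtype_val.continuousAt.eventually (hloc s s.2)) ⟨_, hs₀⟩ ⟨_, hs₁⟩
  have hexp : Complex.exp (s₀ + 2 * Real.pi * Complex.I) = Complex.exp s₀ :=
    Complex.exp_periodic s₀
  simp only [hexp, sub_self] at hconst
  rw [hconst, ← Finset.sum_sub_distrib]
  refine Finset.sum_congr rfl fun i _ => ?_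
  -- The shift by one makes the sum at `s₀ + 2πi` start from sheet `-1`. The difference telescopes
  -- to sheet `n i` minus sheet `-1`, which are one period apart.
  let A : ℕ → M := fun j => k i (sheetLog (n i) ((j : ℤ) - 1) s₀)
  have hA1 : ∑ j : Fin (n i + 1), k i (sheetLog (n i) (j : ℕ) s₀) =
      ∑ j ∈ Finset.range (n i + 1), A (j + 1) := by
    rw [← Fin.sum_univ_eq_sum_range (fun j => A (j + 1))]
    refine Finset.sum_congr rfl fun j _ => ?_
    simp [A]
  have hA2 : ∑ j : Fin (n i + 1), k i (sheetLog (n i) (j : ℕ) (s₀ + 2 * Real.pi * Complex.I)) =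
      ∑ j ∈ Finset.range (n i + 1), A j := by
    rw [← Fin.sum_univ_eq_sum_range A]
    refine Finset.sum_congr rfl fun j _ => ?_
    rw [sheetLog_add_period]
  rw [hA1, hA2, ← Finset.sum_sub_distrib, Finset.sum_range_sub]
  have h3 := hper i _ (hS1 i (-1) s₀ hs₀) 1
  rw [← sheetLog_add_degree, one_smul] at h3
  simp only [A]
  rw [show (((n i + 1 : ℕ) : ℤ) - 1) = -1 + 1 * (n i + 1) by push_cast; ring, h3]
  simp

end HurwitzCovering

/-! ### The topology of the blow-up -/

/-- The direction of a non-zero complex number. -/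
def circleDir (w : ℂ) : Circle := Circle.exp w.arg

theorem norm_mul_circleDir (w : ℂ) : (‖w‖ : ℂ) * circleDir w = w := by
  rw [circleDir, Circle.coe_exp, Complex.norm_mul_exp_arg_mul_I]

theorem circleDir_mul {ρ : ℝ} (hρ : 0 < ρ) (u : Circle) : circleDir (ρ * u) = u := by
  have h := norm_mul_circleDir (ρ * u)
  rw [HurwitzCovering.norm_polar hρ.le] at h
  exact Circle.ext (mul_left_cancel₀ (by exact_mod_cast hρ.ne') h)

theorem continuousOn_circleDir : ContinuousOn circleDir {0}ᶜ := by
  rw [continuousOn_iff_continuous_domRestrict]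
  refine continuous_induced_rng.2 ?_
  have : Continuous fun w : ({0}ᶜ : Set ℂ) => (w : ℂ) / (‖(w : ℂ)‖ : ℂ) :=
    continuous_subtype_val.div (by fun_prop) fun w => by simpa using (show (w : ℂ) ≠ 0 from w.2)
  refine this.congr fun w => ?_
  have h : ((‖(w : ℂ)‖ : ℝ) : ℂ) ≠ 0 := by simpa using (show (w : ℂ) ≠ 0 from w.2)
  rw [div_eq_iff h, mul_comm]
  exact (norm_mul_circleDir w).symm

namespace HurwitzCovering

variable {L M : Type*} [TopologicalSpace L] [ChartedSpace ℂ L] {m : ℕ} {n : Fin (m + 1) → ℕ}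
  (C : HurwitzCovering L m n) [AddCommGroup M] (z : ℂ)

theorem isOpen_blow_iff {S : Set (C.Blow z)} : IsOpen S ↔
    IsOpen ((fun P : C.Punctured => (Blow.interior P : C.Blow z)) ⁻¹' S) ∧
      ∀ i, IsOpen (C.collarMap z i ⁻¹' S) := by
  exact isOpen_sup.trans (and_congr Iff.rfl isOpen_iSup_iff)

/-- The point of the surface below a point of the collar. -/
def collarPoint (i : Fin (m + 1)) (p : C.Collar z i) : L :=
  (C.coord i).symm ((p.1.1 : ℂ) * (p.1.2 : ℂ))

theorem collar_mem_target (i : Fin (m + 1)) (p : C.Collar z i) :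
    (p.1.1 : ℂ) * (p.1.2 : ℂ) ∈ (C.coord i).target := by
  rw [C.coord_target, mem_ball_zero_iff, norm_polar p.2.1]
  exact p.2.2.1

theorem collarPoint_mem (i : Fin (m + 1)) (p : C.Collar z i) :
    C.collarPoint z i p ∈ (C.coord i).source := (C.coord i).map_target (C.collar_mem_target z i p)

theorem coord_collarPoint (i : Fin (m + 1)) (p : C.Collar z i) :
    C.coord i (C.collarPoint z i p) = (p.1.1 : ℂ) * (p.1.2 : ℂ) :=
  (C.coord i).right_inv (C.collar_mem_target z i p)

theorem continuous_collarPoint (i : Fin (m + 1)) : Continuous (C.collarPoint z i) :=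
  (C.coord i).continuousOn_symm.comp_continuous (by fun_prop) (C.collar_mem_target z i)

theorem collarMap_eq_interior_iff {i : Fin (m + 1)} {p : C.Collar z i} {P : C.Punctured} :
    C.collarMap z i p = Blow.interior P ↔ p.1.1 ≠ 0 ∧ C.collarPoint z i p = P := by
  rw [collarMap]
  split_ifs with h
  · simp [h]
  · simp only [Blow.interior.injEq, Subtype.ext_iff]
    exact ⟨fun h' => ⟨h, h'⟩, fun h' => h'.2⟩

theorem collarMap_eq_boundary_iff {i j : Fin (m + 1)} {p : C.Collar z i} {u : C.arcs z j} :
    C.collarMap z i p = Blow.boundary j u ↔ p.1.1 = 0 ∧ i = j ∧ p.1.2 = u := by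
  rw [collarMap]
  split_ifs with h
  · simp only [Blow.boundary.injEq, h, true_and]
    constructor
    · rintro ⟨rfl, h⟩
      exact ⟨rfl, congrArg Subtype.val (eq_of_heq h)⟩
    · rintro ⟨rfl, h⟩
      exact ⟨rfl, heq_of_eq (Subtype.ext h)⟩
  · simp [h]

/-- For `ρ > 0` polar coordinates are unique, boundary points record their direction, and the discs
of different poles are disjoint: the gluing identifies nothing else. -/
theorem collarMap_eq_iff {i j : Fin (m + 1)} {p : C.Collar z i} {q : C.Collar z j} :
    C.collarMap z i p = C.collarMap z j q ↔ i = j ∧ p.1 = q.1 := by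
  constructor
  · intro h
    rcases hx : C.collarMap z j q with P | ⟨l, u⟩
    · rw [hx, collarMap_eq_interior_iff] at h
      rw [collarMap_eq_interior_iff] at hx
      have hij : i = j := by
        by_contra hne
        refine disjoint_left.1 (C.coord_disjoint hne) (C.collarPoint_mem z i p) ?_
        rw [h.2, ← hx.2]
        exact C.collarPoint_mem z j q
      subst hij
      have h1 : (p.1.1 : ℂ) * (p.1.2 : ℂ) = q.1.1 * q.1.2 := by
        rw [← coord_collarPoint, ← coord_collarPoint, h.2, hx.2]
      have h2 := congrArg norm h1
      rw [norm_polar p.2.1, norm_polar q.2.1] at h2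
      refine ⟨rfl, Prod.ext h2 (Circle.ext (mul_left_cancel₀ (?_ : (p.1.1 : ℂ) ≠ 0) ?_))⟩
      · exact_mod_cast h.1
      · rw [h1, h2]
    · rw [hx, collarMap_eq_boundary_iff] at h
      rw [collarMap_eq_boundary_iff] at hx
      exact ⟨h.2.1.trans hx.2.1.symm, Prod.ext (h.1.trans hx.1.symm) (h.2.2.trans hx.2.2.symm)⟩
  · rintro ⟨rfl, h⟩
    rw [Subtype.ext h]

theorem isOpenEmbedding_interior [T2Space L] :
    IsOpenEmbedding (fun P : C.Punctured => (Blow.interior P : C.Blow z)) := by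
  refine .of_continuous_injective_isOpenMap (C.continuous_interior z)
    (fun P Q h => by injection h) fun O hO => (C.isOpen_blow_iff z).2 ⟨?_, fun i => ?_⟩
  · rwa [preimage_image_eq _ fun P Q h => by injection h]
  · have h : C.collarMap z i ⁻¹' ((fun P : C.Punctured => (Blow.interior P : C.Blow z)) '' O) =
        {p | p.1.1 ≠ 0} ∩ C.collarPoint z i ⁻¹' (Subtype.val '' O) := by
      ext p
      constructor
      · rintro ⟨P, hP, hPp⟩
        obtain ⟨h1, h2⟩ := (C.collarMap_eq_interior_iff z).1 hPp.symm
        exact ⟨h1, P, hP, h2.symm⟩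
      · rintro ⟨h1, P, hP, h2⟩
        exact ⟨P, hP, ((C.collarMap_eq_interior_iff z).2 ⟨h1, h2.symm⟩).symm⟩
    rw [h]
    exact (isOpen_ne_fun (by fun_prop) continuous_const).inter
      ((C.isOpenEmbedding_val.isOpenMap O hO).preimage (C.continuous_collarPoint z i))

/-- On the punctured surface the inverse is given by the modulus and direction of the local
parameter, continuous away from the pole; different collars do not meet. -/
theorem isOpenEmbedding_collarMap (i : Fin (m + 1)) : IsOpenEmbedding (C.collarMap z i) := by
  refine .of_continuous_injective_isOpenMap (C.continuous_collarMap z i)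
    (fun p q h => Subtype.ext ((C.collarMap_eq_iff z).1 h).2)
    fun O hO => (C.isOpen_blow_iff z).2 ⟨?_, fun j => ?_⟩
  · have hpol : ∀ P : {P : C.Punctured // (P : L) ∈ (C.coord i).source},
        0 ≤ ‖C.coord i P‖ ∧ ‖C.coord i P‖ < C.radius i ∧
          (‖C.coord i P‖ = 0 → circleDir (C.coord i P) ∈ C.arcs z i) := fun P => by
      have h0 := C.coord_ne_zero i P.2 P.1.2
      have hr := (C.coord i).map_source P.2
      rw [C.coord_target, mem_ball_zero_iff] at hr
      exact ⟨norm_nonneg _, hr, fun h => absurd (norm_eq_zero.1 h) h0⟩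
    let pol : {P : C.Punctured // (P : L) ∈ (C.coord i).source} → C.Collar z i := fun P =>
      ⟨(‖C.coord i P‖, circleDir (C.coord i P)), hpol P⟩
    have hco : Continuous fun P : {P : C.Punctured // (P : L) ∈ (C.coord i).source} =>
        C.coord i P := (C.coord i).continuousOn.comp_continuous (by fun_prop) fun P => P.2
    have hpc : Continuous pol := Continuous.subtype_mk (hco.norm.prodMk
      (continuousOn_circleDir.comp_continuous hco fun P => C.coord_ne_zero i P.2 P.1.2)) _
    have h : (fun P : C.Punctured => (Blow.interior P : C.Blow z)) ⁻¹' (C.collarMap z i '' O) =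
        Subtype.val '' (pol ⁻¹' O) := by
      ext P
      constructor
      · rintro ⟨p, hp, hpP⟩
        obtain ⟨h1, h2⟩ := (C.collarMap_eq_interior_iff z).1 hpP
        refine ⟨⟨P, h2 ▸ C.collarPoint_mem z i p⟩, ?_, rfl⟩
        have h3 : C.coord i P = p.1.1 * p.1.2 := by rw [← h2, coord_collarPoint]
        have hpe : pol ⟨P, h2 ▸ C.collarPoint_mem z i p⟩ = p := by
          refine Subtype.ext (Prod.ext ?_ ?_)
          · change ‖C.coord i P‖ = _
            rw [h3, norm_polar p.2.1]
          · change circleDir (C.coord i P) = _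
            rw [h3, circleDir_mul (lt_of_le_of_ne p.2.1 (Ne.symm h1))]
        rwa [mem_preimage, hpe]
      · rintro ⟨Q, hQ, rfl⟩
        refine ⟨pol Q, hQ, (C.collarMap_eq_interior_iff z).2 ⟨?_, ?_⟩⟩
        · exact norm_ne_zero_iff.2 (C.coord_ne_zero i Q.2 Q.1.2)
        · change (C.coord i).symm ((‖C.coord i Q‖ : ℂ) * circleDir (C.coord i Q)) = _
          rw [norm_mul_circleDir, (C.coord i).left_inv Q.2]
    rw [h]
    have ho : IsOpen {P : C.Punctured | (P : L) ∈ (C.coord i).source} :=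
      (C.coord i).open_source.preimage continuous_subtype_val
    exact ho.isOpenEmbedding_subtypeVal.isOpenMap _ (hO.preimage hpc)
  · by_cases hij : i = j
    · subst hij
      rwa [preimage_image_eq _ fun p q h => Subtype.ext ((C.collarMap_eq_iff z).1 h).2]
    · convert isOpen_empty
      ext q
      simp only [mem_preimage, mem_image, mem_empty_iff_false, iff_false]
      rintro ⟨p, -, hp⟩
      exact hij ((C.collarMap_eq_iff z).1 hp).1

/-- The radial path from a boundary point into the surface. -/
def radialPath (i : Fin (m + 1)) (u : C.arcs z i) : C(unitInterval, C.Blow z) :=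
  (ContinuousMap.mk _ (C.continuous_collarMap z i)).comp
    ⟨fun t => ⟨((t : ℝ) * (C.radius i / 2), u), by
      have := C.radius_pos i
      refine ⟨mul_nonneg t.2.1 (by linarith), ?_, fun _ => u.2⟩
      have := t.2.2
      dsimp only
      nlinarith⟩, by fun_prop⟩

theorem isOpen_arcs (i : Fin (m + 1)) : IsOpen (C.arcs z i) := by
  refine isOpen_lt (Complex.continuous_re.comp (continuous_const.mul (Continuous.inv₀ ?_ ?_)))
    continuous_const
  · fun_prop
  · exact fun u => pow_ne_zero _ u.coe_ne_zero

/-- Near a boundary point the blow-up is a half-disc: a primitive of the restriction of a cocycle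
to the punctured surface extends to the boundary. -/
theorem exists_prim_blow [T2Space L] {ψ : C(unitInterval, C.Blow z) → M} (hψ : IsCocycle ψ)
    {h : C.Punctured → M} (hh : ∀ γ : C(unitInterval, C.Punctured),
      ψ ((ContinuousMap.mk _ (C.continuous_interior z)).comp γ) = h (γ 1) - h (γ 0)) :
    ∃ H : C.Blow z → M, ∀ γ, ψ γ = H (γ 1) - H (γ 0) := by
  classical
  -- The value at a boundary point is forced by the radial path: its end value minus the integral
  -- along it.
  let H : C.Blow z → M := fun x => match x with
    | .interior P => h P
    | .boundary i u => h (C.polarPoint i (C.radius i / 2) (half_pos (C.radius_pos i))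
        (half_lt_self (C.radius_pos i)) u) - ψ (C.radialPath z i u)
  have hint : ∀ P : C.Punctured, IsPrimAt ψ H (Blow.interior P) := fun P => by
    have he := C.isOpenEmbedding_interior z
    have hne : Nonempty C.Punctured := ⟨P⟩
    refine ⟨range fun P : C.Punctured => (Blow.interior P : C.Blow z),
      he.isOpen_range.mem_nhds ⟨P, rfl⟩, fun γ hγ => ?_⟩
    choose η hη using hγ
    have hc : Continuous η := by
      rw [he.isInducing.continuous_iff]
      exact γ.continuous.congr fun t => (hη t).symm
    have := hh ⟨η, hc⟩
    rw [show (ContinuousMap.mk _ (C.continuous_interior z)).comp ⟨η, hc⟩ = γ from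
      ContinuousMap.ext hη] at this
    rw [this, ← hη 1, ← hη 0]
    rfl
  refine ⟨H, fun γ => hψ.eq_sub_of_isPrimAt fun t => ?_⟩
  rcases γ t with P | ⟨i, u⟩
  · exact hint P
  have hr := C.radius_pos i
  obtain ⟨ε, hε, harc⟩ : ∃ ε > 0, ∀ θ : ℝ, |θ| < ε → (u : Circle) * Circle.exp θ ∈ C.arcs z i := by
    have hc : Continuous fun θ : ℝ => (u : Circle) * Circle.exp θ := by fun_prop
    have := hc.continuousAt.preimage_mem_nhds (x := 0) ((C.isOpen_arcs z i).mem_nhds (by simp))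
    obtain ⟨ε, hε, hb⟩ := Metric.mem_nhds_iff.1 this
    exact ⟨ε, hε, fun θ hθ => hb (by simpa using hθ)⟩
  -- A rectangle in polar coordinates, convex up to and including its boundary side `ρ = 0`,
  -- parametrises a neighbourhood of the boundary point.
  let K : Set (ℝ × ℝ) := Ico 0 (C.radius i) ×ˢ Ioo (-ε) ε
  have hK : Convex ℝ K := (convex_Ico _ _).prod (convex_Ioo _ _)
  have hKmem : ∀ p ∈ K, 0 ≤ p.1 ∧ p.1 < C.radius i ∧
      (p.1 = 0 → (u : Circle) * Circle.exp p.2 ∈ C.arcs z i) := fun p hp =>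
    ⟨hp.1.1, hp.1.2, fun _ => harc _ (abs_lt.2 hp.2)⟩
  let e : ℝ × ℝ → C.Blow z := fun p => if hp : p ∈ K then
    C.collarMap z i ⟨(p.1, (u : Circle) * Circle.exp p.2), hKmem p hp⟩ else Blow.boundary i u
  have he : ContinuousOn e K := by
    rw [continuousOn_iff_continuous_domRestrict]
    refine ((C.continuous_collarMap z i).comp (Continuous.subtype_mk (f := fun p : K =>
      (p.1.1, (u : Circle) * Circle.exp p.1.2)) (by fun_prop) fun p => hKmem p p.2)).congr
      fun p => ?_
    exact (show e p = _ from dif_pos p.2).symm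
  obtain ⟨k, hk⟩ := hψ.exists_prim_of_convex hK he
  have hK0 : (C.radius i / 2, (0 : ℝ)) ∈ K :=
    ⟨⟨(half_pos hr).le, half_lt_self hr⟩, ⟨neg_lt_zero.2 hε, hε⟩⟩
  have hpos : ∀ p ∈ K, 0 < p.1 → H (e p) = k p + (H (e (C.radius i / 2, 0)) -
      k (C.radius i / 2, 0)) := fun p hp hp0 => by
    have hs := segPath_mem hK hK0 hp
    have hs0 : ∀ t, 0 < (segPath (C.radius i / 2, (0 : ℝ)) p t).1 := fun t =>
      segPath_mem (K := {p : ℝ × ℝ | 0 < p.1}) (convex_halfSpace_gt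
        (IsLinearMap.mk (fun _ _ => rfl) fun _ _ => rfl) 0) (half_pos hr) hp0 t
    have hc := he.comp_continuous (segPath (C.radius i / 2, (0 : ℝ)) p).continuous hs
    have h1 := hk.segment hK hK0 hp (η := ⟨_, hc⟩) fun _ => rfl
    have h2 := hψ.eq_sub_of_isPrimAt (γ := ⟨_, hc⟩) (h := H) fun t => by
      change IsPrimAt ψ H (e _)
      simp only [e]
      rw [dif_pos (hs t), collarMap, dif_neg (hs0 t).ne']
      exact hint _
    have h3 := h2.symm.trans h1
    simp only [ContinuousMap.coe_mk, Function.comp_apply, segPath_zero, segPath_one] at h3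
    rw [sub_eq_sub_iff_add_eq_add] at h3
    rw [← add_sub_assoc, eq_sub_iff_add_eq, h3]
  -- Radial paths lie in the rectangle, so `k` computes the integrals that define `H` on `ρ = 0`.
  -- Thus `H` differs from `k` by the same constant there as inside.
  have hall : ∀ p ∈ K, H (e p) = k p + (H (e (C.radius i / 2, 0)) -
      k (C.radius i / 2, 0)) := fun p hp => by
    rcases hp.1.1.eq_or_lt with h0 | h0
    · have hp2 : (C.radius i / 2, p.2) ∈ K := ⟨hK0.1, hp.2⟩
      have hu := harc p.2 (abs_lt.2 hp.2)
      have h1 := hk.segment hK hp hp2 (η := C.radialPath z i ⟨_, hu⟩) fun t => by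
        simp only [e]
        rw [dif_pos (segPath_mem hK hp hp2 t)]
        refine congrArg (C.collarMap z i) (Subtype.ext (Prod.ext ?_ ?_))
        · simp [segPath, ← h0]
        · simp only [segPath, ContinuousMap.coe_mk, Prod.smul_mk, Prod.snd_add, Prod.smul_snd]
          congr 2
          simp only [smul_eq_mul]
          ring
      have h2 := hpos _ hp2 (half_pos hr)
      have h3 : e p = Blow.boundary i ⟨_, hu⟩ := by
        simp only [e]
        rw [dif_pos hp, collarMap_eq_boundary_iff]
        exact ⟨h0.symm, rfl, rfl⟩
      have h4 : e (C.radius i / 2, p.2) = Blow.interior (C.polarPoint i (C.radius i / 2)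
          (half_pos (C.radius_pos i)) (half_lt_self (C.radius_pos i))
            ((u : Circle) * Circle.exp p.2)) := by
        simp only [e]
        rw [dif_pos hp2, collarMap, dif_neg (half_pos hr).ne']
      rw [h4] at h2
      rw [h3]
      change h _ - ψ _ = _
      rw [h1]
      change h _ = _ at h2
      rw [h2]
      abel
    · exact hpos p hp h0
  have hemb := C.isOpenEmbedding_collarMap z i
  have hne : Nonempty (C.Collar z i) := ⟨⟨(0, u), le_rfl, hr, fun _ => u.2⟩⟩
  -- Angles are measured relative to `u`, so that the cut of `arg` stays away from the
  -- neighbourhood.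
  let O : Set (C.Collar z i) := {p | ((p.1.2 / u : Circle) : ℂ) ∈ Complex.slitPlane ∧
    |((p.1.2 / u : Circle) : ℂ).arg| < ε}
  have hOc : ContinuousOn (fun p : C.Collar z i => ((p.1.2 / u : Circle) : ℂ).arg)
      {p | ((p.1.2 / u : Circle) : ℂ) ∈ Complex.slitPlane} := fun p hp =>
    ContinuousAt.continuousWithinAt (ContinuousAt.comp (f := fun p : C.Collar z i =>
      ((p.1.2 / u : Circle) : ℂ)) (Complex.continuousAt_arg hp) (by fun_prop))
  have hO : IsOpen O := by
    have h1 : IsOpen {p : C.Collar z i | ((p.1.2 / u : Circle) : ℂ) ∈ Complex.slitPlane} :=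
      Complex.isOpen_slitPlane.preimage (f := fun p : C.Collar z i =>
        ((p.1.2 / u : Circle) : ℂ)) (by fun_prop)
    exact hOc.abs.isOpen_inter_preimage h1 isOpen_Iio
  let g := hemb.toOpenPartialHomeomorph _
  have hgs : ∀ p, g.symm (C.collarMap z i p) = p := fun p => g.left_inv (mem_univ p)
  let s : C.Blow z → ℝ × ℝ := fun x =>
    ((g.symm x).1.1, (((g.symm x).1.2 / u : Circle) : ℂ).arg)
  have hs : ∀ x ∈ C.collarMap z i '' O, s x ∈ K ∧ e (s x) = x := by
    rintro _ ⟨p, hp, rfl⟩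
    have hK' : s (C.collarMap z i p) ∈ K := by
      simp only [s, hgs]
      exact ⟨⟨p.2.1, p.2.2.1⟩, abs_lt.1 hp.2⟩
    refine ⟨hK', ?_⟩
    simp only [e]
    rw [dif_pos hK']
    refine congrArg (C.collarMap z i) (Subtype.ext (Prod.ext ?_ ?_))
    · simp only [s, hgs]
    · simp only [s, hgs]
      rw [Circle.exp_arg, mul_div_cancel]
  have hV : C.collarMap z i '' O ∈ 𝓝 (Blow.boundary i u : C.Blow z) := by
    refine (hemb.isOpenMap O hO).mem_nhds ⟨⟨(0, u), le_rfl, hr, fun _ => u.2⟩, ?_, ?_⟩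
    · simp [O, hε]
    · rw [collarMap_eq_boundary_iff]
      exact ⟨rfl, rfl, rfl⟩
  refine (isPrimAt_of_section hk hV (s := s) ?_ (fun x hx => (hs x hx).1)
    fun x hx => (hs x hx).2).congr (H (e (C.radius i / 2, 0)) - k (C.radius i / 2, 0)) ?_
  · have hg : ContinuousOn g.symm (C.collarMap z i '' O) := g.continuousOn_symm.mono (by
      rintro _ ⟨p, -, rfl⟩
      exact g.map_source (mem_univ p))
    refine ContinuousOn.prodMk ?_ ?_
    · exact (continuous_fst.comp continuous_subtype_val).comp_continuousOn hg
    · refine hOc.comp hg ?_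
      rintro _ ⟨p, hp, rfl⟩
      rw [hgs]
      exact hp.1
  · filter_upwards [hV] with x hx
    rw [Function.comp_apply, ← hall _ (hs x hx).1, (hs x hx).2]

end HurwitzCovering

/-! ### The arcs of the boundary -/

namespace HurwitzCovering

variable {L M : Type*} [TopologicalSpace L] [ChartedSpace ℂ L] {m : ℕ} {n : Fin (m + 1) → ℕ}
  (C : HurwitzCovering L m n) [AddCommGroup M] (z : ℂ)

/-- The direction `u` belongs to the arc number `β` at `∞_i`. -/
def InArc (i : Fin (m + 1)) (β : ℤ) (u : Circle) : Prop :=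
  ∃ θ ∈ C.arcAngles z i β, u = Circle.exp θ

theorem mem_arcAngles_iff (i : Fin (m + 1)) (β : ℤ) (θ : ℝ) : θ ∈ C.arcAngles z i β ↔
    Real.pi / 2 < (n i + 1) * θ - z.arg - 2 * Real.pi * β ∧
      (n i + 1) * θ - z.arg - 2 * Real.pi * β < 3 * Real.pi / 2 := by
  have h : (0 : ℝ) < n i + 1 := by positivity
  rw [arcAngles, mem_Ioo, div_lt_iff₀ h, lt_div_iff₀ h]
  constructor <;> rintro ⟨h1, h2⟩ <;> constructor <;> linarith

theorem exp_mem_arcs_iff (i : Fin (m + 1)) (θ : ℝ) : Circle.exp θ ∈ C.arcs z i ↔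
    ‖z‖ * Real.cos ((n i + 1) * θ - z.arg) < 0 := by
  rw [arcs, Set.mem_ofPred_eq]
  have h : z * (((Circle.exp θ : Circle) : ℂ) ^ (n i + 1))⁻¹ =
      (‖z‖ : ℂ) * Complex.exp (((z.arg - (n i + 1) * θ : ℝ) : ℂ) * Complex.I) := by
    rw [Circle.coe_exp, ← Complex.exp_nat_mul, ← Complex.exp_neg]
    conv_lhs => rw [← Complex.norm_mul_exp_arg_mul_I z]
    rw [mul_assoc, ← Complex.exp_add]
    push_cast
    ring_nf
  rw [h, Complex.re_ofReal_mul, Complex.exp_ofReal_mul_I_re, ← Real.cos_neg, neg_sub]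

variable {z}

theorem InArc.mem_arcs (hz : z ≠ 0) {i : Fin (m + 1)} {β : ℤ} {u : Circle}
    (h : C.InArc z i β u) : u ∈ C.arcs z i := by
  obtain ⟨θ, hθ, rfl⟩ := h
  rw [mem_arcAngles_iff] at hθ
  rw [exp_mem_arcs_iff]
  refine mul_neg_of_pos_of_neg (norm_pos_iff.2 hz) ?_
  rw [← Real.cos_sub_int_mul_two_pi _ β, mul_comm (β : ℝ)]
  exact Real.cos_neg_of_pi_div_two_lt_of_lt hθ.1 (by linarith [hθ.2])

theorem inArc_add_iff {i : Fin (m + 1)} {β : ℤ} (l : ℤ) {u : Circle} :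
    C.InArc z i (β + l * (n i + 1)) u ↔ C.InArc z i β u := by
  have key : ∀ (β l : ℤ), C.InArc z i β u → C.InArc z i (β + l * (n i + 1)) u := by
    rintro β l ⟨θ, hθ, rfl⟩
    refine ⟨θ + l * (2 * Real.pi), ?_, (Circle.periodic_exp.int_mul l θ).symm⟩
    rw [mem_arcAngles_iff] at hθ ⊢
    push_cast
    have : ((n i : ℝ) + 1) * (θ + l * (2 * Real.pi)) - z.arg -
        2 * Real.pi * (β + l * (n i + 1)) = (n i + 1) * θ - z.arg - 2 * Real.pi * β := by ring
    rwa [this]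
  refine ⟨fun h => ?_, key β l⟩
  have := key _ (-l) h
  rwa [neg_mul, add_neg_cancel_right] at this

/-- Angles of one direction differ by `2πl`, which shifts the number by a multiple of `n i + 1`. The
remaining discrepancy is an integer smaller than `1` in absolute value, because each arc has length
`π` in terms of `arg (z λ)`. -/
theorem InArc.eq_add {i : Fin (m + 1)} {β β' : ℤ} {u : Circle} (h : C.InArc z i β u)
    (h' : C.InArc z i β' u) : ∃ l : ℤ, β' = β + l * (n i + 1) := by
  obtain ⟨θ, hθ, rfl⟩ := h
  obtain ⟨θ', hθ', he⟩ := h'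
  obtain ⟨l, hl⟩ := Circle.exp_eq_exp.1 he
  refine ⟨-l, ?_⟩
  rw [mem_arcAngles_iff] at hθ hθ'
  rw [hl] at hθ
  have h1 : |2 * Real.pi * ((β' - (β - l * (n i + 1)) : ℤ) : ℝ)| < 2 * Real.pi * 1 := by
    push_cast
    rw [abs_lt]
    constructor <;> nlinarith [Real.pi_pos]
  rw [abs_mul, abs_of_pos Real.two_pi_pos] at h1
  have h2 := lt_of_mul_lt_mul_left h1 Real.two_pi_pos.le
  have h3 : |β' - (β - l * (n i + 1))| < 1 := by exact_mod_cast h2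
  rw [Int.abs_lt_one_iff] at h3
  linarith

theorem InArc.iff {i : Fin (m + 1)} {β β' : ℤ} {u u' : Circle} (h : C.InArc z i β u)
    (h' : C.InArc z i β u') : C.InArc z i β' u ↔ C.InArc z i β' u' := by
  constructor
  · intro h1
    obtain ⟨l, rfl⟩ := h.eq_add C h1
    exact (C.inArc_add_iff l).2 h'
  · intro h1
    obtain ⟨l, rfl⟩ := h'.eq_add C h1
    exact (C.inArc_add_iff l).2 h

/-- Every boundary direction belongs to one of `n i + 1` successive arcs. -/
theorem exists_inArc (i : Fin (m + 1)) (β₀ : ℤ) {u : Circle} (hu : u ∈ C.arcs z i) :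
    ∃ j : ℕ, j ≤ n i ∧ C.InArc z i (β₀ + j) u := by
  have hz : 0 < ‖z‖ := by
    refine norm_pos_iff.2 fun h => ?_
    rw [arcs, Set.mem_ofPred_eq, h, zero_mul] at hu
    exact lt_irrefl _ hu
  obtain ⟨β, hβ⟩ : ∃ β : ℤ, C.InArc z i β u := by
    rw [← Circle.exp_arg u, exp_mem_arcs_iff] at hu
    have hc := (mul_neg_iff.1 hu).resolve_right fun h => (h.1.trans hz).false
    -- Reducing `φ` modulo `2π` into `[0, 2π)` by its floor gives the arc number; a negative cosine
    -- then means lying between `π/2` and `3π/2`.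
    set φ := (n i + 1) * (u : ℂ).arg - z.arg with hφ
    have h1 := Int.floor_le (φ / (2 * Real.pi))
    have h2 := Int.lt_floor_add_one (φ / (2 * Real.pi))
    set β := ⌊φ / (2 * Real.pi)⌋
    rw [le_div_iff₀ Real.two_pi_pos] at h1
    rw [div_lt_iff₀ Real.two_pi_pos] at h2
    have hc' : Real.cos (φ - 2 * Real.pi * β) < 0 := by
      rw [mul_comm, Real.cos_sub_int_mul_two_pi]
      exact hc.2
    refine ⟨β, (u : ℂ).arg, (C.mem_arcAngles_iff z i β _).2 ⟨?_, ?_⟩, (Circle.exp_arg u).symm⟩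
    · by_contra hle
      exact hc'.not_ge (Real.cos_nonneg_of_neg_pi_div_two_le_of_le (by linarith [Real.pi_pos])
        (not_lt.1 hle))
    · by_contra hle
      rw [← Real.cos_two_pi_sub] at hc'
      exact hc'.not_ge (Real.cos_nonneg_of_neg_pi_div_two_le_of_le (by linarith [Real.pi_pos])
        (by linarith))
  have hpos : (0 : ℤ) < n i + 1 := by positivity
  have h0 := Int.emod_nonneg (β - β₀) hpos.ne'
  have h1 := Int.emod_lt_of_pos (β - β₀) hpos
  refine ⟨((β - β₀) % (n i + 1)).toNat, by omega, ?_⟩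
  rw [Int.toNat_of_nonneg h0, ← C.inArc_add_iff ((β - β₀) / (n i + 1)), add_assoc,
    Int.emod_add_ediv_mul, add_sub_cancel]
  exact hβ

theorem isOpen_inArc (i : Fin (m + 1)) (β : ℤ) : IsOpen {u | C.InArc z i β u} := by
  convert Circle.isCoveringMap_exp.isLocalHomeomorph.isOpenMap (C.arcAngles z i β) isOpen_Ioo
    using 1
  ext u
  exact exists_congr fun θ => and_congr_right fun _ => eq_comm

/-- A path in the boundary stays in one arc. -/
theorem exists_inArc_of_path (γ : C(unitInterval, C.Blow z)) (hγ : ∀ t, γ t ∈ C.bdry z) :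
    ∃ (i : Fin (m + 1)) (β : ℤ), ∀ t, ∃ u : C.arcs z i, γ t = Blow.boundary i u ∧
      C.InArc z i β u := by
  obtain ⟨i, u₀, hu₀⟩ := hγ 0
  obtain ⟨j, -, hj⟩ := C.exists_inArc i 0 u₀.2
  set β : ℤ := 0 + j
  have hnear : ∀ (t : unitInterval) (i : Fin (m + 1)) (u : C.arcs z i) (β : ℤ),
      γ t = Blow.boundary i u → C.InArc z i β u →
      ∀ᶠ t' in 𝓝 t, ∃ u : C.arcs z i, γ t' = Blow.boundary i u ∧ C.InArc z i β u := by
    intro t i u β htu hu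
    have hO := (C.isOpenEmbedding_collarMap z i).isOpenMap _
      ((C.isOpen_inArc (z := z) i β).preimage (f := fun p : C.Collar z i => p.1.2) (by fun_prop))
    have hmem : γ t ∈ C.collarMap z i '' ((fun p : C.Collar z i => p.1.2) ⁻¹'
        {u | C.InArc z i β u}) := by
      refine ⟨⟨(0, u), le_rfl, C.radius_pos i, fun _ => u.2⟩, hu, ?_⟩
      rw [htu, collarMap_eq_boundary_iff]
      exact ⟨rfl, rfl, rfl⟩
    filter_upwards [γ.continuous.continuousAt.preimage_mem_nhds (hO.mem_nhds hmem)] with t' ht'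
    obtain ⟨p, hp, hpt⟩ := ht'
    obtain ⟨i', u', hu'⟩ := hγ t'
    rw [hu', collarMap_eq_boundary_iff] at hpt
    obtain ⟨-, rfl, h2⟩ := hpt
    exact ⟨u', hu', h2 ▸ hp⟩
  -- Arcs are open and distinct arcs are disjoint, so the times spent in one arc form a clopen
  -- subset of the interval.
  have hclopen : IsClopen {t | ∃ u : C.arcs z i, γ t = Blow.boundary i u ∧ C.InArc z i β u} := by
    constructor
    · rw [← isOpen_compl_iff, isOpen_iff_mem_nhds]
      intro t ht
      obtain ⟨i', u, hu⟩ := hγ t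
      obtain ⟨j', -, hj'⟩ := C.exists_inArc i' 0 u.2
      filter_upwards [hnear t i' u _ hu hj'] with t' ht' h
      obtain ⟨v, hv, hvβ⟩ := ht'
      obtain ⟨v', hv', hvβ'⟩ := h
      rw [hv] at hv'
      injection hv' with h1 h2
      subst h1
      rw [← eq_of_heq h2] at hvβ'
      obtain ⟨l, hl⟩ := hvβ'.eq_add C hvβ
      refine ht ⟨u, hu, ?_⟩
      rwa [hl, C.inArc_add_iff] at hj'
    · rw [isOpen_iff_mem_nhds]
      rintro t ⟨u, hu, huβ⟩
      exact hnear t i u β hu huβ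
  refine ⟨i, β, fun t => ?_⟩
  have h := hclopen.eq_univ ⟨0, u₀, hu₀, hj⟩
  exact (h ▸ mem_univ t : t ∈ {t | ∃ u : C.arcs z i, γ t = Blow.boundary i u ∧ C.InArc z i β u})

/-- Two directions in one arc are joined inside the boundary by interpolating their angles, and `ψ`
vanishes on that path. -/
theorem exists_arc_value (hz : z ≠ 0) {ψ : C(unitInterval, C.Blow z) → M}
    (hA : ∀ γ : C(unitInterval, C.Blow z), (∀ t, γ t ∈ C.bdry z) → ψ γ = 0) {h : C.Blow z → M}
    (hh : ∀ γ, ψ γ = h (γ 1) - h (γ 0)) (i : Fin (m + 1)) (β : ℤ) :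
    ∃ v, ∀ u : C.arcs z i, C.InArc z i β u → h (Blow.boundary i u) = v := by
  by_cases hne : ∃ u : C.arcs z i, C.InArc z i β u
  · obtain ⟨u₀, θ₀, hθ₀, h0⟩ := hne
    refine ⟨h (Blow.boundary i u₀), ?_⟩
    rintro u ⟨θ, hθ, hu⟩
    have hs : ∀ t, Circle.exp (segPath θ₀ θ t) ∈ C.arcs z i := fun t =>
      InArc.mem_arcs C hz ⟨_, segPath_mem (K := C.arcAngles z i β) (convex_Ioo _ _) hθ₀ hθ t, rfl⟩
    let γ : C(unitInterval, C.Collar z i) :=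
      ⟨fun t => ⟨(0, Circle.exp (segPath θ₀ θ t)), le_rfl, C.radius_pos i, fun _ => hs t⟩,
        by fun_prop⟩
    have h1 := hA ((ContinuousMap.mk _ (C.continuous_collarMap z i)).comp γ) fun t =>
      C.collarMap_mem_bdry z i _ rfl
    rw [hh, sub_eq_zero] at h1
    have e0 : C.collarMap z i (γ 0) = Blow.boundary i u₀ :=
      (C.collarMap_eq_boundary_iff z).2 ⟨rfl, rfl, by simp [γ, segPath_zero, h0]⟩
    have e1 : C.collarMap z i (γ 1) = Blow.boundary i u :=
      (C.collarMap_eq_boundary_iff z).2 ⟨rfl, rfl, by simp [γ, segPath_one, hu]⟩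
    rw [← e0, ← e1]
    exact h1
  · exact ⟨0, fun u hu => absurd ⟨u, hu⟩ hne⟩

/-! ### The contours generate -/

theorem collar_eq_boundary {i : Fin (m + 1)} (p : C.Collar z i) (hp : p.1.1 = 0) :
    C.collarMap z i p = Blow.boundary i ⟨p.1.2, p.2.2.2 hp⟩ :=
  (C.collarMap_eq_boundary_iff z).2 ⟨hp, rfl, rfl⟩

variable {C}

/-- The paths `T` chain the arcs `0, …, n i` at each pole, and the paths `W` tie arc `0` of every
other pole to arc `0` at `∞_0`. -/
theorem ContourSystem.const_on_bdry {g : ℕ} (hz : z ≠ 0) (S : C.ContourSystem g z)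
    {ψ : C(unitInterval, C.Blow z) → M}
    (hA : ∀ γ : C(unitInterval, C.Blow z), (∀ t, γ t ∈ C.bdry z) → ψ γ = 0) {h : C.Blow z → M}
    (hh : ∀ γ, ψ γ = h (γ 1) - h (γ 0)) (hw : ∀ i, ψ (S.w i).toContinuousMap = 0)
    (ht : ∀ i α, ψ ((S.t i α).map (C.continuous_collarMap z i)).toContinuousMap = 0) :
    ∃ c, ∀ a ∈ C.bdry z, h a = c := by
  choose v hv using C.exists_arc_value hz hA hh
  have hT : ∀ i (α : ℕ), α < n i → v i (S.firstSheet i + α) = v i (S.firstSheet i + α + 1) := by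
    intro i α hα
    have h1 := ht i ⟨α, hα⟩
    rw [hh, sub_eq_zero] at h1
    have e1 : ((S.t i ⟨α, hα⟩).map (C.continuous_collarMap z i)).toContinuousMap 1 = _ :=
      ((S.t i ⟨α, hα⟩).map (C.continuous_collarMap z i)).target
    have e0 : ((S.t i ⟨α, hα⟩).map (C.continuous_collarMap z i)).toContinuousMap 0 = _ :=
      ((S.t i ⟨α, hα⟩).map (C.continuous_collarMap z i)).source
    have f0 := S.t_angle i ⟨α, hα⟩ 0
    have f1 := S.t_angle i ⟨α, hα⟩ 1
    rw [(S.t i ⟨α, hα⟩).source] at f0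
    rw [(S.t i ⟨α, hα⟩).target] at f1
    rw [e0, e1, C.collar_eq_boundary _ (S.tEnd_radius i ⟨α, hα⟩),
      C.collar_eq_boundary _ (S.tStart_radius i ⟨α, hα⟩),
      hv i _ _ ⟨_, S.tAngle_end i ⟨α, hα⟩, f1⟩, hv i _ _ ⟨_, S.tAngle_start i ⟨α, hα⟩, f0⟩] at h1
    exact h1.symm
  have hT' : ∀ i (j : ℕ), j ≤ n i → v i (S.firstSheet i + j) = v i (S.firstSheet i) := by
    intro i j
    induction j with
    | zero => simp
    | succ j ih =>
      intro hj
      rw [← ih (Nat.le_of_succ_le hj), hT i j hj]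
      push_cast
      rw [add_assoc]
  have hW : ∀ j : Fin m, v j.succ (S.firstSheet j.succ) = v 0 (S.firstSheet 0) := by
    intro j
    have h1 := hw j
    rw [hh, sub_eq_zero] at h1
    have e1 : (S.w j).toContinuousMap 1 = _ := (S.w j).target
    have e0 : (S.w j).toContinuousMap 0 = _ := (S.w j).source
    rwa [e0, e1, hv _ _ _ (S.wStart_mem j), hv _ _ _ (S.wEnd_mem j)] at h1
  refine ⟨v 0 (S.firstSheet 0), ?_⟩
  rintro _ ⟨i, u, rfl⟩
  obtain ⟨j, hj, hu⟩ := C.exists_inArc i (S.firstSheet i) u.2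
  rw [hv i _ u hu, hT' i j hj]
  refine Fin.cases rfl hW i

/-- A functional that kills the contours has a cocycle without residues and without periods. Its
primitive is constant on the boundary, so the functional is zero. -/
theorem ContourSystem.span_eq_top [T2Space L] [CompactSpace L] [ConnectedSpace L]
    [IsManifold 𝓘(ℂ) ω L] {g : ℕ} (hz : z ≠ 0) (S : C.ContourSystem g z) :
    ⊤ ≤ Submodule.span ℂ (range S.contour) := by
  by_contra hne
  obtain ⟨φ, hφ, hker⟩ := Submodule.exists_le_ker_of_lt_top _ (lt_top_iff_ne_top.2 fun h =>
    hne h.ge)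
  have hφ0 : ∀ k, φ (S.contour k) = 0 := fun k => hker (Submodule.subset_span ⟨k, rfl⟩)
  obtain ⟨ψ, hψ, hA, hloop, hpath, hzero⟩ := exists_cocycle_of_functional φ
  have hX := hψ.comp (ContinuousMap.mk _ (C.continuous_interior z))
  have hres1 : ∀ i : Fin m, ∀ ρ h0 hr, ψ ((ContinuousMap.mk _ (C.continuous_interior z)).comp
      (C.circleLoop i.succ ρ h0 hr).toContinuousMap) = 0 := fun i ρ h0 hr => by
    obtain ⟨k, c, -, -, hc⟩ := C.exists_residue hX i.succ
    rw [hc ρ h0 hr, ← hc _ (S.vRadius_pos i) (S.vRadius_lt i)]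
    have := hφ0 (.inr (.inl i))
    rw [ContourSystem.contour, hloop] at this
    exact this
  have hres : ∀ i ρ h0 hr, ψ ((ContinuousMap.mk _ (C.continuous_interior z)).comp
      (C.circleLoop i ρ h0 hr).toContinuousMap) = 0 := by
    refine Fin.cases (fun ρ h0 hr => ?_) hres1
    have hsum := C.sum_residue_eq_zero hX (ρ := fun i => C.radius i / 2)
      (fun i => half_pos (C.radius_pos i)) fun i => half_lt_self (C.radius_pos i)
    rw [Fin.sum_univ_succ] at hsum
    simp only [hres1, Finset.sum_const_zero, add_zero] at hsum
    obtain ⟨k, c, -, -, hc⟩ := C.exists_residue hX 0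
    rw [hc ρ h0 hr]
    rwa [hc] at hsum
  obtain ⟨Ψ, hΨ, hΨX⟩ := C.exists_extension hX hres
  obtain ⟨B, hB⟩ := S.homologyBasis
  have := ChartedSpace.locallyPathConnectedSpace ℂ L
  have : PathConnectedSpace L := pathConnectedSpace_iff_connectedSpace.2 inferInstance
  obtain ⟨h, hh⟩ := hΨ.exists_prim_of_loops fun p γ => hΨ.loop_eq_zero_of_basis B (fun k => by
    rcases k with k | k
    · rw [congrFun hB, Sum.elim_inl, homologyFunctional_loopClass]
      have := hφ0 (.inl (.inl k))
      rw [ContourSystem.contour, hloop] at this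
      exact (hΨX (S.a k).toContinuousMap).trans this
    · rw [congrFun hB, Sum.elim_inr, homologyFunctional_loopClass]
      have := hφ0 (.inl (.inr k))
      rw [ContourSystem.contour, hloop] at this
      exact (hΨX (S.b k).toContinuousMap).trans this) γ
  obtain ⟨H, hH⟩ := C.exists_prim_blow z hψ (h := fun P => h P) fun γ => by
    rw [← hh ⟨fun t => (γ t : L), by fun_prop⟩ |>.symm.trans (hΨX γ)]
    rfl
  obtain ⟨c, hc⟩ := S.const_on_bdry hz hA hH (fun i => by
    exact (hpath _ _ ⟨_, _, rfl⟩ ⟨_, _, rfl⟩ (S.w i)).symm.trans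
      (hφ0 (.inr (.inr (.inl i))))) fun i α => by
    exact (hpath _ _ (C.collarMap_mem_bdry z i _ (S.tStart_radius i α))
      (C.collarMap_mem_bdry z i _ (S.tEnd_radius i α)) _).symm.trans
      (hφ0 (.inr (.inr (.inr ⟨i, α⟩))))
  exact hφ (hzero H c hH hc)

end HurwitzCovering

/-! ### Families of logarithms with prescribed winding numbers -/

section Winding

/-- Two continuous logarithms of one function differ by an integral multiple of `2πi`, which is zero
at `x` and hence nearby. -/
theorem Complex.eventually_eq_of_exp_eq {X : Type*} [TopologicalSpace X] {a b : X → ℂ} {x : X}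
    (ha : ContinuousAt a x) (hb : ContinuousAt b x)
    (he : ∀ᶠ x' in 𝓝 x, Complex.exp (a x') = Complex.exp (b x')) (h : a x = b x) :
    ∀ᶠ x' in 𝓝 x, a x' = b x' := by
  have hc : Tendsto (fun x' => (a x' - b x').im) (𝓝 x) (𝓝 0) := by
    have := Complex.continuous_im.continuousAt.comp (ha.sub hb)
    simpa [ContinuousAt, Function.comp_def, h] using this
  filter_upwards [he, hc.eventually (Ioo_mem_nhds (neg_lt_zero.2 Real.pi_pos) Real.pi_pos)]
    with x' h1 h2
  have h3 := Complex.log_exp h2.1 h2.2.le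
  rw [Complex.exp_sub, h1, div_self (Complex.exp_ne_zero _), Complex.log_one] at h3
  exact sub_eq_zero.1 h3.symm

/-- The logarithm of a function with a zero or pole of order `d` at `y`, in terms of a local
parameter `w`. -/
theorem eventually_log_div_eq {X : Type*} [TopologicalSpace X] [T1Space X] {F w h : X → ℂ} {y : X}
    {d : ℤ} (hw : ∀ᶠ x in 𝓝[≠] y, ContinuousAt w x ∧ w x ≠ 0)
    (hh : ∀ᶠ x in 𝓝 y, ContinuousAt h x) (h0 : h y ≠ 0)
    (hF : ∀ᶠ x in 𝓝[≠] y, F x = w x ^ d * h x) :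
    ∀ᶠ x in 𝓝[≠] y, F x ≠ 0 ∧ ∀ᶠ x' in 𝓝 x, Complex.log (F x' / F x) =
      d * Complex.log (w x' / w x) + (Complex.log (h x' / h y) - Complex.log (h x / h y)) := by
  have hs : ∀ᶠ x in 𝓝[≠] y, h x / h y ∈ Complex.slitPlane :=
    mem_nhdsWithin_of_mem_nhds <| (hh.self_of_nhds.div_const (h y)).preimage_mem_nhds
      (Complex.isOpen_slitPlane.mem_nhds (by
        rw [div_self h0]
        exact Complex.one_mem_slitPlane))
  filter_upwards [hw, hh.filter_mono nhdsWithin_le_nhds, hF, hs,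
    eventually_nhdsNE_eventually_nhds_iff.2 hw, eventually_nhdsNE_eventually_nhds_iff.2 hF,
    eventually_nhdsNE_eventually_nhds_iff.2 hs] with x hwx hhx hFx hsx hw' hF' hs'
  have hhx0 : h x ≠ 0 := fun h => Complex.slitPlane_ne_zero hsx (by rw [h, zero_div])
  have hFx0 : F x ≠ 0 := hFx ▸ mul_ne_zero (zpow_ne_zero _ hwx.2) hhx0
  have hFc : ContinuousAt F x :=
    ((hwx.1.zpow₀ d (.inl hwx.2)).mul hhx).congr (hF'.mono fun _ h => h.symm)
  have hone : ∀ {G : X → ℂ}, ContinuousAt G x → G x ≠ 0 →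
      ContinuousAt (fun x' => Complex.log (G x' / G x)) x := fun hG h0 =>
    (hG.div_const _).clog (by rw [div_self h0]; exact Complex.one_mem_slitPlane)
  refine ⟨hFx0, Complex.eventually_eq_of_exp_eq (hone hFc hFx0) ((continuousAt_const.mul
    (hone hwx.1 hwx.2)).add (((hhx.div_const _).clog hsx).sub continuousAt_const)) ?_ ?_⟩
  · filter_upwards [hw', hF', hs'] with x' h1 h2 h3
    have h4 : h x' ≠ 0 := fun h => Complex.slitPlane_ne_zero h3 (by rw [h, zero_div])
    rw [Complex.exp_add, Complex.exp_sub, Complex.exp_int_mul, Complex.exp_log,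
      Complex.exp_log (div_ne_zero h1.2 hwx.2), Complex.exp_log (div_ne_zero h4 h0),
      Complex.exp_log (div_ne_zero hhx0 h0), h2, hFx, div_zpow]
    · field_simp [zpow_ne_zero d hwx.2]
    · exact div_ne_zero (h2 ▸ mul_ne_zero (zpow_ne_zero _ h1.2) h4) hFx0
  · simp [div_self hFx0, div_self hwx.2]

theorem eventually_coord_ne {X : Type*} [TopologicalSpace X] [T1Space X]
    (e : OpenPartialHomeomorph X ℂ) {y : X} (hy : y ∈ e.source) :
    ∀ᶠ x in 𝓝[≠] y, ContinuousAt (fun x => e x - e y) x ∧ e x - e y ≠ 0 := by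
  filter_upwards [mem_nhdsWithin_of_mem_nhds (e.open_source.mem_nhds hy), self_mem_nhdsWithin]
    with x hx hne
  exact ⟨(e.continuousAt hx).sub continuousAt_const, sub_ne_zero.2 fun h => hne (e.injOn hx hy h)⟩

/-! ### Coordinate changes and logarithms with a prescribed divisor. -/

variable {L : Type*} [TopologicalSpace L] [ChartedSpace ℂ L]

/-- The chart at `y`, centred at `y`. -/
def centeredChart (y x : L) : ℂ := chartAt ℂ y x - chartAt ℂ y y

/-- Two holomorphic coordinates differ by an invertible factor. -/
theorem exists_coord_factor [IsManifold 𝓘(ℂ) ω L] {e e' : OpenPartialHomeomorph L ℂ}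
    (he : e ∈ IsManifold.maximalAtlas 𝓘(ℂ) ω L) (he' : e' ∈ IsManifold.maximalAtlas 𝓘(ℂ) ω L)
    {y : L} (hy : y ∈ e.source) (hy' : y ∈ e'.source) :
    ∃ h : L → ℂ, (∀ᶠ x in 𝓝 y, ContinuousAt h x) ∧ h y ≠ 0 ∧
      ∀ᶠ x in 𝓝 y, e x - e y = (e' x - e' y) * h x := by
  have hdiff : ∀ {e e' : OpenPartialHomeomorph L ℂ}, e ∈ IsManifold.maximalAtlas 𝓘(ℂ) ω L →
      e' ∈ IsManifold.maximalAtlas 𝓘(ℂ) ω L → y ∈ e.source → y ∈ e'.source →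
      DifferentiableAt ℂ (e ∘ e'.symm) (e' y) := by
    intro e e' he he' hy hy'
    have h1 : MDifferentiableAt 𝓘(ℂ) 𝓘(ℂ) e (e'.symm (e' y)) := by
      rw [e'.left_inv hy']
      exact (contMDiffAt_of_mem_maximalAtlas he hy).mdifferentiableAt (by simp)
    have h2 : MDifferentiableAt 𝓘(ℂ) 𝓘(ℂ) e'.symm (e' y) :=
      ((contMDiffOn_symm_of_mem_maximalAtlas he').contMDiffAt
        (e'.open_target.mem_nhds (e'.map_source hy'))).mdifferentiableAt (by simp)
    exact mdifferentiableAt_iff_differentiableAt.1 (h1.comp _ h2)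
  have hd := hdiff he he' hy hy'
  have hd' := hdiff he' he hy' hy
  have hne : deriv (e ∘ e'.symm) (e' y) ≠ 0 := by
    intro h0
    have hid : (e' ∘ e.symm) ∘ (e ∘ e'.symm) =ᶠ[𝓝 (e' y)] id := by
      have hc : ContinuousAt e'.symm (e' y) := e'.continuousAt_symm (e'.map_source hy')
      filter_upwards [e'.open_target.mem_nhds (e'.map_source hy'), hc.preimage_mem_nhds
        (e.open_source.mem_nhds (by rwa [e'.left_inv hy']))] with w h1 h2
      simp only [Function.comp_apply, id]
      rw [e.left_inv h2, e'.right_inv h1]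
    have hval : (e ∘ e'.symm) (e' y) = e y := by simp [e'.left_inv hy']
    have h1 := deriv_comp (e' y) (hval ▸ hd') hd
    rw [h0, mul_zero, hid.deriv_eq, deriv_id] at h1
    exact one_ne_zero h1
  -- The factor is the difference quotient of the coordinate change, continued by the nonzero
  -- derivative at `y`.
  refine ⟨fun x => dslope (e ∘ e'.symm) (e' y) (e' x), ?_, ?_, ?_⟩
  · filter_upwards [e.open_source.mem_nhds hy, e'.open_source.mem_nhds hy'] with x hx hx'
    refine ContinuousAt.comp (g := dslope (e ∘ e'.symm) (e' y)) ?_ (e'.continuousAt hx')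
    by_cases hxy : e' x = e' y
    · rw [hxy, continuousAt_dslope_same]
      exact hd
    · rw [continuousAt_dslope_of_ne hxy]
      refine ContinuousAt.comp ?_ (e'.continuousAt_symm (e'.map_source hx'))
      rw [e'.left_inv hx']
      exact e.continuousAt hx
  · beta_reduce
    rwa [dslope_same]
  · filter_upwards [e'.open_source.mem_nhds hy'] with x hx'
    rw [← smul_eq_mul, sub_smul_dslope]
    simp [e'.left_inv hy', e'.left_inv hx']

/-- The family `f` behaves like the logarithms of a function which has order `D y` at every
point `y`. -/
def HasWinding (D : L → ℤ) (f : L → L → ℂ) : Prop :=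
  ∀ y, ∀ᶠ x in 𝓝[≠] y, ∀ᶠ x' in 𝓝 x, f x x' - f x x =
    D y * Complex.log (centeredChart y x' / centeredChart y x) + (f y x' - f y x)

theorem HasWinding.add {D D' : L → ℤ} {f f' : L → L → ℂ} (h : HasWinding D f)
    (h' : HasWinding D' f') :
    HasWinding (fun y => D y + D' y) fun y x => f y x + f' y x := by
  intro y
  filter_upwards [h y, h' y] with x h1 h2
  filter_upwards [h1, h2] with x' h3 h4
  push_cast
  linear_combination h3 + h4

theorem HasWinding.neg {D : L → ℤ} {f : L → L → ℂ} (h : HasWinding D f) :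
    HasWinding (fun y => - D y) fun y x => - f y x := by
  intro y
  filter_upwards [h y] with x h1
  filter_upwards [h1] with x' h3
  push_cast
  linear_combination - h3

open scoped Classical in
/-- The divisor `x - y`. -/
def pointDiff (x y : L) : L → ℤ := fun p => (if p = x then 1 else 0) - if p = y then 1 else 0

/-- In the chart at `y`, `F = (w - a) / w` has divisor `x - y`. For `|w| > |a|` its value `1 - a /
w` stays within distance `1` of `1`, so the principal logarithm is single-valued there and can be
exchanged for zero outside the disc. -/
theorem exists_hasWinding_nearby [T2Space L] [IsManifold 𝓘(ℂ) ω L] (y : L) :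
    ∀ᶠ x in 𝓝 y, ∃ f, HasWinding (pointDiff x y) f := by
  classical
  set φ := chartAt ℂ y with hφ
  have hyφ : y ∈ φ.source := mem_chart_source ℂ y
  obtain ⟨R, hR, hball⟩ := Metric.isOpen_iff.1 φ.open_target _ (φ.map_source hyφ)
  filter_upwards [φ.open_source.mem_nhds hyφ, (φ.continuousAt hyφ).preimage_mem_nhds
    (Metric.ball_mem_nhds _ hR)] with A hAφ hAR
  set w : L → ℂ := fun x => φ x - φ y with hw
  set a := w A with ha
  have haR : ‖a‖ < R := by simpa [dist_eq_norm] using hAR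
  rcases eq_or_ne A y with rfl | hAy
  · exact ⟨0, fun p => by simp [pointDiff]⟩
  have ha0 : a ≠ 0 := sub_ne_zero.2 fun h => hAy (φ.injOn hAφ hyφ h)
  set F : L → ℂ := fun x => (w x - a) / w x with hF
  set U : Set L := φ.source ∩ φ ⁻¹' Metric.ball (φ y) R with hU
  have hUo : IsOpen U := φ.isOpen_inter_preimage Metric.isOpen_ball
  have hmemU : ∀ x ∈ U, ‖w x‖ < R := fun x hx => by simpa [dist_eq_norm] using hx.2
  set K : Set L := φ.symm '' Metric.closedBall (φ y) ‖a‖ with hK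
  have hKt : Metric.closedBall (φ y) ‖a‖ ⊆ φ.target :=
    (Metric.closedBall_subset_ball haR).trans hball
  have hKc : IsClosed K :=
    ((isCompact_closedBall _ _).image_of_continuousOn (φ.continuousOn_symm.mono hKt)).isClosed
  have hKU : K ⊆ U := by
    rintro _ ⟨v, hv, rfl⟩
    refine ⟨φ.map_target (hKt hv), ?_⟩
    rw [mem_preimage, φ.right_inv (hKt hv)]
    exact Metric.closedBall_subset_ball haR hv
  have hmemK : ∀ x ∈ φ.source, x ∉ K → ‖a‖ < ‖w x‖ := by
    intro x hx hxK
    by_contra hle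
    exact hxK ⟨φ x, by simpa [dist_eq_norm] using hle, φ.left_inv hx⟩
  have hwc : ∀ x ∈ U, ContinuousAt w x := fun x hx =>
    (φ.continuousAt hx.1).sub continuousAt_const
  have hwy : ∀ x ∈ U, x ≠ y → w x ≠ 0 := fun x hx h =>
    sub_ne_zero.2 fun h' => h (φ.injOn hx.1 hyφ h')
  have hwA : ∀ x ∈ U, x ≠ A → w x - a ≠ 0 := fun x hx h h' =>
    h (φ.injOn hx.1 hAφ (sub_left_injective (sub_eq_zero.1 h')))
  -- At each point of the disc the zero or pole of `F` is split off, leaving an invertible factor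
  -- whose logarithm is the local member.
  have hlocal : ∀ q, ∃ h : L → ℂ, q ∈ U → (∀ᶠ x in 𝓝 q, ContinuousAt h x) ∧ h q ≠ 0 ∧
      (∀ᶠ x in 𝓝[≠] q, F x = centeredChart q x ^ pointDiff A y q * h x) ∧
      (q ≠ A → q ≠ y → h = F) := by
    intro q
    by_cases hq : q ∈ U
    swap
    · exact ⟨0, fun h => absurd h hq⟩
    have hUq := hUo.mem_nhds hq
    by_cases hqA : q = A
    · subst hqA
      obtain ⟨h, hc, h0, he⟩ := exists_coord_factor
        (IsManifold.chart_mem_maximalAtlas (I := 𝓘(ℂ)) (n := ω) y)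
        (IsManifold.chart_mem_maximalAtlas (I := 𝓘(ℂ)) (n := ω) q) hAφ (mem_chart_source ℂ q)
      refine ⟨fun x => h x / w x, fun _ => ⟨?_, div_ne_zero h0 ha0, ?_, fun h => absurd rfl h⟩⟩
      · filter_upwards [hc, hUq, eventually_ne_nhds hAy] with x h1 h2 h3
        exact h1.div (hwc x h2) (hwy x h2 h3)
      · filter_upwards [he.filter_mono nhdsWithin_le_nhds] with x hx
        have h1 : w x - a = centeredChart q x * h x := by
          rw [centeredChart, ← hx, ha, hw]
          ring
        simp only [hF, h1, pointDiff, if_neg hAy]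
        simp
        ring
    by_cases hqy : q = y
    · subst hqy
      refine ⟨fun x => w x - a, fun _ => ⟨?_, hwA q hq (Ne.symm hAy), .of_forall fun x => ?_,
        fun _ h => absurd rfl h⟩⟩
      · filter_upwards [hUq] with x h1
        exact (hwc x h1).sub continuousAt_const
      · simp only [hF, pointDiff, if_neg hqA, hw, centeredChart, hφ]
        simp
        ring
    · refine ⟨F, fun _ => ⟨?_, div_ne_zero (hwA q hq hqA) (hwy q hq hqy), .of_forall fun x => ?_,
        fun _ _ => rfl⟩⟩
      · filter_upwards [hUq, eventually_ne_nhds hqy] with x h1 h2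
        exact ((hwc x h1).sub continuousAt_const).div (hwc x h1) (hwy x h1 h2)
      · simp [pointDiff, hqA, hqy]
  choose h hh using hlocal
  -- For `q ∉ U` the member may jump at the frontier of `U`. No continuity there is required, since
  -- at nearby `x ∉ U` the member is literally the same function.
  refine ⟨fun q p => if q ∈ U then Complex.log (h q p / h q q) else
    if p ∈ U then Complex.log (F p) else 0, fun q => ?_⟩
  by_cases hq : q ∈ U
  · obtain ⟨h1, h2, h3, h4⟩ := hh q hq
    have hne : ∀ P : L, ∀ᶠ x in 𝓝[≠] q, x ≠ P := fun P => by
      by_cases hP : q = P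
      · rw [← hP]
        exact self_mem_nhdsWithin
      · exact eventually_ne_nhdsWithin hP
    filter_upwards [eventually_log_div_eq (eventually_coord_ne _ (mem_chart_source ℂ q)) h1 h2 h3,
      mem_nhdsWithin_of_mem_nhds (hUo.mem_nhds hq), hne A, hne y] with x h5 hxU hxA hxy
    filter_upwards [h5.2] with x' h6
    have h7 := (hh x hxU).2.2.2 hxA hxy
    simp only [if_pos hq, if_pos hxU, h7, div_self h5.1, Complex.log_one, sub_zero]
    exact h6
  · have hqA : q ≠ A := fun h => hq (h ▸ ⟨hAφ, hAR⟩)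
    have hqy : q ≠ y := fun h => hq (h ▸ ⟨hyφ, Metric.mem_ball_self hR⟩)
    have hD : pointDiff A y q = 0 := by simp [pointDiff, hqA, hqy]
    filter_upwards [mem_nhdsWithin_of_mem_nhds (hKc.isOpen_compl.mem_nhds fun h => hq (hKU h))]
      with x hxK
    rw [hD]
    by_cases hxU : x ∈ U
    swap
    · exact .of_forall fun x' => by simp [hq, hxU]
    have hxA : x ≠ A := fun h => hxK (h ▸ ⟨φ A, by simp [dist_eq_norm, ha, hw], φ.left_inv hAφ⟩)
    have hxy : x ≠ y := fun h => hxK (h ▸ ⟨φ y, by simp, φ.left_inv hyφ⟩)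
    have hFe : ∀ x, x ∈ U → x ∉ K → F x ∈ Complex.slitPlane := fun x hxU hxK => by
      have h1 := hmemK x hxU.1 hxK
      have h2 : 0 < ‖w x‖ := (norm_nonneg _).trans_lt h1
      have h3 : F x = 1 + (-(a / w x)) := by
        simp only [hF]
        rw [sub_div, div_self (norm_pos_iff.1 h2), sub_eq_add_neg]
      rw [h3]
      refine Complex.mem_slitPlane_of_norm_lt_one ?_
      rwa [norm_neg, norm_div, div_lt_one h2]
    have hFc : ContinuousAt F x :=
      ((hwc x hxU).sub continuousAt_const).div (hwc x hxU) (hwy x hxU hxy)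
    have hF0 := Complex.slitPlane_ne_zero (hFe x hxU hxK)
    have hmain := Complex.eventually_eq_of_exp_eq (a := fun x' => Complex.log (F x' / F x))
      (b := fun x' => Complex.log (F x') - Complex.log (F x))
      ((hFc.div_const _).clog (by rw [div_self hF0]; exact Complex.one_mem_slitPlane))
      ((hFc.clog (hFe x hxU hxK)).sub continuousAt_const) (by
        filter_upwards [hUo.mem_nhds hxU, hKc.isOpen_compl.mem_nhds hxK] with x' h1 h2
        have h3 := Complex.slitPlane_ne_zero (hFe x' h1 h2)
        rw [Complex.exp_sub, Complex.exp_log (div_ne_zero h3 hF0), Complex.exp_log h3,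
          Complex.exp_log hF0]) (by simp [div_self hF0])
    filter_upwards [hmain, hUo.mem_nhds hxU] with x' h1 h2
    have h7 := (hh x hxU).2.2.2 hxA hxy
    simp only [if_pos hxU, if_neg hq, h7, div_self hF0, Complex.log_one, sub_zero, if_pos h2, h1]
    simp

theorem exists_hasWinding [T2Space L] [ConnectedSpace L] [IsManifold 𝓘(ℂ) ω L] (x y : L) :
    ∃ f, HasWinding (pointDiff x y) f := by
  have hneg : ∀ x y : L, (∃ f, HasWinding (pointDiff x y) f) → ∃ f, HasWinding (pointDiff y x) f :=
    fun x y ⟨f, hf⟩ => ⟨_, by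
      convert hf.neg using 1
      funext p
      simp [pointDiff]⟩
  have : Std.Symm fun x y : L => ∃ f, HasWinding (pointDiff x y) f := ⟨hneg⟩
  refine PreconnectedSpace.induction₂ (fun x y : L => ∃ f, HasWinding (pointDiff x y) f)
    (fun x => (exists_hasWinding_nearby x).mono fun y => hneg y x) ⟨?_⟩ x y
  rintro x y z ⟨f, hf⟩ ⟨f', hf'⟩
  refine ⟨fun y x => f y x + f' y x, ?_⟩
  convert hf.add hf' using 1
  funext p
  simp only [pointDiff]
  ring

end Winding

/-! ### Cocycles with prescribed residues -/

namespace HurwitzCovering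

variable {L : Type*} [TopologicalSpace L] [ChartedSpace ℂ L] {m : ℕ} {n : Fin (m + 1) → ℕ}
  (C : HurwitzCovering L m n) (z : ℂ)

/-- The map of the blow-up to the surface which collapses the boundary circles. -/
def collapse : C.Blow z → L
  | .interior P => P
  | .boundary i _ => C.pole i

theorem collapse_collarMap {i : Fin (m + 1)} (p : C.Collar z i) :
    C.collapse z (C.collarMap z i p) = C.collarPoint z i p := by
  by_cases h : p.1.1 = 0
  · rw [C.collar_eq_boundary p h, collapse, collarPoint, h, Complex.ofReal_zero, zero_mul,
      ← C.coord_pole i, (C.coord i).left_inv (C.pole_mem i)]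
  · rw [collarMap, dif_neg h]
    rfl

theorem continuous_collapse : Continuous (C.collapse z) := by
  refine continuous_def.2 fun O hO => (C.isOpen_blow_iff z).2 ⟨?_, fun i => ?_⟩
  · exact hO.preimage continuous_subtype_val
  · have : C.collapse z ∘ C.collarMap z i = C.collarPoint z i :=
      funext fun p => C.collapse_collarMap z p
    rw [← preimage_comp, this]
    exact hO.preimage (C.continuous_collarPoint z i)

/-- A branch of the logarithm of the local parameter at `∞_i` over the boundary arcs. -/
def arcLog (d : ℕ) (w : ℂ) : ℂ := - (Complex.log (-(z * (w ^ (d + 1))⁻¹)) / (d + 1))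

/-- The sign in `arcLog` moves the sector `re (z λ) < 0` into the right half-plane, off the cut of
the logarithm; up to a local constant the result is `log w`. -/
theorem arcLog_eventually {d : ℕ} {w : ℂ} (hw : w ≠ 0) (h : (z * (w ^ (d + 1))⁻¹).re < 0) :
    ∀ᶠ w' in 𝓝 w, arcLog z d w' - arcLog z d w = Complex.log (w' / w) := by
  have hs : -(z * (w ^ (d + 1))⁻¹) ∈ Complex.slitPlane := .inl (by simpa using h)
  have hz : z ≠ 0 := fun h0 => by simp [h0] at h
  have hc : ContinuousAt (fun w' : ℂ => -(z * (w' ^ (d + 1))⁻¹)) w :=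
    (continuousAt_const.mul ((continuousAt_id.pow _).inv₀ (pow_ne_zero _ hw))).neg
  have hmain := Complex.eventually_eq_of_exp_eq
    (a := fun w' => Complex.log (-(z * (w' ^ (d + 1))⁻¹)) - Complex.log (-(z * (w ^ (d + 1))⁻¹)))
    (b := fun w' => -(((d + 1 : ℕ) : ℂ) * Complex.log (w' / w)))
    ((hc.clog hs).sub continuousAt_const)
    (continuousAt_const.mul ((continuousAt_id.div_const w).clog (by
      rw [id, div_self hw]; exact Complex.one_mem_slitPlane))).neg (by
      filter_upwards [eventually_ne_nhds hw] with w' hw'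
      have h1 : ∀ v : ℂ, v ≠ 0 → -(z * (v ^ (d + 1))⁻¹) ≠ 0 := fun v hv =>
        neg_ne_zero.2 (mul_ne_zero hz (inv_ne_zero (pow_ne_zero _ hv)))
      rw [Complex.exp_sub, Complex.exp_log (h1 _ hw'), Complex.exp_log (h1 _ hw), Complex.exp_neg,
        Complex.exp_nat_mul, Complex.exp_log (div_ne_zero hw' hw), div_pow]
      have := pow_ne_zero (d + 1) hw
      have := pow_ne_zero (d + 1) hw'
      field_simp) (by simp [div_self hw])
  filter_upwards [hmain] with w' h1
  have h2 : ((d : ℂ) + 1) ≠ 0 := by exact_mod_cast d.succ_ne_zero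
  push_cast at h1
  rw [arcLog, arcLog, neg_sub_neg, ← sub_div, div_eq_iff h2]
  linear_combination -h1

/-- The winding condition refers to the chart at the pole. Passing to the distinguished parameter
costs the logarithm of an invertible factor, which `g` absorbs. -/
theorem exists_log_pole [T2Space L] [IsManifold 𝓘(ℂ) ω L] {D : L → ℤ} {f : L → L → ℂ}
    (hf : HasWinding D f) (i : Fin (m + 1)) : ∃ g : L → ℂ, ∀ᶠ x in 𝓝 (C.pole i),
      x ≠ C.pole i → ∀ᶠ x' in 𝓝 x, f x x' - f x x =
        D (C.pole i) * Complex.log (C.coord i x' / C.coord i x) + (g x' - g x) := by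
  obtain ⟨h, hc, h0, he⟩ := exists_coord_factor
    (IsManifold.chart_mem_maximalAtlas (I := 𝓘(ℂ)) (n := ω) (C.pole i)) (C.coord_mem i)
    (mem_chart_source ℂ (C.pole i)) (C.pole_mem i)
  have h1 := eventually_log_div_eq (F := centeredChart (C.pole i)) (d := 1)
    (eventually_coord_ne _ (C.pole_mem i)) hc h0 (by
      filter_upwards [he.filter_mono nhdsWithin_le_nhds] with x hx
      rw [zpow_one]
      exact hx)
  refine ⟨fun x => D (C.pole i) * Complex.log (h x / h (C.pole i)) + f (C.pole i) x,
    eventually_nhdsWithin_iff.1 ?_⟩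
  filter_upwards [h1, hf (C.pole i)] with x h2 h3
  filter_upwards [h2.2, h3] with x' h4 h5
  rw [h5, h4, C.coord_pole, sub_zero, sub_zero]
  push_cast
  ring

theorem coord_polarPoint (i : Fin (m + 1)) (ρ : ℝ) (h0 : 0 < ρ) (hr : ρ < C.radius i)
    (u : Circle) : C.coord i (C.polarPoint i ρ h0 hr u) = ρ * u := by
  refine (C.coord i).right_inv ?_
  rw [C.coord_target, mem_ball_zero_iff, norm_polar h0.le]
  exact hr

theorem log_exp_div_eventually (ρ : ℝ) (h0 : 0 < ρ) (t : unitInterval) :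
    ∀ᶠ t' in 𝓝 t, Complex.log ((ρ * (Circle.exp (2 * Real.pi * (t' : unitInterval)) : ℂ)) /
      (ρ * (Circle.exp (2 * Real.pi * t) : ℂ))) =
        2 * Real.pi * Complex.I * ((t' : ℝ) - (t : ℝ)) := by
  have hρ : (ρ : ℂ) ≠ 0 := by exact_mod_cast h0.ne'
  refine Complex.eventually_eq_of_exp_eq ?_ (by fun_prop) (.of_forall fun t' => ?_) ?_
  · refine ContinuousAt.clog (by fun_prop) ?_
    rw [div_self (mul_ne_zero hρ (Circle.coe_ne_zero _))]
    exact Complex.one_mem_slitPlane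
  · rw [Complex.exp_log (div_ne_zero (mul_ne_zero hρ (Circle.coe_ne_zero _))
      (mul_ne_zero hρ (Circle.coe_ne_zero _))), mul_div_mul_left _ _ hρ, Circle.coe_exp,
      Circle.coe_exp, ← Complex.exp_sub]
    congr 1
    push_cast
    ring
  · rw [div_self (mul_ne_zero hρ (Circle.coe_ne_zero _))]
    simp

/-- Away from the poles the family has no winding and is coherent. Next to a boundary arc the
logarithm of the local parameter has a single branch, so the family continues to the boundary,
although its residue prevents a continuation to the pole. -/
theorem exists_cocycle_winding [T2Space L] [IsManifold 𝓘(ℂ) ω L] {D : L → ℤ}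
    (hD : ∀ P ∉ range C.pole, D P = 0) {f : L → L → ℂ} (hf : HasWinding D f) :
    ∃ ψ : C(unitInterval, C.Blow z) → ℂ, IsCocycle ψ ∧
      (∀ γ : C(unitInterval, C.Blow z), (∀ t, γ t ∈ C.bdry z) → ψ γ = 0) ∧
      ∀ i ρ h0 hr, ψ ((ContinuousMap.mk _ (C.continuous_interior z)).comp
        (C.circleLoop i ρ h0 hr).toContinuousMap) = 2 * Real.pi * Complex.I * D (C.pole i) := by
  choose g hg using C.exists_log_pole hf
  -- The member at a boundary point depends only on the pole, so coherence between boundary points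
  -- is trivial. The value `0` on the boundary makes the zero function a primitive along boundary
  -- paths.
  let fX : C.Blow z → C.Blow z → ℂ := fun x x' => match x, x' with
    | .interior P, .interior Q => f P Q
    | .boundary i _, .interior Q => D (C.pole i) * arcLog z (n i) (C.coord i Q) + g i Q
    | _, .boundary _ _ => 0
  have hint : ∀ (P : C.Punctured) {p : C.Blow z → Prop}, (∀ᶠ x in 𝓝 (Blow.interior P), p x) ↔
      ∀ᶠ Q : C.Punctured in 𝓝 P, p (.interior Q) := fun P p => by
    rw [← (C.isOpenEmbedding_interior z).map_nhds_eq, eventually_map]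
  have hcoh : Coherent fX := by
    rintro (P | ⟨i, u⟩)
    · rw [hint]
      have hL : ∀ᶠ x in 𝓝 (P : L), ∀ᶠ x' in 𝓝 x, f P x' - f x x' = f P x - f x x := by
        have h1 := eventually_nhdsWithin_iff.1 (hf P)
        filter_upwards [h1] with x hx
        by_cases hxP : x = P
        · rw [hxP]
          exact .of_forall fun x' => by simp
        · filter_upwards [hx hxP] with x' hx'
          rw [hD P P.2, Int.cast_zero, zero_mul, zero_add] at hx'
          linear_combination -hx'
      filter_upwards [continuous_subtype_val.continuousAt.eventually hL] with Q hQ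
      rw [hint]
      exact continuous_subtype_val.continuousAt.eventually hQ
    · have hO := (C.isOpenEmbedding_collarMap z i).isOpenMap _
        ((C.isOpen_arcs z i).preimage (f := fun p : C.Collar z i => p.1.2) (by fun_prop))
      have hmem : Blow.boundary i u ∈ C.collarMap z i ''
          ((fun p : C.Collar z i => p.1.2) ⁻¹' (C.arcs z i)) :=
        ⟨⟨(0, u), le_rfl, C.radius_pos i, fun _ => u.2⟩, u.2,
          (C.collarMap_eq_boundary_iff z).2 ⟨rfl, rfl, rfl⟩⟩
      have hcol :=
        ((C.continuous_collapse z).continuousAt (x := Blow.boundary i u)).eventually (hg i)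
      filter_upwards [hO.mem_nhds hmem, hcol] with x hx hx'
      obtain ⟨p, hp, rfl⟩ := hx
      by_cases hp0 : p.1.1 = 0
      · rw [C.collar_eq_boundary p hp0]
        refine .of_forall fun x' => ?_
        rcases x' with Q | ⟨j, v⟩ <;> simp [fX]
      · rw [collapse_collarMap] at hx'
        have hc := C.coord_collarPoint z i p
        have hsrc := C.collarPoint_mem z i p
        obtain ⟨Q, hQ⟩ : ∃ Q : C.Punctured, C.collarMap z i p = .interior Q := by
          rw [collarMap, dif_neg hp0]
          exact ⟨_, rfl⟩
        rw [hQ, hint]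
        rw [((C.collarMap_eq_interior_iff z).1 hQ).2] at hx' hc hsrc
        have hρ : (p.1.1 : ℂ) ≠ 0 := by exact_mod_cast hp0
        have h0 : C.coord i Q ≠ 0 := hc ▸ mul_ne_zero hρ (Circle.coe_ne_zero _)
        have hre : (z * ((C.coord i Q) ^ (n i + 1))⁻¹).re < 0 := by
          have h1 : z * ((C.coord i Q) ^ (n i + 1))⁻¹ =
              (((p.1.1 ^ (n i + 1))⁻¹ : ℝ) : ℂ) * (z * ((p.1.2 : ℂ) ^ (n i + 1))⁻¹) := by
            rw [hc]
            push_cast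
            rw [mul_pow, mul_inv]
            ring
          rw [h1, Complex.re_ofReal_mul]
          exact mul_neg_of_pos_of_neg
            (inv_pos.2 (pow_pos (lt_of_le_of_ne p.2.1 (Ne.symm hp0)) _)) hp
        have h2 := ((C.coord i).continuousAt hsrc).eventually (arcLog_eventually z h0 hre)
        filter_upwards [continuous_subtype_val.continuousAt.eventually h2,
          continuous_subtype_val.continuousAt.eventually
            (hx' fun h => Q.2 ⟨i, h.symm⟩)] with Q' h3 h4
        simp only [fX]
        linear_combination (D (C.pole i) : ℂ) * h3 - h4
  obtain ⟨ψ, hψ, -, hval⟩ := hcoh.exists_cocycle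
  refine ⟨ψ, hψ, fun γ hγ => ?_, fun i => ?_⟩
  · rw [hval γ 0 fun t => .of_forall fun t' => ?_, Pi.zero_apply, Pi.zero_apply, sub_zero]
    obtain ⟨i, u, hu⟩ := hγ t
    obtain ⟨j, v, hv⟩ := hγ t'
    simp [hu, hv, fX]
  · obtain ⟨k, c, -, -, hc⟩ := C.exists_residue
      (hψ.comp (ContinuousMap.mk _ (C.continuous_interior z))) i
    have h0t : (0 : ℂ) ∈ (C.coord i).target :=
      C.coord_pole i ▸ (C.coord i).map_source (C.pole_mem i)
    have hcont := (C.coord i).continuousAt_symm h0t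
    have hs0 : (C.coord i).symm 0 = C.pole i := by
      rw [← C.coord_pole i, (C.coord i).left_inv (C.pole_mem i)]
    rw [ContinuousAt, hs0] at hcont
    obtain ⟨ε, hε, hball⟩ := Metric.eventually_nhds_iff.1 (hcont.eventually (hg i))
    have hm : 0 < min ε (C.radius i) := lt_min hε (C.radius_pos i)
    set ρ := min ε (C.radius i) / 2 with hρ
    have hρ0 : 0 < ρ := half_pos hm
    have hρr : ρ < C.radius i := (half_lt_self hm).trans_le (min_le_right _ _)
    have hρε : ρ < ε := (half_lt_self hm).trans_le (min_le_left _ _)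
    -- The residue does not depend on the radius, so a circle within the range of the expansion at
    -- the pole suffices.
    suffices hsuff : ψ ((ContinuousMap.mk _ (C.continuous_interior z)).comp
        (C.circleLoop i ρ hρ0 hρr).toContinuousMap) = 2 * Real.pi * Complex.I * D (C.pole i) from
      fun ρ' h0 hr => (hc ρ' h0 hr).trans ((hc ρ hρ0 hρr).symm.trans hsuff)
    let γ := C.circleLoop i ρ hρ0 hρr
    rw [hval _ (fun t => 2 * Real.pi * Complex.I * D (C.pole i) * (t : ℝ) + g i (γ t))]
    · rw [γ.source, γ.target]
      simp
    · intro t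
      have h1 := hball (y := ρ * (Circle.exp (2 * Real.pi * (t : ℝ)) : ℂ)) (by
        rwa [dist_zero_right, norm_polar hρ0.le]) fun h => (γ t).2 ⟨i, h.symm⟩
      have h2 : ContinuousAt (fun t' => (γ t' : L)) t := by fun_prop
      filter_upwards [h2.eventually h1, log_exp_div_eventually ρ hρ0 t] with t' h3 h4
      have h5 : ∀ t, C.coord i (γ t) = ρ * (Circle.exp (2 * Real.pi * (t : ℝ)) : ℂ) := fun t =>
        C.coord_polarPoint i ρ hρ0 hρr _
      have h6 : f (γ t) (γ t') - f (γ t) (γ t) = D (C.pole i) *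
        Complex.log (C.coord i (γ t') / C.coord i (γ t)) + (g i (γ t') - g i (γ t)) := h3
      rw [h5, h5, h4] at h6
      change _ - f (γ t) (γ t') = _ - f (γ t) (γ t)
      linear_combination -h6

end HurwitzCovering

/-! ### The contours are independent -/

namespace HurwitzCovering

variable {L M : Type*} [TopologicalSpace L] [ChartedSpace ℂ L] {m : ℕ} {n : Fin (m + 1) → ℕ}
  {C : HurwitzCovering L m n} {z : ℂ} {g : ℕ} (S : C.ContourSystem g z)

/-- The values of a cocycle on the contours. -/
def ContourSystem.value (ψ : C(unitInterval, C.Blow z) → M) : ContourIndex g m n → M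
  | .inl (.inl k) => ψ ((S.a k).map (C.continuous_interior z)).toContinuousMap
  | .inl (.inr k) => ψ ((S.b k).map (C.continuous_interior z)).toContinuousMap
  | .inr (.inl i) => ψ ((C.circleLoop i.succ (S.vRadius i) (S.vRadius_pos i) (S.vRadius_lt i)).map
        (C.continuous_interior z)).toContinuousMap
  | .inr (.inr (.inl i)) => ψ (S.w i).toContinuousMap
  | .inr (.inr (.inr ⟨i, α⟩)) => ψ ((S.t i α).map (C.continuous_collarMap z i)).toContinuousMap

theorem ContourSystem.homologyFunctional_contour {ψ : C(unitInterval, C.Blow z) → ℂ}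
    (hψ : IsCocycle ψ) (hA : ∀ γ : C(unitInterval, C.Blow z), (∀ t, γ t ∈ C.bdry z) → ψ γ = 0)
    (k : ContourIndex g m n) : homologyFunctional ℂ hψ hA (S.contour k) = S.value ψ k := by
  rcases k with (k | k) | i | i | ⟨i, α⟩
  · exact homologyFunctional_loopClass ℂ hψ hA _
  · exact homologyFunctional_loopClass ℂ hψ hA _
  · exact homologyFunctional_loopClass ℂ hψ hA _
  · exact homologyFunctional_pathClass ℂ hψ hA ⟨_, _, rfl⟩ ⟨_, _, rfl⟩ _
  · exact homologyFunctional_pathClass ℂ hψ hA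
      (C.collarMap_mem_bdry z i _ (S.tStart_radius i α))
      (C.collarMap_mem_bdry z i _ (S.tEnd_radius i α)) _

/-- A coefficient of a relation between the contours vanishes if some cocycle detects it. -/
theorem ContourSystem.coeff_eq_zero {c : ContourIndex g m n → ℂ}
    (hc : ∑ k, c k • S.contour k = 0) {ψ : C(unitInterval, C.Blow z) → ℂ}
    (hψ : IsCocycle ψ) (hA : ∀ γ : C(unitInterval, C.Blow z), (∀ t, γ t ∈ C.bdry z) → ψ γ = 0)
    {k : ContourIndex g m n} (h : ∀ k' ≠ k, c k' = 0 ∨ S.value ψ k' = 0)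
    (hk : S.value ψ k ≠ 0) : c k = 0 := by
  have h1 := congrArg (homologyFunctional ℂ hψ hA) hc
  simp only [map_sum, map_smul, map_zero, S.homologyFunctional_contour, smul_eq_mul] at h1
  rw [Finset.sum_eq_single k (fun k' _ hk' => mul_eq_zero.2 (h k' hk')) (by simp)] at h1
  exact (mul_eq_zero.1 h1).resolve_right hk

theorem increment_loop [AddCommGroup M] {Y : Type*} [TopologicalSpace Y] (h : Y → M) {p : Y}
    (γ : Path p p) : h (γ.toContinuousMap 1) - h (γ.toContinuousMap 0) = 0 :=
  sub_eq_zero.2 (congrArg h (γ.target.trans γ.source.symm))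

theorem ContourSystem.exists_ends_t (i : Fin (m + 1)) (α : Fin (n i)) : ∃ u v : C.arcs z i,
    C.InArc z i (S.firstSheet i + (α : ℕ)) u ∧ C.InArc z i (S.firstSheet i + ((α : ℕ) + 1 : ℕ)) v ∧
      ((S.t i α).map (C.continuous_collarMap z i)).toContinuousMap 0 = Blow.boundary i u ∧
      ((S.t i α).map (C.continuous_collarMap z i)).toContinuousMap 1 = Blow.boundary i v := by
  have f0 := S.t_angle i α 0
  have f1 := S.t_angle i α 1
  rw [(S.t i α).source] at f0
  rw [(S.t i α).target] at f1
  refine ⟨_, _, ⟨_, S.tAngle_start i α, f0⟩, ⟨_, ?_, f1⟩,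
    ((S.t i α).map (C.continuous_collarMap z i)).source.trans
      (C.collar_eq_boundary _ (S.tStart_radius i α)),
    ((S.t i α).map (C.continuous_collarMap z i)).target.trans
      (C.collar_eq_boundary _ (S.tEnd_radius i α))⟩
  have := S.tAngle_end i α
  push_cast
  rwa [← add_assoc]

/-- Among `n i + 1` consecutive numbers each arc occurs once. -/
theorem InArc.index_unique {i : Fin (m + 1)} {β : ℤ} {j j' : ℕ} {u : Circle}
    (h : C.InArc z i (β + j) u) (h' : C.InArc z i (β + j') u) (hj : j ≤ n i) (hj' : j' ≤ n i) :
    j = j' := by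
  obtain ⟨l, hl⟩ := h.eq_add C h'
  have h1 : (j' : ℤ) - j = l * (n i + 1) := by linarith
  have h2 : l = 0 := by
    by_contra hne
    have h3 : (1 : ℤ) ≤ |l| := Int.one_le_abs hne
    have h4 : |(j' : ℤ) - j| ≤ n i := by
      rw [abs_le]
      omega
    rw [h1, abs_mul, abs_of_pos (by positivity : (0 : ℤ) < n i + 1)] at h4
    nlinarith
  rw [h2, zero_mul] at h1
  omega

/-! ### Test cocycles and the vanishing of the coefficients. -/

open scoped Classical in
/-- The indicator function of the arcs at `∞_i` with a number satisfying `p`. -/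
def arcIndicator (i : Fin (m + 1)) (p : ℕ → Prop) (x : C.Blow z) : ℂ :=
  if ∃ u : C.arcs z i, x = Blow.boundary i u ∧
    ∃ j : ℕ, j ≤ n i ∧ p j ∧ C.InArc z i (S.firstSheet i + j) u then 1 else 0

/-- A boundary path stays in one arc, on which the indicator is constant; hence its increment
descends to relative homology. -/
theorem arcIndicator_increment (i : Fin (m + 1)) (p : ℕ → Prop) (γ : C(unitInterval, C.Blow z))
    (hγ : ∀ t, γ t ∈ C.bdry z) :
    arcIndicator S i p (γ 1) - arcIndicator S i p (γ 0) = 0 := by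
  obtain ⟨i', β, hβ⟩ := C.exists_inArc_of_path γ hγ
  have key : ∀ s t, (∃ u : C.arcs z i, γ s = Blow.boundary i u ∧
      ∃ j : ℕ, j ≤ n i ∧ p j ∧ C.InArc z i (S.firstSheet i + j) u) →
      ∃ u : C.arcs z i, γ t = Blow.boundary i u ∧
        ∃ j : ℕ, j ≤ n i ∧ p j ∧ C.InArc z i (S.firstSheet i + j) u := by
    rintro s t ⟨u, hu, j, hj, hpj, huj⟩
    obtain ⟨v, hv, hvβ⟩ := hβ s
    obtain ⟨v', hv', hvβ'⟩ := hβ t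
    rw [hu] at hv
    injection hv with h1 h2
    subst h1
    rw [← eq_of_heq h2] at hvβ
    exact ⟨v', hv', j, hj, hpj, (hvβ.iff C hvβ').1 huj⟩
  classical
  rw [arcIndicator, arcIndicator, if_congr ⟨key 1 0, key 0 1⟩ rfl rfl, sub_self]

theorem arcIndicator_of_inArc (i : Fin (m + 1)) (p : ℕ → Prop) [DecidablePred p] {u : C.arcs z i}
    {j : ℕ} (hj : j ≤ n i) (hu : C.InArc z i (S.firstSheet i + j) u) :
    arcIndicator S i p (Blow.boundary i u) = if p j then 1 else 0 := by
  rw [arcIndicator]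
  congr 1
  rw [eq_iff_iff]
  constructor
  · rintro ⟨v, hv, j', hj', hp, hv'⟩
    injection hv with h1 h2
    rw [← h2] at hv'
    rwa [hu.index_unique hv' hj hj']
  · exact fun hp => ⟨u, rfl, j, hj, hp, hu⟩

theorem arcIndicator_of_ne {i i' : Fin (m + 1)} (h : i ≠ i') (p : ℕ → Prop) (u : C.arcs z i') :
    arcIndicator S i p (Blow.boundary i' u) = 0 := by
  rw [arcIndicator, if_neg]
  rintro ⟨v, hv, -⟩
  injection hv with h1
  exact h h1.symm

theorem arcIndicator_first (i i' : Fin (m + 1)) (p : ℕ → Prop) [DecidablePred p] {u : C.arcs z i'}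
    (hu : C.InArc z i' (S.firstSheet i') u) :
    arcIndicator S i p (Blow.boundary i' u) = if i = i' ∧ p 0 then 1 else 0 := by
  by_cases h : i = i'
  · subst h
    rw [arcIndicator_of_inArc S i p (Nat.zero_le _) (by simpa using hu)]
    simp
  · rw [arcIndicator_of_ne S h, if_neg fun hp => h hp.1]

/-- The cocycle of increments of the indicator function of some arcs at `∞_i`. -/
def arcCocycle (i : Fin (m + 1)) (p : ℕ → Prop) (γ : C(unitInterval, C.Blow z)) : ℂ :=
  arcIndicator S i p (γ 1) - arcIndicator S i p (γ 0)

theorem value_arcCocycle_w (i : Fin (m + 1)) (p : ℕ → Prop) [DecidablePred p] (j : Fin m) :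
    S.value (arcCocycle S i p) (.inr (.inr (.inl j))) =
      (if i = j.succ ∧ p 0 then 1 else 0) - if i = 0 ∧ p 0 then 1 else 0 := by
  have e1 : (S.w j).toContinuousMap 1 = _ := (S.w j).target
  have e0 : (S.w j).toContinuousMap 0 = _ := (S.w j).source
  rw [ContourSystem.value, arcCocycle, e1, e0, arcIndicator_first S i _ p (S.wStart_mem j),
    arcIndicator_first S i _ p (S.wEnd_mem j)]

theorem value_arcCocycle_t (i : Fin (m + 1)) (p : ℕ → Prop) [DecidablePred p] (i' : Fin (m + 1))
    (α : Fin (n i')) :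
    S.value (arcCocycle S i p) (.inr (.inr (.inr ⟨i', α⟩))) =
      (if i = i' ∧ p (α + 1) then 1 else 0) - if i = i' ∧ p α then 1 else 0 := by
  obtain ⟨u, v, hu, hv, e0, e1⟩ := S.exists_ends_t i' α
  rw [ContourSystem.value, arcCocycle, e1, e0]
  by_cases h : i = i'
  · subst h
    rw [arcIndicator_of_inArc S i p α.2.le hu, arcIndicator_of_inArc S i p α.2 hv]
    simp
  · simp [arcIndicator_of_ne S h, h]

/-- The indicator of the arcs beyond `α` at `∞_i` jumps only along the path from arc `α` to arc `α +
1`. It vanishes on arc `0`, so the paths `W` do not see it. -/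
theorem ContourSystem.coeff_t {c : ContourIndex g m n → ℂ} (hc : ∑ k, c k • S.contour k = 0)
    (i : Fin (m + 1)) (α : Fin (n i)) : c (.inr (.inr (.inr ⟨i, α⟩))) = 0 := by
  refine S.coeff_eq_zero hc (isCocycle_increment (arcIndicator S i fun j => (α : ℕ) < j))
    (arcIndicator_increment S i _) (fun k hk => .inr ?_) ?_
  · rcases k with (k | k) | i' | i' | ⟨i', α'⟩
    · exact increment_loop _ _
    · exact increment_loop _ _
    · exact increment_loop _ _
    · exact (value_arcCocycle_w S i _ i').trans (by simp)
    · refine (value_arcCocycle_t S i _ i' α').trans ?_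
      by_cases h : i = i'
      · subst h
        have hne : (α' : ℕ) ≠ α := fun h => hk (by rw [Fin.ext h])
        have : (α : ℕ) < α' + 1 ↔ (α : ℕ) < α' := by omega
        simp [this]
      · simp [h]
  · exact ne_of_eq_of_ne (value_arcCocycle_t S i _ i α) (by simp)

/-- With all arcs at one pole marked, each path `T` begins and ends at equal values, and only the
path `W` arriving at that pole changes value. -/
theorem ContourSystem.coeff_w {c : ContourIndex g m n → ℂ} (hc : ∑ k, c k • S.contour k = 0)
    (j : Fin m) : c (.inr (.inr (.inl j))) = 0 := by
  refine S.coeff_eq_zero hc (isCocycle_increment (arcIndicator S j.succ fun _ => True))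
    (arcIndicator_increment S _ _) (fun k hk => .inr ?_) ?_
  · rcases k with (k | k) | i' | i' | ⟨i', α'⟩
    · exact increment_loop _ _
    · exact increment_loop _ _
    · exact increment_loop _ _
    · have hne : j ≠ i' := fun h => hk (by rw [h])
      exact (value_arcCocycle_w S _ _ i').trans (by simp [hne])
    · exact (value_arcCocycle_t S _ _ i' α').trans (by simp)
  · exact ne_of_eq_of_ne (value_arcCocycle_w S _ _ j) (by simp)

/-- On the compact surface the circle bounds the coordinate disc, where the cocycle has a primitive.
-/
theorem circleLoop_eq_zero [AddCommGroup M] {ψ : C(unitInterval, L) → M} (hψ : IsCocycle ψ)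
    (i : Fin (m + 1)) (ρ : ℝ) (h0 : 0 < ρ) (hr : ρ < C.radius i) :
    ψ ((C.circleLoop i ρ h0 hr).map continuous_subtype_val).toContinuousMap = 0 := by
  obtain ⟨k, hk⟩ := hψ.exists_prim_of_convex (K := (C.coord i).target)
    (C.coord_target i ▸ convex_ball _ _) (C.coord i).continuousOn_symm
  rw [hk ⟨fun t => ρ * (Circle.exp (2 * Real.pi * (t : ℝ)) : ℂ), by fun_prop⟩ _ (fun t => ?_)
    fun t => rfl]
  · simp
  · rw [C.coord_target, mem_ball_zero_iff]
    exact (norm_polar h0.le _).trans_lt hr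

/-- A coordinate of the integral homology basis, pulled back by the collapse, picks out one cycle
and vanishes on the circles and on the collapsed boundary. Its values on `W` and `T` are unknown,
but those coefficients are already zero. -/
theorem ContourSystem.coeff_ab [ConnectedSpace L] {c : ContourIndex g m n → ℂ}
    (hc : ∑ k, c k • S.contour k = 0) (k : Fin g ⊕ Fin g) : c (.inl k) = 0 := by
  have := ChartedSpace.locallyPathConnectedSpace ℂ L
  have : PathConnectedSpace L := pathConnectedSpace_iff_connectedSpace.2 inferInstance
  obtain ⟨B, hB⟩ := S.homologyBasis
  obtain ⟨ψ, hψ, hval⟩ := exists_cocycle_of_integral_functional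
    ((Int.castAddHom ℂ).comp (B.coord k).toAddMonoidHom)
  have hv : ∀ k', S.value (fun γ => ψ ((ContinuousMap.mk _ (C.continuous_collapse z)).comp γ))
      (.inl k') = if k' = k then 1 else 0 := by
    intro k'
    have h1 : S.value (fun γ => ψ ((ContinuousMap.mk _ (C.continuous_collapse z)).comp γ))
        (.inl k') = (Int.castAddHom ℂ).comp (B.coord k).toAddMonoidHom (B k') := by
      rw [hB]
      rcases k' with k' | k'
      · exact hval _ ((S.a k').map continuous_subtype_val)
      · exact hval _ ((S.b k').map continuous_subtype_val)
    rw [h1]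
    simp [Finsupp.single_apply]
  refine S.coeff_eq_zero hc (hψ.comp (ContinuousMap.mk _ (C.continuous_collapse z)))
    (fun γ hγ => ?_) (fun k' hk' => ?_) (ne_of_eq_of_ne (hv k) (by simp))
  · obtain ⟨i, β, hβ⟩ := C.exists_inArc_of_path γ hγ
    rw [show (ContinuousMap.mk _ (C.continuous_collapse z)).comp γ =
      ContinuousMap.const _ (C.pole i) from ContinuousMap.ext fun t => by
        obtain ⟨u, hu, -⟩ := hβ t
        simp [hu, collapse]]
    exact hψ.const _
  · rcases k' with k' | i | i | ⟨i, α⟩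
    · exact .inr ((hv k').trans (if_neg fun h => hk' (by rw [h])))
    · exact .inr (circleLoop_eq_zero hψ i.succ _ (S.vRadius_pos i) (S.vRadius_lt i))
    · exact .inl (S.coeff_w hc i)
    · exact .inl (S.coeff_t hc i α)

/-- The compensating residue sits at `∞_0`, whose circle is not among the contours, so only one
circle is seen; all the other families have been dealt with. -/
theorem ContourSystem.coeff_v [T2Space L] [ConnectedSpace L] [IsManifold 𝓘(ℂ) ω L]
    {c : ContourIndex g m n → ℂ} (hc : ∑ k, c k • S.contour k = 0) (i : Fin m) :
    c (.inr (.inl i)) = 0 := by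
  obtain ⟨f, hf⟩ := exists_hasWinding (C.pole i.succ) (C.pole 0)
  obtain ⟨ψ, hψ, hA, hval⟩ := C.exists_cocycle_winding z (fun P hP => by
    rw [pointDiff, if_neg fun h => hP ⟨_, h.symm⟩, if_neg fun h => hP ⟨_, h.symm⟩, sub_zero]) hf
  have hv : ∀ j, S.value ψ (.inr (.inl j)) =
      2 * Real.pi * Complex.I * (if j = i then 1 else 0) := by
    intro j
    refine (hval _ _ (S.vRadius_pos j) (S.vRadius_lt j)).trans ?_
    simp [pointDiff, C.pole_injective.eq_iff]
  refine S.coeff_eq_zero hc hψ hA (fun k hk => ?_) (ne_of_eq_of_ne (hv i) (by simp))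
  rcases k with k | j | j | ⟨j, α⟩
  · exact .inl (S.coeff_ab hc k)
  · exact .inr ((hv j).trans (by rw [if_neg fun h => hk (by rw [h]), mul_zero]))
  · exact .inl (S.coeff_w hc j)
  · exact .inl (S.coeff_t hc j α)

theorem ContourSystem.linearIndependent [T2Space L] [ConnectedSpace L] [IsManifold 𝓘(ℂ) ω L] :
    LinearIndependent ℂ S.contour := by
  rw [Fintype.linearIndependent_iff]
  rintro c hc (k | j | j | ⟨j, α⟩)
  · exact S.coeff_ab hc k
  · exact S.coeff_v hc j
  · exact S.coeff_w hc j
  · exact S.coeff_t hc j α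

end HurwitzCovering

end

theorem mainTheorem12 {L : Type*} [TopologicalSpace L] [T2Space L] [CompactSpace L]
    [ConnectedSpace L] [ChartedSpace ℂ L] [IsManifold 𝓘(ℂ) ω L]
    {g m : ℕ} {n : Fin (m + 1) → ℕ} (C : HurwitzCovering L m n) (z : ℂ) (hz : z ≠ 0)
    (S : C.ContourSystem g z) :
    ∃ B : Module.Basis (ContourIndex g m n) ℂ (C.LambdaStar z), ⇑B = S.contour :=
  ⟨Module.Basis.mk S.linearIndependent (S.span_eq_top hz), Module.Basis.coe_mk _ _⟩
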